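/- Let $\mathbb K$ be a field of characteristic $0$ and $V=\bigoplus_{i\in\mathbb Z}V^i$ a graded vector space over $\mathbb K$. For $n\ge 1$ let $\mathfrak p_n:\otimes^nV\to V$ be a homogeneous linear map of degree $n-2$. **Conventions.** $\epsilon(\sigma)=\epsilon(\sigma;x_1,\dots,x_n)$ is the Koszul sign. The symmetric group $\mathbb S_n$ acts on $\otimes^nV$ from the right by $\rho^{(1)}_\sigma(x_1\otimes\cdots\otimes x_n)=\epsilon(\sigma)\,x_{\sigma(1)}\otimes\cdots\otimes x_{\sigma(n)}$ and by $\rho^{(2)}_\sigma=\operatorname{sgn}(\sigma)\rho^{(1)}_\sigma$; put $\rho^{(k)}_{w_n}=\sum_{\sigma\in\mathbb S_n}\rho^{(k)}_\sigma$. $I_m$ is the identity of $\otimes^mV$, and $(f\otimes g)(x\otimes y)=(-1)^{|g||x|}f(x)\otimes g(y)$. $\wedge^nV$ is the space of coinvariants of $\otimes^nV$ under $\rho^{(1)}$. The suspension is $(sV)^i=V^{i-1}$, and $\hat{\mathfrak p}_n:\otimes^n(sV)\to sV$ is the degree $-1$ map $$\hat{\mathfrak p}_n(sx_1,\dots,sx_n)=\begin{cases}(-1)^{|x_1|+|x_3|+\cdots+|x_{n-1}|}\,s\,\mathfrak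 p_n(x_1,\dots,x_n),& n\text{ even},\\ -(-1)^{|x_2|+|x_4|+\cdots+|x_{n-1}|}\,s\,\mathfrak p_n(x_1,\dots,x_n),& n\text{ odd}.\end{cases}$$ For a graded vector space $W$, the cofree left Perm-coalgebra is $P^*W=\bigoplus_{n\ge1}P^nW$, $P^nW=(\wedge^{n-1}W)\otimes W$, with $$\Delta(x_1\wedge\cdots\wedge x_{n-1}\otimes x_n)=\sum_{i=1}^{n-1}\ \sum_{\sigma\in Sh(i-1,1,n-i-1)}\epsilon(\sigma)\,(x_{\sigma(1)}\wedge\cdots\wedge x_{\sigma(i-1)}\otimes x_{\sigma(i)})\otimes(x_{\sigma(i+1)}\wedge\cdots\wedge x_{\sigma(n-1)}\otimes x_n),$$ where $Sh(i-1,1,n-i-1)\subset\mathbb S_{n-1}$ is the set of unshuffles (permutations increasing on the consecutive blocks of these sizes). A coderivation is a homogeneous linear map $f:P^*W\to P^*W$ with $\Delta f=(f\otimes\mathrm{Id}+\mathrm{Id}\otimes f)\Delta$. A family of degree $-1$ maps $\hat{\mathfrak q}_n:P^nW\to W$ induces $\tilde{\mathfrak q}:P^*W\to P^*W$ with components $P^kW\to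 P^lW$ ($1\le l\le k$) $$\frac1{(l-1)!(k-l)!}\Big(\sum_{i=0}^{l-2}I_i\wedge\hat{\mathfrak q}_{k-l+1}\wedge I_{l-i-2}\otimes I_1+I_{l-1}\otimes\hat{\mathfrak q}_{k-l+1}\Big)\circ(\rho^{(1)}_{w_{k-1}}\otimes I_1).$$ **Theorem.** The following are equivalent. 1. For all $n\ge1$, $\mathfrak p_n=\mathfrak p_n\circ(\rho^{(2)}_\sigma\otimes I_1)$ for every $\sigma\in\mathbb S_{n-1}$, and $$\sum_{i+j=n+1}\sum_{m=0}^{i-1}\frac{(-1)^{j(i-m-1)+m}}{(i-1)!(j-1)!}\,\mathfrak p_i\circ(I_m\otimes\mathfrak p_j\otimes I_{i-m-1})\circ(\rho^{(2)}_{w_{n-1}}\otimes I_1)=0 .$$ 2. For all $n\ge1$, $\hat{\mathfrak p}_n=\hat{\mathfrak p}_n\circ(\rho^{(1)}_\sigma\otimes I_1)$ for every $\sigma\in\mathbb S_{n-1}$, and $$\sum_{i+j=n+1}\sum_{m=0}^{i-1}\frac{1}{(i-1)!(j-1)!}\,\hat{\mathfrak p}_i\circ(I_m\otimes\hat{\mathfrak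 p}_j\otimes I_{i-m-1})\circ(\rho^{(1)}_{w_{n-1}}\otimes I_1)=0 .$$ 3. Every $\hat{\mathfrak p}_n$ factors through the projection $\otimes^n(sV)\to P^n(sV)$, and the map $\tilde{\mathfrak p}:P^*(sV)\to P^*(sV)$ induced by the resulting maps $P^n(sV)\to sV$ is a coderivation of degree $-1$ with $\tilde{\mathfrak p}^2=0$. (In all sums $i,j\ge1$.) -/

import Mathlib

open scoped TensorProduct DirectSum

namespace PLInf
noncomputable section

/-- The Koszul sign `ε(σ; x₁, …, xₙ)` for homogeneous `xᵢ` of parity `d i`: the product of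
`(-1)^(|x_{σ i}| |x_{σ j}|)` over the inversions `i < j`, `σ j < σ i`. It is the sign with
`x₁ ∧ … ∧ xₙ = ε(σ) x_{σ 1} ∧ … ∧ x_{σ n}`; see `koszulSign_mul` for the cocycle rule. -/
def koszulSign {n : ℕ} (σ : Equiv.Perm (Fin n)) (d : Fin n → ZMod 2) : ℤˣ :=
  ∏ i, ∏ j, if i < j ∧ σ j < σ i then (-1 : ℤˣ) ^ (d (σ i) * d (σ j)) else 1

theorem prod_pairs_perm {n : ℕ} (σ : Equiv.Perm (Fin n)) (f : Fin n → Fin n → ℤˣ)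
    (hf : ∀ i j, f i j = f j i) :
    (∏ i, ∏ j, if i < j then f (σ i) (σ j) else 1) = ∏ i, ∏ j, if i < j then f i j else 1 := by
  rw [← Finset.prod_product', ← Finset.prod_product', ← Finset.prod_filter,
    ← Finset.prod_filter]
  refine Finset.prod_bij'
    (fun q _ => if σ q.1 < σ q.2 then (σ q.1, σ q.2) else (σ q.2, σ q.1))
    (fun q _ => if σ.symm q.1 < σ.symm q.2 then (σ.symm q.1, σ.symm q.2)
      else (σ.symm q.2, σ.symm q.1)) ?_ ?_ ?_ ?_ ?_
  · rintro ⟨i, j⟩ h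
    have h' : i ≠ j := by rintro rfl; simp at h
    have := σ.injective.ne h'
    rcases lt_or_gt_of_ne this with h1 | h1
    · simp [h1]
    · simp [h1, not_lt_of_gt h1]
  · rintro ⟨i, j⟩ h
    have h' : i ≠ j := by rintro rfl; simp at h
    have := σ.symm.injective.ne h'
    rcases lt_or_gt_of_ne this with h1 | h1
    · simp [h1]
    · simp [h1, not_lt_of_gt h1]
  · rintro ⟨i, j⟩ h
    simp at h
    split_ifs <;> simp_all [not_lt_of_gt]
  · rintro ⟨i, j⟩ h
    simp at h
    split_ifs <;> simp_all [not_lt_of_gt]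
  · rintro ⟨i, j⟩ h
    dsimp only
    split_ifs
    · rfl
    · exact hf _ _

/-- The cocycle rule `ε(τσ; x) = ε(τ; x) ε(σ; x ∘ τ)`. -/
theorem koszulSign_mul {n : ℕ} (τ σ : Equiv.Perm (Fin n)) (d : Fin n → ZMod 2) :
    koszulSign (τ * σ) d = koszulSign τ d * koszulSign σ (d ∘ τ) := by
  set f : Fin n → Fin n → ℤˣ := fun u v =>
    if (u < v ∧ τ v < τ u) ∨ (v < u ∧ τ u < τ v) then (-1 : ℤˣ) ^ (d (τ u) * d (τ v)) else 1
    with hf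
  have h1 : koszulSign τ d = ∏ i, ∏ j, if i < j then f i j else 1 := by
    unfold koszulSign
    refine Finset.prod_congr rfl fun i _ => Finset.prod_congr rfl fun j _ => ?_
    simp only [hf]
    by_cases h : i < j
    · simp [h, not_lt_of_gt h]
    · simp [h]
  have hs : ∀ i j, f i j = f j i := by
    intro i j
    simp only [hf, mul_comm (d (τ i)), or_comm]
  rw [h1, ← prod_pairs_perm σ f hs]
  unfold koszulSign
  rw [← Finset.prod_mul_distrib]
  refine Finset.prod_congr rfl fun i _ => ?_
  rw [← Finset.prod_mul_distrib]
  refine Finset.prod_congr rfl fun j _ => ?_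
  simp only [hf, Equiv.Perm.coe_mul, Function.comp]
  by_cases h : i < j
  · have h1 : σ i ≠ σ j := σ.injective.ne h.ne
    have h2 : τ (σ i) ≠ τ (σ j) := τ.injective.ne h1
    have hsq : ∀ a : ℤˣ, a * a = 1 := Int.units_mul_self
    rcases lt_or_gt_of_ne h1 with h1 | h1 <;> rcases lt_or_gt_of_ne h2 with h2 | h2 <;>
      simp [h, h1, h2, not_lt_of_gt h1, not_lt_of_gt h2, hsq]
  · simp [h]

theorem koszulSign_viaEmbedding {m n : ℕ} (e : Fin m ↪ Fin n) (hm : StrictMono e)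
    (he : ∀ i j k, e i ≤ k → k ≤ e j → k ∈ Set.range e) (σ : Equiv.Perm (Fin m))
    (d : Fin n → ZMod 2) :
    koszulSign (σ.viaEmbedding e) d = koszulSign σ (d ∘ e) := by
  have hin : ∀ i, σ.viaEmbedding e (e i) = e (σ i) := fun i =>
    Equiv.Perm.viaEmbedding_apply σ e i
  have hout : ∀ k, k ∉ Set.range e → σ.viaEmbedding e k = k := fun k hk =>
    Equiv.Perm.viaEmbedding_apply_of_notMem σ e k hk
  unfold koszulSign
  symm
  refine Fintype.prod_of_injective e e.injective _ _ ?_ ?_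
  · intro i hi
    refine Finset.prod_eq_one fun j _ => if_neg ?_
    rw [hout i hi]
    rintro ⟨h1, h2⟩
    by_cases hj : j ∈ Set.range e
    · obtain ⟨j, rfl⟩ := hj
      rw [hin] at h2
      exact hi (he _ _ _ h2.le h1.le)
    · rw [hout j hj] at h2
      exact absurd h1 (not_lt_of_gt h2)
  · intro i
    refine Fintype.prod_of_injective e e.injective _ _ ?_ ?_
    · intro j hj
      refine if_neg ?_
      rw [hin, hout j hj]
      rintro ⟨h1, h2⟩
      exact hj (he _ _ _ h1.le h2.le)
    · intro j
      simp only [hin, Function.comp, hm.lt_iff_lt]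

theorem map_zsmul_unit {A B F : Type*} [AddCommGroup A] [AddCommGroup B] [FunLike F A B]
    [AddMonoidHomClass F A B] (f : F) (e : ℤˣ) (a : A) : f (e • a) = e • f a := by
  rw [Units.smul_def, Units.smul_def, map_zsmul]

variable {K V W : Type*} [Field K] [AddCommGroup V] [Module K V] [AddCommGroup W] [Module K W]

/-- The projection of a `ℤ`-graded vector space `V = ⨁ 𝒱 i` onto the sum of the `𝒱 i` with `i`
of parity `a`. -/
def parityProj (𝒱 : ℤ → Submodule K V) [DirectSum.Decomposition 𝒱] (a : ZMod 2) : V →ₗ[K] V :=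
  (DirectSum.toModule K ℤ V fun i => if (i : ZMod 2) = a then (𝒱 i).subtype else 0) ∘ₗ
    (DirectSum.decomposeLinearEquiv 𝒱).toLinearMap

section
variable (𝒱 : ℤ → Submodule K V) [DirectSum.Decomposition 𝒱]

theorem parityProj_of_mem (a : ZMod 2) {i : ℤ} {v : V} (hv : v ∈ 𝒱 i) :
    parityProj 𝒱 a v = if (i : ZMod 2) = a then v else 0 := by
  lift v to 𝒱 i using hv
  simp only [parityProj, LinearMap.comp_apply, LinearEquiv.coe_coe,
    DirectSum.decomposeLinearEquiv_apply, DirectSum.decompose_coe]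
  rw [← DirectSum.lof_eq_of K, DirectSum.toModule_lof]
  split_ifs <;> simp

theorem sum_parityProj (v : V) : ∑ a, parityProj 𝒱 a v = v := by
  induction v using DirectSum.Decomposition.inductionOn 𝒱 with
  | zero => simp
  | homogeneous v => simp [parityProj_of_mem 𝒱 _ v.2]
  | add v w hv hw => simp only [map_add, Finset.sum_add_distrib, hv, hw]

theorem parityProj_parityProj (a b : ZMod 2) (v : V) :
    parityProj 𝒱 a (parityProj 𝒱 b v) = if a = b then parityProj 𝒱 b v else 0 := by
  induction v using DirectSum.Decomposition.inductionOn 𝒱 with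
  | zero => simp
  | @homogeneous i v =>
    rw [parityProj_of_mem 𝒱 b v.2]
    by_cases h : (i : ZMod 2) = b
    · rw [if_pos h, parityProj_of_mem 𝒱 a v.2, h]
      simp [eq_comm]
    · simp [h]
  | add v w hv hw => rw [map_add, map_add, hv, hw]; split_ifs <;> simp

/-- The multilinear map whose value on homogeneous `x₁, …, xₙ` of parities `d 1, …, d n` is
`F d (x₁, …, xₙ)` (see `gradedExt_apply_of_mem`). It serves to write down linear maps involving
signs that depend on the degrees of homogeneous elements. -/
def gradedExt {n : ℕ} (F : (Fin n → ZMod 2) → MultilinearMap K (fun _ : Fin n => V) W) :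
    MultilinearMap K (fun _ : Fin n => V) W :=
  ∑ d, (F d).compLinearMap fun i => parityProj 𝒱 (d i)

variable {𝒱}

theorem gradedExt_apply {n : ℕ} (F : (Fin n → ZMod 2) → MultilinearMap K (fun _ : Fin n => V) W)
    {d : Fin n → ZMod 2} {x : Fin n → V} (hx : ∀ i, parityProj 𝒱 (d i) (x i) = x i) :
    gradedExt 𝒱 F x = F d x := by
  rw [gradedExt, sum_apply, Finset.sum_eq_single d]
  · simp [hx]
  · intro b _ hb
    obtain ⟨i, hi⟩ := Function.ne_iff.1 hb
    rw [MultilinearMap.compLinearMap_apply]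
    refine (F b).map_coord_zero i ?_
    rw [← hx i, parityProj_parityProj, if_neg hi]
  · simp

theorem gradedExt_apply_of_mem {n : ℕ}
    (F : (Fin n → ZMod 2) → MultilinearMap K (fun _ : Fin n => V) W)
    {d : Fin n → ℤ} {x : Fin n → V} (hx : ∀ i, x i ∈ 𝒱 (d i)) :
    gradedExt 𝒱 F x = F (fun i => (d i : ZMod 2)) x :=
  gradedExt_apply F fun i => by simp [parityProj_of_mem 𝒱 _ (hx i)]

theorem units_smul_apply {n : ℕ} (e : ℤˣ) (F : MultilinearMap K (fun _ : Fin n => V) W)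
    (x : Fin n → V) : (e • F) x = e • F x := by
  rcases Int.units_eq_one_or e with rfl | rfl <;> simp

theorem multilinear_ext {n : ℕ} {f g : MultilinearMap K (fun _ : Fin n => V) W}
    (h : ∀ (d : Fin n → ZMod 2) (x : Fin n → V), (∀ i, parityProj 𝒱 (d i) (x i) = x i) →
      f x = g x) : f = g := by
  ext x
  have hx : x = fun i => ∑ a, parityProj 𝒱 a (x i) := by
    funext i; rw [sum_parityProj]
  rw [hx, MultilinearMap.map_sum, MultilinearMap.map_sum]
  refine Finset.sum_congr rfl fun d _ => h d _ fun i => ?_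
  rw [parityProj_parityProj, if_pos rfl]


theorem linear_ext {n : ℕ} {f g : (⨂[K]^n V) →ₗ[K] W}
    (h : ∀ (d : Fin n → ZMod 2) (x : Fin n → V), (∀ i, parityProj 𝒱 (d i) (x i) = x i) →
      f (PiTensorProduct.tprod K x) = g (PiTensorProduct.tprod K x)) : f = g :=
  PiTensorProduct.ext (multilinear_ext (𝒱 := 𝒱) h)

variable (𝒱)

/-- The right action `ρ⁽¹⁾` of the symmetric group on `⊗ⁿ V`: for homogeneous `xᵢ`,
`x₁ ⊗ … ⊗ xₙ ↦ ε(σ) x_{σ 1} ⊗ … ⊗ x_{σ n}`. -/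
def rho1 {n : ℕ} (σ : Equiv.Perm (Fin n)) : (⨂[K]^n V) →ₗ[K] (⨂[K]^n V) :=
  PiTensorProduct.lift (gradedExt 𝒱 fun d =>
    koszulSign σ d • (PiTensorProduct.tprod K).domDomCongr σ)

/-- The right action `ρ⁽²⁾_σ = sgn(σ) ρ⁽¹⁾_σ`. -/
def rho2 {n : ℕ} (σ : Equiv.Perm (Fin n)) : (⨂[K]^n V) →ₗ[K] (⨂[K]^n V) :=
  Equiv.Perm.sign σ • rho1 𝒱 σ

/-- The inclusion of the permutations of the first `n` indices into those of `n + 1` indices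
(fixing the last one), so that `ρ_(fixLast σ)` is `ρ_σ ⊗ I₁` on `⊗ⁿ⁺¹ V`; see
`koszulSign_fixLast`. -/
def fixLast {n : ℕ} (σ : Equiv.Perm (Fin n)) : Equiv.Perm (Fin (n + 1)) :=
  σ.viaEmbedding Fin.castSuccEmb

theorem rho1_tprod {n : ℕ} (σ : Equiv.Perm (Fin n)) {d : Fin n → ZMod 2} {x : Fin n → V}
    (hx : ∀ i, parityProj 𝒱 (d i) (x i) = x i) :
    rho1 𝒱 σ (PiTensorProduct.tprod K x) =
      koszulSign σ d • PiTensorProduct.tprod K (fun i => x (σ i)) := by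
  rw [rho1, PiTensorProduct.lift.tprod, gradedExt_apply _ hx]
  rfl

theorem rho1_mul {n : ℕ} (τ σ : Equiv.Perm (Fin n)) :
    rho1 𝒱 (τ * σ) = rho1 𝒱 σ ∘ₗ rho1 𝒱 τ := by
  refine linear_ext (𝒱 := 𝒱) fun d x hx => ?_
  rw [LinearMap.comp_apply, rho1_tprod 𝒱 _ hx, rho1_tprod 𝒱 _ hx,
    map_zsmul_unit, rho1_tprod 𝒱 σ (d := d ∘ τ) (fun i => hx (τ i)), koszulSign_mul, mul_smul]
  rfl

/-- The subspace of `⊗ⁿ V` spanned by all `ρ⁽¹⁾_σ(t) - t`. -/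
def wedgeRel (n : ℕ) : Submodule K (⨂[K]^n V) :=
  Submodule.span K {u | ∃ (σ : Equiv.Perm (Fin n)) (t : ⨂[K]^n V), u = rho1 𝒱 σ t - t}

/-- `∧ⁿ V`, the coinvariants of `⊗ⁿ V` under `ρ⁽¹⁾`. -/
abbrev Wedge (n : ℕ) : Type _ := (⨂[K]^n V) ⧸ wedgeRel 𝒱 n

/-- `∧ⁿ V ⊗ V`, that is, `Pⁿ⁺¹ V`. The index is the number of wedge factors. -/
def PermPart (n : ℕ) : Type _ := Wedge 𝒱 n ⊗[K] V

instance (n : ℕ) : AddCommGroup (PermPart 𝒱 n) :=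
  inferInstanceAs (AddCommGroup (Wedge 𝒱 n ⊗[K] V))

instance (n : ℕ) : Module K (PermPart 𝒱 n) :=
  inferInstanceAs (Module K (Wedge 𝒱 n ⊗[K] V))

/-- The underlying space of `P* V = ⨁_{n ≥ 1} Pⁿ V = ⨁_{n ≥ 0} ∧ⁿ V ⊗ V`. -/
abbrev PermCoalg : Type _ := ⨁ n : ℕ, PermPart 𝒱 n

/-- `PermPart 𝒱 n` is `∧ⁿ V ⊗ V` by definition. -/
def permEquiv (n : ℕ) : Wedge 𝒱 n ⊗[K] V ≃ₗ[K] PermPart 𝒱 n :=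
  LinearEquiv.refl K (Wedge 𝒱 n ⊗[K] V)

/-- The projection `⊗ⁿ⁺¹ V → ∧ⁿ V ⊗ V`,
`x₁ ⊗ … ⊗ xₙ ⊗ xₙ₊₁ ↦ x₁ ∧ … ∧ xₙ ⊗ xₙ₊₁`. -/
def permMk (n : ℕ) : (⨂[K]^(n + 1) V) →ₗ[K] PermPart 𝒱 n :=
  (permEquiv 𝒱 n).toLinearMap ∘ₗ PiTensorProduct.lift (MultilinearMap.uncurryRight
    ((TensorProduct.mk K (Wedge 𝒱 n) V ∘ₗ (wedgeRel 𝒱 n).mkQ).compMultilinearMap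
      (PiTensorProduct.tprod K)))

theorem permMk_tprod {n : ℕ} (x : Fin (n + 1) → V) :
    permMk 𝒱 n (PiTensorProduct.tprod K x) =
      permEquiv 𝒱 n ((wedgeRel 𝒱 n).mkQ (PiTensorProduct.tprod K fun i : Fin n => x i.castSucc) ⊗ₜ
        x (Fin.last n)) := by
  rw [permMk, LinearMap.comp_apply, PiTensorProduct.lift.tprod]
  rfl

theorem fixLast_castSucc {n : ℕ} (σ : Equiv.Perm (Fin n)) (i : Fin n) :
    fixLast σ i.castSucc = (σ i).castSucc :=
  Equiv.Perm.viaEmbedding_apply σ Fin.castSuccEmb i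

theorem fixLast_last {n : ℕ} (σ : Equiv.Perm (Fin n)) : fixLast σ (Fin.last n) = Fin.last n :=
  Equiv.Perm.viaEmbedding_apply_of_notMem σ Fin.castSuccEmb _ (by
    rintro ⟨i, hi⟩
    exact (Fin.castSucc_lt_last i).ne hi)

theorem fixLast_mul {n : ℕ} (τ σ : Equiv.Perm (Fin n)) :
    fixLast (τ * σ) = fixLast τ * fixLast σ :=
  map_mul (Equiv.Perm.viaEmbeddingHom Fin.castSuccEmb) τ σ

theorem koszulSign_fixLast {n : ℕ} (σ : Equiv.Perm (Fin n)) (d : Fin (n + 1) → ZMod 2) :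
    koszulSign (fixLast σ) d = koszulSign σ fun i => d i.castSucc := by
  refine koszulSign_viaEmbedding Fin.castSuccEmb Fin.strictMono_castSucc ?_ σ d
  intro i j k _ h
  have : k ≠ Fin.last n := (lt_of_le_of_lt h (Fin.castSucc_lt_last j)).ne
  exact ⟨k.castPred this, Fin.castSucc_castPred k this⟩

theorem permMk_comp_rho1 {n : ℕ} (σ : Equiv.Perm (Fin n)) :
    permMk 𝒱 n ∘ₗ rho1 𝒱 (fixLast σ) = permMk 𝒱 n := by
  refine linear_ext (𝒱 := 𝒱) fun d x hx => ?_
  have h : (wedgeRel 𝒱 n).mkQ (PiTensorProduct.tprod K fun i : Fin n => x i.castSucc) =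
      koszulSign σ (fun i => d i.castSucc) •
        (wedgeRel 𝒱 n).mkQ (PiTensorProduct.tprod K fun i : Fin n => x (σ i).castSucc) := by
    rw [← map_zsmul_unit, ← rho1_tprod 𝒱 σ (x := fun i : Fin n => x i.castSucc)
      (fun i => hx i.castSucc)]
    refine ((Submodule.Quotient.eq (wedgeRel 𝒱 n)).2 ?_).symm
    exact Submodule.subset_span ⟨σ, _, rfl⟩
  rw [LinearMap.comp_apply, rho1_tprod 𝒱 _ hx, map_zsmul_unit, permMk_tprod, permMk_tprod, h,
    koszulSign_fixLast, ← map_zsmul_unit (permEquiv 𝒱 n)]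
  simp only [fixLast_castSucc, fixLast_last, Units.smul_def, TensorProduct.smul_tmul']

theorem wedgeRel_le_ker {n : ℕ} (G : (⨂[K]^(n + 1) V) →ₗ[K] W)
    (hG : ∀ σ : Equiv.Perm (Fin n), G ∘ₗ rho1 𝒱 (fixLast σ) = G) :
    wedgeRel 𝒱 n ≤ LinearMap.ker
      (PiTensorProduct.lift (G.compMultilinearMap (PiTensorProduct.tprod K)).curryRight) := by
  rw [wedgeRel, Submodule.span_le]
  rintro _ ⟨σ, t, rfl⟩
  simp only [SetLike.mem_coe, LinearMap.mem_ker, map_sub, sub_eq_zero]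
  rw [← LinearMap.comp_apply]
  congr 1
  refine linear_ext (𝒱 := 𝒱) fun d x hx => ?_
  rw [LinearMap.comp_apply, rho1_tprod 𝒱 _ hx, map_zsmul_unit, PiTensorProduct.lift.tprod,
    PiTensorProduct.lift.tprod]
  refine LinearMap.ext fun v => ?_
  rw [← sum_parityProj 𝒱 v, map_sum, map_sum]
  refine Finset.sum_congr rfl fun a _ => ?_
  have ha : parityProj 𝒱 a (parityProj 𝒱 a v) = parityProj 𝒱 a v := by
    rw [parityProj_parityProj, if_pos rfl]
  generalize parityProj 𝒱 a v = w at ha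
  have hx' : ∀ i, parityProj 𝒱 ((Fin.snoc d a : Fin (n + 1) → ZMod 2) i)
      ((Fin.snoc x w : Fin (n + 1) → V) i) = (Fin.snoc x w : Fin (n + 1) → V) i := by
    intro i
    refine Fin.lastCases ?_ (fun i => ?_) i
    · simpa using ha
    · simpa using hx i
  have h := LinearMap.congr_fun (hG σ)
    (PiTensorProduct.tprod K (Fin.snoc x w : Fin (n + 1) → V))
  rw [LinearMap.comp_apply, rho1_tprod 𝒱 _ hx', map_zsmul_unit, koszulSign_fixLast] at h
  simp only [Fin.snoc_castSucc] at h
  rw [LinearMap.smul_apply, MultilinearMap.curryRight_apply,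
    MultilinearMap.curryRight_apply, LinearMap.compMultilinearMap_apply,
    LinearMap.compMultilinearMap_apply, ← h]
  congr 3
  funext i
  refine Fin.lastCases ?_ (fun i => ?_) i
  · rw [fixLast_last]; simp
  · rw [fixLast_castSucc]; simp

/-- The map on `∧ⁿ V ⊗ V` induced by a map `G` on `⊗ⁿ⁺¹ V` with `G ∘ (ρ⁽¹⁾_σ ⊗ I₁) = G` for all
`σ`; see `permLift_permMk`. -/
def permLift {n : ℕ} (G : (⨂[K]^(n + 1) V) →ₗ[K] W)
    (hG : ∀ σ : Equiv.Perm (Fin n), G ∘ₗ rho1 𝒱 (fixLast σ) = G) : PermPart 𝒱 n →ₗ[K] W :=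
  TensorProduct.lift ((wedgeRel 𝒱 n).liftQ
    (PiTensorProduct.lift (G.compMultilinearMap (PiTensorProduct.tprod K)).curryRight)
    (wedgeRel_le_ker 𝒱 G hG)) ∘ₗ (permEquiv 𝒱 n).symm.toLinearMap

theorem permLift_permMk {n : ℕ} (G : (⨂[K]^(n + 1) V) →ₗ[K] W)
    (hG : ∀ σ : Equiv.Perm (Fin n), G ∘ₗ rho1 𝒱 (fixLast σ) = G) (t : ⨂[K]^(n + 1) V) :
    permLift 𝒱 G hG (permMk 𝒱 n t) = G t := by
  rw [← LinearMap.comp_apply]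
  congr 1
  refine linear_ext (𝒱 := 𝒱) fun d x _ => ?_
  rw [LinearMap.comp_apply, permMk_tprod, permLift, LinearMap.comp_apply,
    LinearEquiv.coe_coe, LinearEquiv.symm_apply_apply, TensorProduct.lift.tmul,
    Submodule.mkQ_apply, Submodule.liftQ_apply, PiTensorProduct.lift.tprod,
    MultilinearMap.curryRight_apply, LinearMap.compMultilinearMap_apply]
  congr 2
  exact Fin.snoc_init_self x


variable {𝒱}

/-- The tuple `(x₁, …, x_m, f(x_{m+1}, …, x_{m+b+1}), x_{m+b+2}, …, x_{N+1})` of length `a + 1`,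
where `a + b = N`. -/
def insertTuple {N a b : ℕ} (h : a + b = N) (m : Fin (a + 1)) (f : (⨂[K]^(b + 1) V) →ₗ[K] V)
    (x : Fin (N + 1) → V) (t : Fin (a + 1)) : V :=
  if t < m then x ⟨t, by omega⟩
  else if t = m then f (PiTensorProduct.tprod K fun s : Fin (b + 1) => x ⟨m + s, by omega⟩)
  else x ⟨t + b, by omega⟩

theorem insertTuple_update {N a b : ℕ} (h : a + b = N) (m : Fin (a + 1))
    (f : (⨂[K]^(b + 1) V) →ₗ[K] V) (x : Fin (N + 1) → V) (i : Fin (N + 1)) :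
    ∃ (t : Fin (a + 1)) (φ : V →ₗ[K] V), ∀ v,
      insertTuple h m f (Function.update x i v) = Function.update (insertTuple h m f x) t (φ v) := by
  by_cases h1 : i.1 < m.1
  · refine ⟨⟨i, by omega⟩, LinearMap.id, fun v => ?_⟩
    funext t
    have h2 : ∀ s : Fin (b + 1), (⟨m + s, by omega⟩ : Fin (N + 1)) ≠ i := fun s hs => by
      have := congrArg Fin.val hs; simp at this; omega
    by_cases ht : t.1 = i.1
    · have hi : i.1 < a + 1 := by omega
      rw [show t = ⟨i, hi⟩ from Fin.ext ht]
      have : (⟨i, by omega⟩ : Fin (a + 1)) < m := h1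
      simp [insertTuple, this]
    · have e1 : (⟨t, by omega⟩ : Fin (N + 1)) ≠ i := fun hs => ht (congrArg Fin.val hs)
      have e2 : t ≠ ⟨i, by omega⟩ := fun hs => ht (congrArg Fin.val hs)
      rw [Function.update_of_ne e2]
      unfold insertTuple
      simp only [Function.update_of_ne e1, Function.update_of_ne (h2 _)]
      split_ifs with h3 h4
      · rfl
      · rfl
      · refine Function.update_of_ne (fun hs => ?_) _ _
        have := congrArg Fin.val hs
        simp at this
        have h5 : ¬ t.1 < m.1 := h3
        omega
  by_cases h2 : i.1 ≤ m.1 + b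
  · refine ⟨m, (f.compMultilinearMap (PiTensorProduct.tprod K)).toLinearMap
      (fun s : Fin (b + 1) => x ⟨m + s, by omega⟩) ⟨i - m, by omega⟩, fun v => ?_⟩
    funext t
    by_cases ht : t = m
    · subst ht
      simp only [insertTuple, lt_irrefl, if_false, if_true, Function.update_self,
        MultilinearMap.toLinearMap_apply, LinearMap.compMultilinearMap_apply]
      congr 2
      funext s
      by_cases hs : s.1 = i - t
      · have hi : i.1 - t.1 < b + 1 := by omega
        rw [show s = ⟨i - t, hi⟩ from Fin.ext hs]
        have : (⟨t + (i - t), by omega⟩ : Fin (N + 1)) = i := Fin.ext (by simp; omega)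
        simp [this]
      · rw [Function.update_of_ne, Function.update_of_ne]
        · exact fun h => hs (congrArg Fin.val h)
        · intro h
          have := congrArg Fin.val h
          simp at this
          omega
    · rw [Function.update_of_ne ht]
      have ht' : t.1 ≠ m.1 := fun h => ht (Fin.ext h)
      unfold insertTuple
      simp only [if_neg ht]
      split_ifs with h3
      · refine Function.update_of_ne (fun hs => ?_) _ _
        have := congrArg Fin.val hs
        simp at this
        have h5 : t.1 < m.1 := h3
        omega
      · refine Function.update_of_ne (fun hs => ?_) _ _
        have := congrArg Fin.val hs
        simp at this
        have h5 : ¬ t.1 < m.1 := h3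
        omega
  · refine ⟨⟨i - b, by omega⟩, LinearMap.id, fun v => ?_⟩
    funext t
    have e2 : ∀ s : Fin (b + 1), (⟨m + s, by omega⟩ : Fin (N + 1)) ≠ i := fun s hs => by
      have := congrArg Fin.val hs; simp at this; omega
    by_cases ht : t.1 = i.1 - b
    · have hi : i.1 - b < a + 1 := by omega
      rw [show t = ⟨i - b, hi⟩ from Fin.ext ht]
      have l1 : ¬ (⟨i - b, by omega⟩ : Fin (a + 1)) < m := fun h => by
        have : i.1 - b < m.1 := h
        omega
      have l2 : (⟨i - b, by omega⟩ : Fin (a + 1)) ≠ m := fun h => by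
        have : i.1 - b = m.1 := congrArg Fin.val h
        omega
      have l3 : (⟨i - b + b, by omega⟩ : Fin (N + 1)) = i := Fin.ext (by simp; omega)
      simp [insertTuple, l1, l2, l3]
    · have e3 : t ≠ ⟨i - b, by omega⟩ := fun hs => ht (congrArg Fin.val hs)
      rw [Function.update_of_ne e3]
      unfold insertTuple
      simp only [Function.update_of_ne (e2 _)]
      split_ifs with h3 h4
      · refine Function.update_of_ne (fun hs => ?_) _ _
        have := congrArg Fin.val hs
        simp at this
        have h5 : t.1 < m.1 := h3
        omega
      · rfl
      · refine Function.update_of_ne (fun hs => ?_) _ _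
        have := congrArg Fin.val hs
        simp at this
        omega

/-- The multilinear map `x ↦ x₁ ⊗ … ⊗ x_m ⊗ f(x_{m+1}, …, x_{m+b+1}) ⊗ x_{m+b+2} ⊗ … ⊗ x_{N+1}`
(without a sign). -/
def insertMap {N a b : ℕ} (h : a + b = N) (m : Fin (a + 1)) (f : (⨂[K]^(b + 1) V) →ₗ[K] V) :
    MultilinearMap K (fun _ : Fin (N + 1) => V) (⨂[K]^(a + 1) V) where
  toFun x := PiTensorProduct.tprod K (insertTuple h m f x)
  map_update_add' {inst} x i v w := by
    obtain rfl := Subsingleton.elim inst (instDecidableEqFin _)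
    obtain ⟨t, φ, hφ⟩ := insertTuple_update h m f x i
    simp only [hφ, map_add, MultilinearMap.map_update_add]
  map_update_smul' {inst} x i c v := by
    obtain rfl := Subsingleton.elim inst (instDecidableEqFin _)
    obtain ⟨t, φ, hφ⟩ := insertTuple_update h m f x i
    simp only [hφ, map_smul, MultilinearMap.map_update_smul]

variable (𝒱)

/-- The map `I_m ⊗ f ⊗ I_{a-m} : ⊗ᴺ⁺¹ V → ⊗ᵃ⁺¹ V` for `f : ⊗ᵇ⁺¹ V → V` homogeneous of degree `e`,
`a + b = N`, with its sign `(-1)^(e (|x₁| + … + |x_m|))`. -/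
def idTensor {N a b : ℕ} (h : a + b = N) (m : Fin (a + 1)) (e : ℤ)
    (f : (⨂[K]^(b + 1) V) →ₗ[K] V) : (⨂[K]^(N + 1) V) →ₗ[K] (⨂[K]^(a + 1) V) :=
  PiTensorProduct.lift (gradedExt 𝒱 fun d =>
    (-1 : ℤˣ) ^ ((e : ZMod 2) * ∑ t : Fin (N + 1) with t.1 < m.1, d t) • insertMap h m f)


theorem sum_rho1_comp {n : ℕ} (τ : Equiv.Perm (Fin n)) :
    (∑ σ : Equiv.Perm (Fin n), rho1 𝒱 (fixLast σ)) ∘ₗ rho1 𝒱 (fixLast τ) =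
      ∑ σ : Equiv.Perm (Fin n), rho1 𝒱 (fixLast σ) := by
  refine LinearMap.ext fun x => ?_
  rw [LinearMap.comp_apply, LinearMap.sum_apply, LinearMap.sum_apply,
    ← Equiv.sum_comp (Equiv.mulLeft τ) fun σ => rho1 𝒱 (fixLast σ) x]
  refine Finset.sum_congr rfl fun σ _ => ?_
  rw [Equiv.coe_mulLeft, fixLast_mul, rho1_mul, LinearMap.comp_apply]

/-- The component `∧ᵏ V ⊗ V → ∧ˡ V ⊗ V` of the coderivation induced by degree `-1` maps
`q_b : ∧ᵇ V ⊗ V → V`. With `b = k - l` it is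
`1 / (l! b!) (∑_{i<l} I_i ∧ q_b ∧ I_{l-1-i} ⊗ I₁ + I_l ⊗ q_b) ∘ (∑_{σ ∈ S_k} ρ⁽¹⁾_σ ⊗ I₁)`; both kinds
of summands are `permMk` composed with some `I_i ⊗ q_b ⊗ I_{l-i}`, `i ≤ l`. -/
def coextComponent (q : ∀ n, PermPart 𝒱 n →ₗ[K] V) {k l b : ℕ} (h : l + b = k) :
    PermPart 𝒱 k →ₗ[K] PermPart 𝒱 l :=
  permLift 𝒱 (((l.factorial : K) * (b.factorial : K))⁻¹ •
      (permMk 𝒱 l ∘ₗ (∑ i : Fin (l + 1), idTensor 𝒱 h i (-1) (q b ∘ₗ permMk 𝒱 b)) ∘ₗ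
        ∑ σ : Equiv.Perm (Fin k), rho1 𝒱 (fixLast σ)))
    fun τ => by
      rw [LinearMap.smul_comp, LinearMap.comp_assoc, LinearMap.comp_assoc, sum_rho1_comp]

/-- The map `q̃ : P* V → P* V` induced by degree `-1` maps `q_n : ∧ⁿ V ⊗ V → V`; its components are
the maps `coextComponent`. -/
def coext (q : ∀ n, PermPart 𝒱 n →ₗ[K] V) : PermCoalg 𝒱 →ₗ[K] PermCoalg 𝒱 :=
  DirectSum.toModule K ℕ _ fun k => ∑ l : Fin (k + 1),
    DirectSum.lof K ℕ (fun n => PermPart 𝒱 n) l ∘ₗ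
      coextComponent 𝒱 q (show l.1 + (k - l.1) = k by omega)

/-- The map `u ↦ (-1)^(e |u|) u` for homogeneous `u ∈ P* V`. -/
def signTwist (e : ℤ) : PermCoalg 𝒱 →ₗ[K] PermCoalg 𝒱 :=
  DirectSum.toModule K ℕ _ fun n => DirectSum.lof K ℕ (fun n => PermPart 𝒱 n) n ∘ₗ
    permLift 𝒱 (PiTensorProduct.lift (gradedExt 𝒱 fun d =>
        (-1 : ℤˣ) ^ ((e : ZMod 2) * ∑ i, d i) •
          (permMk 𝒱 n).compMultilinearMap (PiTensorProduct.tprod K)))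
      fun σ => by
        refine linear_ext (𝒱 := 𝒱) fun d x hx => ?_
        have hs : ∑ i, (d ∘ fixLast σ) i = ∑ i, d i := Equiv.sum_comp (fixLast σ) d
        have h := LinearMap.congr_fun (permMk_comp_rho1 𝒱 σ) (PiTensorProduct.tprod K x)
        rw [LinearMap.comp_apply, rho1_tprod 𝒱 _ hx, map_zsmul_unit] at h
        rw [LinearMap.comp_apply, rho1_tprod 𝒱 _ hx, map_zsmul_unit,
          PiTensorProduct.lift.tprod, PiTensorProduct.lift.tprod, gradedExt_apply _ hx,
          gradedExt_apply (d := d ∘ fixLast σ) _ (fun i => hx _), hs, units_smul_apply, units_smul_apply,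
          LinearMap.compMultilinearMap_apply, LinearMap.compMultilinearMap_apply, smul_comm, h]

/-- `x₁ ⊗ … ⊗ x_{N+1} ↦ (x₁ ⊗ … ⊗ x_{a+1}) ⊗ (x_{a+2} ⊗ … ⊗ x_{N+1})`; see `split_tprod`. -/
def split {N a b : ℕ} (h : a + 1 + b = N) :
    (⨂[K]^(N + 1) V) →ₗ[K] (⨂[K]^(a + 1) V) ⊗[K] (⨂[K]^(b + 1) V) :=
  (TensorPower.mulEquiv (R := K) (M := V) (n := a + 1) (m := b + 1)).symm.toLinearMap ∘ₗ
    (TensorPower.cast K V (show N + 1 = a + 1 + (b + 1) by omega)).toLinearMap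

theorem split_tprod {N a b : ℕ} (h : a + 1 + b = N) (x : Fin (N + 1) → V) :
    split h (PiTensorProduct.tprod K x) =
      PiTensorProduct.tprod K (fun i : Fin (a + 1) => x ⟨i, by omega⟩) ⊗ₜ[K]
        PiTensorProduct.tprod K (fun i : Fin (b + 1) => x ⟨a + 1 + i, by omega⟩) := by
  subst h
  rw [split, LinearMap.comp_apply, LinearEquiv.coe_coe, LinearEquiv.coe_coe,
    LinearEquiv.symm_apply_eq]
  rw [TensorPower.cast_tprod, ← TensorPower.gMul_def, TensorPower.tprod_mul_tprod]
  congr 1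
  funext i
  refine Fin.addCases (fun i => ?_) (fun i => ?_) i
  · rw [Fin.append_left]; rfl
  · rw [Fin.append_right]; rfl


/-- The block, for the block sizes `a, 1, N - a - 1`, in which a position lies. -/
def blk {N : ℕ} (a : ℕ) (i : Fin N) : ℕ := if i.1 < a then 0 else if i.1 = a then 1 else 2

/-- `Sh(a, 1, N - a - 1)`: the permutations that are increasing on each of the three blocks. -/
def unshuffles (N a : ℕ) : Finset (Equiv.Perm (Fin N)) :=
  {σ | ∀ i j : Fin N, i < j → blk a i = blk a j → σ i < σ j}

theorem blk_mono {N : ℕ} (a : ℕ) : Monotone (blk (N := N) a) := by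
  intro i j h
  have : i.1 ≤ j.1 := h
  unfold blk
  split_ifs <;> omega

theorem unshuffle_key_mono {N a : ℕ} {s : Equiv.Perm (Fin N)} (hs : s ∈ unshuffles N a)
    {c : Fin N → ℕ} (hc : ∀ i, c (s i) = blk a i) :
    Monotone ((fun v => toLex (c v, v)) ∘ s : Fin N → ℕ ×ₗ Fin N) := by
  rw [unshuffles, Finset.mem_filter] at hs
  intro i j hij
  rw [Function.comp_apply, Function.comp_apply, Prod.Lex.toLex_le_toLex, hc, hc]
  rcases (blk_mono a hij).lt_or_eq with h | h
  · exact Or.inl h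
  · refine Or.inr ⟨h, ?_⟩
    rcases hij.lt_or_eq with h' | h'
    · exact (hs.2 i j h' h).le
    · exact (congrArg s h').le

theorem unshuffle_unique {N a : ℕ} {s g : Equiv.Perm (Fin N)} (hs : s ∈ unshuffles N a)
    (hg : ∀ i, blk a (g i) = blk a i) (hsg : s * g ∈ unshuffles N a) : s * g = s := by
  have h1 := unshuffle_key_mono hs (c := fun v => blk a (s.symm v)) (by simp)
  have h2 := unshuffle_key_mono hsg (c := fun v => blk a (s.symm v)) (by simp [hg])
  have h3 := Tuple.unique_monotone h2 h1
  ext1 i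
  simpa using congrArg (fun z => (ofLex z).2) (congrFun h3 i)

theorem exists_unshuffle {N : ℕ} (a : ℕ) (σ : Equiv.Perm (Fin N)) :
    ∃ g : Equiv.Perm (Fin N), (∀ i, blk a (g i) = blk a i) ∧ σ * g ∈ unshuffles N a := by
  set f : Fin N → ℕ ×ₗ Fin N := fun v => toLex (blk a (σ.symm v), v) with hf
  have hm : Monotone (f ∘ Tuple.sort f) := Tuple.monotone_sort f
  have hm' : Monotone ((fun v => blk a (σ.symm v)) ∘ Tuple.sort f) := fun i j hij => by
    rcases Prod.Lex.toLex_le_toLex.1 (hm hij) with h | h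
    · exact h.le
    · exact h.1.le
  have hb : Monotone ((fun v : Fin N => blk a (σ.symm v)) ∘ σ) := by
    have : (fun v : Fin N => blk a (σ.symm v)) ∘ σ = blk a := by
      funext i; simp
    rw [this]; exact blk_mono a
  have he := Tuple.unique_monotone hm' hb
  have hg : ∀ i, blk a (σ.symm (Tuple.sort f i)) = blk a i := fun i => by
    simpa using congrFun he i
  refine ⟨σ⁻¹ * Tuple.sort f, hg, ?_⟩
  rw [mul_inv_cancel_left, unshuffles, Finset.mem_filter]
  refine ⟨Finset.mem_univ _, fun i j hij hbl => ?_⟩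
  refine lt_of_le_of_ne ?_ ((Tuple.sort f).injective.ne hij.ne)
  rcases Prod.Lex.toLex_le_toLex.1 (hm hij.le) with h | h
  · exact absurd h (by simp only [hg, hbl, lt_irrefl, not_false_iff])
  · exact h.2

theorem sum_unshuffles_mul {N a : ℕ} {M : Type*} [AddCommMonoid M]
    (T : Equiv.Perm (Fin N) → M)
    (hT : ∀ σ g : Equiv.Perm (Fin N), (∀ i, blk a (g i) = blk a i) → T (σ * g) = T σ)
    (τ : Equiv.Perm (Fin N)) :
    ∑ σ ∈ unshuffles N a, T (τ * σ) = ∑ σ ∈ unshuffles N a, T σ := by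
  choose g hg hgu using exists_unshuffle (N := N) a
  have hinv : ∀ {k : Equiv.Perm (Fin N)}, (∀ i, blk a (k i) = blk a i) →
      ∀ i, blk a (k⁻¹ i) = blk a i := fun {k} hk i => by
    rw [← hk (k⁻¹ i)]; simp
  refine Finset.sum_bij' (fun σ _ => (τ * σ) * g (τ * σ)) (fun σ _ => (τ⁻¹ * σ) * g (τ⁻¹ * σ))
    (fun σ _ => hgu _) (fun σ _ => hgu _) ?_ ?_ (fun σ _ => (hT _ _ (hg _)).symm)
  · intro σ hσ
    have h := hgu (τ⁻¹ * (τ * σ * g (τ * σ)))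
    have h1 : ∀ k : Equiv.Perm (Fin N), τ⁻¹ * (τ * σ * g (τ * σ)) * k = σ * (g (τ * σ) * k) :=
      fun k => by group
    rw [h1] at h ⊢
    exact unshuffle_unique hσ (fun i => by rw [Equiv.Perm.mul_apply, hg, hg]) h
  · intro σ hσ
    have h := hgu (τ * (τ⁻¹ * σ * g (τ⁻¹ * σ)))
    have h1 : ∀ k : Equiv.Perm (Fin N),
        τ * (τ⁻¹ * σ * g (τ⁻¹ * σ)) * k = σ * (g (τ⁻¹ * σ) * k) := fun k => by group
    rw [h1] at h ⊢
    exact unshuffle_unique hσ (fun i => by rw [Equiv.Perm.mul_apply, hg, hg]) h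

/-- `x₁ ⊗ … ⊗ x_{N+1} ↦ (x₁ ∧ … ∧ x_a ⊗ x_{a+1}) ⊗ (x_{a+2} ∧ … ∧ x_N ⊗ x_{N+1})`. -/
def splitMk {N a b : ℕ} (h : a + 1 + b = N) :
    (⨂[K]^(N + 1) V) →ₗ[K] PermPart 𝒱 a ⊗[K] PermPart 𝒱 b :=
  TensorProduct.map (permMk 𝒱 a) (permMk 𝒱 b) ∘ₗ split h

/-- The embedding of `Fin a` onto the positions `c, …, c + a - 1`. -/
def emb {N a : ℕ} (c : ℕ) (h : c + a ≤ N) : Fin a ↪ Fin (N + 1) where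
  toFun i := ⟨c + i, by omega⟩
  inj' i j e := by
    have := congrArg Fin.val e
    exact Fin.ext (by simpa using this)

theorem splitMk_comp_left {N a b : ℕ} (h : a + 1 + b = N) (g : Equiv.Perm (Fin a))
    (k : Equiv.Perm (Fin (N + 1)))
    (hk : k = g.viaEmbedding (emb (N := N) 0 (by omega))) :
    splitMk 𝒱 h ∘ₗ rho1 𝒱 k = splitMk 𝒱 h := by
  set E : Fin a ↪ Fin (N + 1) := emb 0 (by omega)
  have hE : ∀ i, (E i).1 = i.1 := fun i => Nat.zero_add _
  have hin : ∀ i, k (E i) = E (g i) := fun i => by rw [hk, Equiv.Perm.viaEmbedding_apply]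
  have hout : ∀ j : Fin (N + 1), a ≤ j.1 → k j = j := fun j hj => by
    rw [hk]
    refine Equiv.Perm.viaEmbedding_apply_of_notMem _ _ _ ?_
    rintro ⟨i, rfl⟩
    have := hE i
    omega
  refine linear_ext (𝒱 := 𝒱) fun d x hx => ?_
  have hε : koszulSign k d = koszulSign g (d ∘ E) := by
    rw [hk]
    refine koszulSign_viaEmbedding E (fun i j hij => ?_) ?_ g d
    · rwa [Fin.lt_def, hE, hE]
    · intro i j l _ hl
      rw [Fin.le_def, hE] at hl
      exact ⟨⟨l, by omega⟩, Fin.ext (hE _)⟩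
  have h1 : ∀ i : Fin (a + 1), k ⟨i, by omega⟩ = ⟨fixLast g i, by omega⟩ := fun i => by
    refine Fin.ext ?_
    refine Fin.lastCases ?_ (fun i => ?_) i
    · change _ = (fixLast g (Fin.last a)).1
      rw [fixLast_last, hout _ le_rfl]
    · change _ = (fixLast g i.castSucc).1
      rw [fixLast_castSucc]
      change _ = (g i).1
      rw [← hE, ← hin]
      exact congrArg (fun z => (k z).1) (Fin.ext (hE i).symm)
  have h2 : ∀ i : Fin (b + 1), k ⟨a + 1 + i, by omega⟩ = ⟨a + 1 + i, by omega⟩ := fun i =>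
    hout _ (by simp only; omega)
  have h3 := LinearMap.congr_fun (permMk_comp_rho1 𝒱 g)
    (PiTensorProduct.tprod K fun i : Fin (a + 1) => x ⟨i, by omega⟩)
  rw [LinearMap.comp_apply, rho1_tprod 𝒱 (d := fun i : Fin (a + 1) => d ⟨i, by omega⟩) _
    (fun i => hx _), map_zsmul_unit, koszulSign_fixLast] at h3
  rw [LinearMap.comp_apply, rho1_tprod 𝒱 _ hx, map_zsmul_unit, splitMk, LinearMap.comp_apply,
    LinearMap.comp_apply, split_tprod, split_tprod, TensorProduct.map_tmul,
    TensorProduct.map_tmul, ← h3, hε]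
  have hd : d ∘ E = fun i => d ⟨i.castSucc, by omega⟩ := funext fun i => congrArg d (Fin.ext (hE i))
  simp only [h1, h2, hd, Units.smul_def, TensorProduct.smul_tmul']

theorem splitMk_comp_right {N a b : ℕ} (h : a + 1 + b = N) (g : Equiv.Perm (Fin b))
    (k : Equiv.Perm (Fin (N + 1)))
    (hk : k = g.viaEmbedding (emb (N := N) (a + 1) h.le)) :
    splitMk 𝒱 h ∘ₗ rho1 𝒱 k = splitMk 𝒱 h := by
  set E : Fin b ↪ Fin (N + 1) := emb (a + 1) h.le
  have hE : ∀ i, (E i).1 = a + 1 + i.1 := fun i => rfl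
  have hin : ∀ i, k (E i) = E (g i) := fun i => by rw [hk, Equiv.Perm.viaEmbedding_apply]
  have hout : ∀ j : Fin (N + 1), j.1 ≤ a ∨ j.1 = N → k j = j := fun j hj => by
    rw [hk]
    refine Equiv.Perm.viaEmbedding_apply_of_notMem _ _ _ ?_
    rintro ⟨i, rfl⟩
    have := hE i
    omega
  refine linear_ext (𝒱 := 𝒱) fun d x hx => ?_
  have hε : koszulSign k d = koszulSign g (d ∘ E) := by
    rw [hk]
    refine koszulSign_viaEmbedding E (fun i j hij => ?_) ?_ g d
    · have hij' : i.1 < j.1 := hij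
      change a + 1 + i.1 < a + 1 + j.1
      omega
    · intro i j l hl1 hl2
      have hl1' : a + 1 + i.1 ≤ l.1 := hl1
      have hl2' : l.1 ≤ a + 1 + j.1 := hl2
      exact ⟨⟨l - (a + 1), by omega⟩, Fin.ext (by rw [hE]; simp only; omega)⟩
  have h1 : ∀ i : Fin (a + 1), k ⟨i, by omega⟩ = ⟨i, by omega⟩ := fun i =>
    hout _ (Or.inl (by simp only; omega))
  have h2 : ∀ i : Fin (b + 1), k ⟨a + 1 + i, by omega⟩ = ⟨a + 1 + fixLast g i, by omega⟩ :=
    fun i => by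
      refine Fin.ext ?_
      refine Fin.lastCases ?_ (fun i => ?_) i
      · change _ = a + 1 + (fixLast g (Fin.last b)).1
        rw [fixLast_last, hout _ (Or.inr (by simpa using h))]
      · change _ = a + 1 + (fixLast g i.castSucc).1
        rw [fixLast_castSucc]
        change _ = a + 1 + (g i).1
        rw [← hE, ← hin]
        rfl
  have h3 := LinearMap.congr_fun (permMk_comp_rho1 𝒱 g)
    (PiTensorProduct.tprod K fun i : Fin (b + 1) => x ⟨a + 1 + i, by omega⟩)
  rw [LinearMap.comp_apply, rho1_tprod 𝒱 (d := fun i : Fin (b + 1) => d ⟨a + 1 + i, by omega⟩) _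
    (fun i => hx _), map_zsmul_unit, koszulSign_fixLast] at h3
  rw [LinearMap.comp_apply, rho1_tprod 𝒱 _ hx, map_zsmul_unit, splitMk, LinearMap.comp_apply,
    LinearMap.comp_apply, split_tprod, split_tprod, TensorProduct.map_tmul,
    TensorProduct.map_tmul, ← h3, hε]
  simp only [h1, h2, Units.smul_def, TensorProduct.tmul_smul]
  rfl

theorem splitMk_comp_block {N a b : ℕ} (h : a + 1 + b = N) (g : Equiv.Perm (Fin N))
    (hg : ∀ i, blk a (g i) = blk a i) :
    splitMk 𝒱 h ∘ₗ rho1 𝒱 (fixLast g) = splitMk 𝒱 h := by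
  have hlt : ∀ i : Fin N, (g i).1 < a ↔ i.1 < a := fun i => by
    have := hg i
    unfold blk at this
    split_ifs at this <;> omega
  have heq : ∀ i : Fin N, (g i).1 = a ↔ i.1 = a := fun i => by
    have := hg i
    unfold blk at this
    split_ifs at this <;> omega
  let g1 : Equiv.Perm (Fin a) := Equiv.ofBijective
    (fun i => ⟨g ⟨i, by omega⟩, (hlt _).2 i.2⟩) (Finite.injective_iff_bijective.1 (by
      intro i j hij
      have h0 := congrArg Fin.val hij
      have h1 := g.injective (Fin.ext h0)
      exact Fin.ext (Fin.mk.inj h1)))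
  have hb : ∀ i : Fin b, a + 1 ≤ (g ⟨a + 1 + i, by omega⟩).1 := fun i => by
    have h1 := hlt ⟨a + 1 + i, by omega⟩
    have h2 := heq ⟨a + 1 + i, by omega⟩
    simp only at h1 h2
    omega
  let g2 : Equiv.Perm (Fin b) := Equiv.ofBijective
    (fun i => ⟨g ⟨a + 1 + i, by omega⟩ - (a + 1), by have := hb i; omega⟩)
    (Finite.injective_iff_bijective.1 (by
      intro i j hij
      have h0 := congrArg Fin.val hij
      have hi := hb i
      have hj := hb j
      simp only at h0
      have h1 := congrArg Fin.val (g.injective (Fin.ext (show (g ⟨a + 1 + i, by omega⟩).1 =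
        (g ⟨a + 1 + j, by omega⟩).1 by omega)))
      simp only at h1
      exact Fin.ext (by omega)))
  let E1 : Fin a ↪ Fin (N + 1) := emb 0 (by omega)
  let E2 : Fin b ↪ Fin (N + 1) := emb (a + 1) h.le
  have e1 : ∀ i, (E1 i).1 = i.1 := fun i => Nat.zero_add _
  have key : fixLast g = g1.viaEmbedding E1 * g2.viaEmbedding E2 := by
    have n1 : ∀ j : Fin (N + 1), a ≤ j.1 → g1.viaEmbedding E1 j = j := fun j hj => by
      refine Equiv.Perm.viaEmbedding_apply_of_notMem _ _ _ ?_
      rintro ⟨i, rfl⟩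
      have := e1 i
      omega
    have n2 : ∀ j : Fin (N + 1), j.1 ≤ a ∨ j.1 = N → g2.viaEmbedding E2 j = j := fun j hj => by
      refine Equiv.Perm.viaEmbedding_apply_of_notMem _ _ _ ?_
      rintro ⟨i, rfl⟩
      have : (E2 i).1 = a + 1 + i.1 := rfl
      omega
    ext1 j
    rw [Equiv.Perm.mul_apply]
    refine Fin.lastCases ?_ (fun j => ?_) j
    · rw [fixLast_last, n2 _ (Or.inr rfl), n1 _ (by simp only [Fin.val_last]; omega)]
    · rw [fixLast_castSucc]
      rcases lt_trichotomy j.1 a with hj | hj | hj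
      · rw [n2 _ (Or.inl hj.le)]
        have : j.castSucc = E1 ⟨j, hj⟩ := Fin.ext (e1 ⟨j, hj⟩).symm
        rw [this, Equiv.Perm.viaEmbedding_apply]
        exact Fin.ext (e1 (g1 ⟨j, hj⟩)).symm
      · rw [n2 _ (Or.inl hj.le), n1 _ hj.ge]
        refine Fin.ext ?_
        simp only [Fin.val_castSucc]
        rw [hj, heq, hj]
      · have hj' : j = ⟨a + 1 + (j - (a + 1)), by omega⟩ := Fin.ext (by simp only; omega)
        have : j.castSucc = E2 ⟨j - (a + 1), by omega⟩ :=
          Fin.ext (by change j.1 = a + 1 + (j.1 - (a + 1)); omega)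
        rw [this, Equiv.Perm.viaEmbedding_apply, n1]
        · refine Fin.ext ?_
          have h1 := hb ⟨j - (a + 1), by omega⟩
          change (g j).1 = a + 1 + ((g ⟨a + 1 + (j - (a + 1)), by omega⟩).1 - (a + 1))
          simp only [← hj'] at h1 ⊢
          omega
        · change a ≤ a + 1 + _
          omega
  rw [key, rho1_mul, ← LinearMap.comp_assoc, splitMk_comp_right 𝒱 h g2 _ rfl,
    splitMk_comp_left 𝒱 h g1 _ rfl]

theorem splitMk_unshuffles_comp {N a b : ℕ} (h : a + 1 + b = N) (τ : Equiv.Perm (Fin N)) :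
    (splitMk 𝒱 h ∘ₗ ∑ σ ∈ unshuffles N a, rho1 𝒱 (fixLast σ)) ∘ₗ rho1 𝒱 (fixLast τ) =
      splitMk 𝒱 h ∘ₗ ∑ σ ∈ unshuffles N a, rho1 𝒱 (fixLast σ) := by
  refine LinearMap.ext fun x => ?_
  have := sum_unshuffles_mul (a := a) (fun σ => splitMk 𝒱 h (rho1 𝒱 (fixLast σ) x))
    (fun σ g hg => by
      rw [fixLast_mul, rho1_mul, LinearMap.comp_apply, ← LinearMap.comp_apply,
        splitMk_comp_block 𝒱 h g hg]) τ
  simpa only [LinearMap.comp_apply, LinearMap.sum_apply, map_sum, fixLast_mul, rho1_mul] using this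

/-- The comultiplication of `P* V`: `x₁ ∧ … ∧ x_N ⊗ x_{N+1}` is sent to
`∑_{a=0}^{N-1} ∑_{σ ∈ Sh(a,1,N-1-a)} ε(σ) (x_{σ 1} ∧ … ∧ x_{σ a} ⊗ x_{σ (a+1)}) ⊗
(x_{σ (a+2)} ∧ … ∧ x_{σ N} ⊗ x_{N+1})`. -/
def comul : PermCoalg 𝒱 →ₗ[K] PermCoalg 𝒱 ⊗[K] PermCoalg 𝒱 :=
  DirectSum.toModule K ℕ _ fun N => ∑ a : Fin N,
    TensorProduct.map (DirectSum.lof K ℕ (fun n => PermPart 𝒱 n) a)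
        (DirectSum.lof K ℕ (fun n => PermPart 𝒱 n) (N - 1 - a)) ∘ₗ
      permLift 𝒱 (splitMk 𝒱 (show a.1 + 1 + (N - 1 - a.1) = N by omega) ∘ₗ
        ∑ σ ∈ unshuffles N a, rho1 𝒱 (fixLast σ))
      (splitMk_unshuffles_comp 𝒱 _)


/-- `f`, of degree `e`, is a coderivation: `Δ f = (f ⊗ Id + Id ⊗ f) Δ`, where
`(Id ⊗ f)(u ⊗ v) = (-1)^(e |u|) u ⊗ f(v)`. -/
def IsCoderivation (e : ℤ) (f : PermCoalg 𝒱 →ₗ[K] PermCoalg 𝒱) : Prop :=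
  comul 𝒱 ∘ₗ f =
    (TensorProduct.map f LinearMap.id + TensorProduct.map (signTwist 𝒱 e) f) ∘ₗ comul 𝒱

/-- The homogeneous elements of degree `k` in `P* V`: those spanned by the
`x₁ ∧ … ∧ xₙ ⊗ xₙ₊₁` with homogeneous `xᵢ` of total degree `k`. -/
def permDegree (k : ℤ) : Submodule K (PermCoalg 𝒱) :=
  Submodule.span K {u | ∃ (n : ℕ) (d : Fin (n + 1) → ℤ) (x : Fin (n + 1) → V),
    (∀ i, x i ∈ 𝒱 (d i)) ∧ ∑ i, d i = k ∧
      u = DirectSum.lof K ℕ (fun n => PermPart 𝒱 n) n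
        (permMk 𝒱 n (PiTensorProduct.tprod K x))}

/-- `f : P* V → P* V` is homogeneous of degree `e`. -/
def IsPermHomogeneous (e : ℤ) (f : PermCoalg 𝒱 →ₗ[K] PermCoalg 𝒱) : Prop :=
  ∀ k : ℤ, ∀ u ∈ permDegree 𝒱 k, f u ∈ permDegree 𝒱 (k + e)

/-- `f : ⊗ⁿ V → V` is homogeneous of degree `e`. -/
def IsHomogeneousOp {n : ℕ} (e : ℤ) (f : (⨂[K]^n V) →ₗ[K] V) : Prop :=
  ∀ (d : Fin n → ℤ) (x : Fin n → V), (∀ i, x i ∈ 𝒱 (d i)) →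
    f (PiTensorProduct.tprod K x) ∈ 𝒱 (∑ i, d i + e)

/-- The `PL∞` equations for maps `p_n` of degree `n - 2`. The arity of `p n` is `n + 1`, so that its
degree is `n - 1`. In the second line `i = a + 1`, `j = N - a + 1`, and `N + 1` is the total arity. -/
def SatisfiesPLDegNSubTwo (p : ∀ n : ℕ, (⨂[K]^(n + 1) V) →ₗ[K] V) : Prop :=
  (∀ (n : ℕ) (σ : Equiv.Perm (Fin n)), p n = p n ∘ₗ rho2 𝒱 (fixLast σ)) ∧
  ∀ N : ℕ, ∑ a : Fin (N + 1), ∑ m : Fin (a.1 + 1),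
    ((-1 : K) ^ ((N - a.1 + 1) * (a.1 - m.1) + m.1) / (a.1.factorial * (N - a.1).factorial)) •
      (p a ∘ₗ idTensor 𝒱 (show a.1 + (N - a.1) = N by omega) m (((N - a.1 : ℕ) : ℤ) - 1)
        (p (N - a.1)) ∘ₗ ∑ σ : Equiv.Perm (Fin N), rho2 𝒱 (fixLast σ)) = 0

/-- The `PL∞` equations for maps of degree `-1`; the arity of `p n` is `n + 1`, and in the second
line `i = a + 1`, `j = N - a + 1`. -/
def SatisfiesPLDegNegOne (p : ∀ n : ℕ, (⨂[K]^(n + 1) V) →ₗ[K] V) : Prop :=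
  (∀ (n : ℕ) (σ : Equiv.Perm (Fin n)), p n = p n ∘ₗ rho1 𝒱 (fixLast σ)) ∧
  ∀ N : ℕ, ∑ a : Fin (N + 1), ∑ m : Fin (a.1 + 1),
    (1 / (a.1.factorial * (N - a.1).factorial) : K) •
      (p a ∘ₗ idTensor 𝒱 (show a.1 + (N - a.1) = N by omega) m (-1) (p (N - a.1)) ∘ₗ
        ∑ σ : Equiv.Perm (Fin N), rho1 𝒱 (fixLast σ)) = 0

/-- For `|xᵢ| = d i`: the sign `(-1)^(|x₁| + |x₃| + … + |x_{n-1}|)` if `n` is even and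
`-(-1)^(|x₂| + |x₄| + … + |x_{n-1}|)` if `n` is odd. Indices of `Fin n` start at `0`. -/
def hatSign {n : ℕ} (d : Fin n → ZMod 2) : ℤˣ :=
  if Even n then (-1) ^ (∑ i : Fin n with Even i.1, d i)
  else -(-1) ^ (∑ i : Fin n with Odd i.1, d i)

/-- The map `p̂` with `p̂(s x₁, …, s xₙ) = ± s p(x₁, …, xₙ)`, the sign being `hatSign` of the degrees
of the `xᵢ` in `V`. The suspension `s V` has the same underlying vector space as `V` and `s` is the
identity of it; only the grading changes, see `susp`. -/
def hat (p : ∀ n : ℕ, (⨂[K]^(n + 1) V) →ₗ[K] V) (n : ℕ) : (⨂[K]^(n + 1) V) →ₗ[K] V :=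
  PiTensorProduct.lift (gradedExt 𝒱 fun d =>
    hatSign d • (p n).compMultilinearMap (PiTensorProduct.tprod K))

end

/-- The grading of the suspension: `(s V)ⁱ = Vⁱ⁻¹`. -/
def susp (𝒱 : ℤ → Submodule K V) (i : ℤ) : Submodule K V := 𝒱 (i - 1)

/-- The identification of `Vⁱ` with `(s V)ⁱ⁺¹`. -/
def suspIncl (𝒱 : ℤ → Submodule K V) (i : ℤ) : 𝒱 i →ₗ[K] susp 𝒱 (i + 1) :=
  Submodule.inclusion (le_of_eq (by rw [susp, add_sub_cancel_right]))

instance (𝒱 : ℤ → Submodule K V) [DirectSum.Decomposition 𝒱] :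
    DirectSum.Decomposition (susp 𝒱) :=
  DirectSum.Decomposition.ofLinearMap (susp 𝒱)
    (DirectSum.toModule K ℤ _ (fun i =>
      DirectSum.lof K ℤ (fun j => susp 𝒱 j) (i + 1) ∘ₗ suspIncl 𝒱 i) ∘ₗ
        (DirectSum.decomposeLinearEquiv 𝒱).toLinearMap)
    (by
      refine LinearMap.ext fun v => ?_
      induction v using DirectSum.Decomposition.inductionOn 𝒱 with
      | zero => simp
      | @homogeneous i v =>
        simp only [LinearMap.comp_apply, LinearEquiv.coe_coe,
          DirectSum.decomposeLinearEquiv_apply, DirectSum.decompose_coe]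
        rw [← DirectSum.lof_eq_of K, DirectSum.toModule_lof, LinearMap.comp_apply,
          DirectSum.coeLinearMap_lof]
        rfl
      | add v w hv hw => rw [map_add, map_add, hv, hw])
    (by
      refine DirectSum.linearMap_ext K fun i => LinearMap.ext fun v => ?_
      obtain ⟨j, rfl⟩ : ∃ j, i = j + 1 := ⟨i - 1, by omega⟩
      obtain ⟨v, hv⟩ := v
      have hv' : v ∈ 𝒱 j := by simpa [susp] using hv
      have h : DirectSum.decompose 𝒱 v = DirectSum.lof K ℤ (fun j => 𝒱 j) j ⟨v, hv'⟩ :=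
        DirectSum.decompose_of_mem 𝒱 hv'
      simp only [LinearMap.comp_apply, DirectSum.coeLinearMap_lof, LinearEquiv.coe_coe,
        DirectSum.decomposeLinearEquiv_apply, h, DirectSum.toModule_lof, LinearMap.id_apply]
      rfl)

/-- The maps `p̂` on the suspension have degree `-1`. -/
theorem hat_homogeneous (𝒱 : ℤ → Submodule K V) [DirectSum.Decomposition 𝒱]
    (p : ∀ n : ℕ, (⨂[K]^(n + 1) V) →ₗ[K] V)
    (hp : ∀ n : ℕ, IsHomogeneousOp 𝒱 ((n : ℤ) - 1) (p n)) (n : ℕ) :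
    IsHomogeneousOp (susp 𝒱) (-1) (hat 𝒱 p n) := by
  intro d x hx
  have h : p n (PiTensorProduct.tprod K x) ∈ susp 𝒱 (∑ i, d i + -1) := by
    have h0 := hp n (fun i => d i - 1) x hx
    have he : ∑ i, (d i - 1) + ((n : ℤ) - 1) = ∑ i, d i + -1 - 1 := by
      simp [Finset.sum_sub_distrib]
      ring
    rw [he] at h0
    exact h0
  rw [hat, PiTensorProduct.lift.tprod, gradedExt_apply_of_mem (𝒱 := 𝒱)
    (d := fun i => d i - 1) _ hx, units_smul_apply, LinearMap.compMultilinearMap_apply]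
  rw [Units.smul_def]
  exact zsmul_mem h _

end
end PLInf

/-!
The three conditions are linked by two independent arguments.

*From degree `n - 2` to degree `-1`.* The signs in `p̂` are implemented by an involution
`decalage` of the tensor powers, `p̂ₙ = pₙ ∘ decalage`. Conjugation by it turns the action `ρ⁽²⁾`
on `⊗ⁿ V` into the action `ρ⁽¹⁾` on `⊗ⁿ (sV)` (`rho1_susp`, checked on adjacent transpositions)
and turns `I_m ⊗ p_j ⊗ I` into `I_m ⊗ p̂_j ⊗ I` up to the sign of the quadratic relation
(`idTensor_susp`). So the two systems of equations are the same up to composition with `decalage`.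

*From degree `-1` to coderivations.* Put `W = sV`. Operations `p̂ₙ` symmetric in all but the last
argument are the same as maps `qₙ : Pⁿ W → W`. The projection of `q̃ ∘ q̃` to `W` is the quadratic
relation (`corestrict_coext_coext`), so `q̃² = 0` implies it at once. For the converse, `q̃` is a
coderivation of degree `-1` (`isCoderivation_coext`, `isPermHomogeneous_coext`), hence `q̃²` is a
coderivation too, and a coderivation is zero as soon as its projection to `W` is: by induction on
the number of factors its values lie in the kernel of `Δ`, and that kernel is `W`
(`eq_zero_of_comul_eq_zero`), because over a field of characteristic `0` the symmetrizer is, up to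
a factorial, a section of `⊗ⁿ W → Pⁿ W`.

That `q̃` is a coderivation is seen on symmetrized tensors. In characteristic `0` the sum over the
unshuffles in `Δ` is, up to factorials, deconcatenation after the full symmetrizer
(`splitMk_symmetrizer`), and `q̃` is, up to factorials, `∑_m I_m ⊗ q ⊗ I` after the full
symmetrizer. Tensors of the latter form are again symmetric (`rho1_insertSum_symmetrizer`),
because permuting the outputs of `I_m ⊗ q ⊗ I` moves the slot `m` and permutes blocks of inputs
(`exists_rho1_comp_idTensor`). So all the symmetrizers but the first can be dropped, and the
coderivation property becomes `split_insertSum`: inserting `q` and then cutting a tensor in two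
means that `q` is inserted in the left or in the right piece.
-/

namespace PLInf
noncomputable section

variable {K V W : Type*} [Field K] [AddCommGroup V] [Module K V] [AddCommGroup W] [Module K W]

/-! ### Signs and parities -/

theorem prod_neg_one_pow {ι : Type*} (s : Finset ι) (f : ι → ZMod 2) :
    ∏ i ∈ s, (-1 : ℤˣ) ^ f i = (-1) ^ ∑ i ∈ s, f i := by
  classical
  induction s using Finset.induction_on with
  | empty => simp
  | insert i s hi ih => rw [Finset.prod_insert hi, Finset.sum_insert hi, uzpow_add, ih]

/-- Every function on `Fin n` is the restriction of a function on `ℕ`; this turns sums over `Fin n`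
into sums over `Finset.range n`. -/
theorem exists_eq_comp_val {A : Type*} [Zero A] {n : ℕ} (d : Fin n → A) :
    ∃ D : ℕ → A, d = fun t => D t.1 :=
  ⟨fun k => if h : k < n then d ⟨k, h⟩ else 0, funext fun t => by simp⟩

theorem sum_fin_filter_lt {A : Type*} [AddCommMonoid A] {n m : ℕ} (h : m ≤ n) (D : ℕ → A) :
    ∑ t : Fin n with t.1 < m, D t.1 = ∑ k ∈ Finset.range m, D k := by
  rw [Finset.sum_filter, Fin.sum_univ_eq_sum_range (fun k => if k < m then D k else 0) n,
    ← Finset.sum_filter]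
  congr 1
  ext k
  simp only [Finset.mem_filter, Finset.mem_range]
  omega

/-- The degrees of the entries of `insertTuple h m f x`, for `xᵢ` of degree `d i` and `f` of
degree `e`. -/
def insertDeg {A : Type*} [AddCommMonoid A] {N a b : ℕ} (h : a + b = N) (m : Fin (a + 1)) (e : A)
    (d : Fin (N + 1) → A) (t : Fin (a + 1)) : A :=
  if t < m then d ⟨t, by omega⟩
  else if t = m then ∑ s : Fin (b + 1), d ⟨m + s, by omega⟩ + e
  else d ⟨t + b, by omega⟩

theorem sum_range_insertDeg {A : Type*} [AddCommMonoid A] {a b m : ℕ} (hm : m ≤ a) (e : A)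
    (D : ℕ → A) :
    ∑ t ∈ Finset.range (a + 1), (if t < m then D t else if t = m then
      ∑ s ∈ Finset.range (b + 1), D (m + s) + e else D (t + b)) =
      ∑ t ∈ Finset.range (a + b + 1), D t + e := by
  obtain ⟨k, rfl⟩ := Nat.exists_eq_add_of_le hm
  rw [show m + k + 1 = m + (1 + k) by omega, Finset.sum_range_add _ m, Finset.sum_range_add _ 1,
    show m + k + b + 1 = m + ((b + 1) + k) by omega, Finset.sum_range_add D m,
    Finset.sum_range_add _ (b + 1)]
  have h1 : ∑ t ∈ Finset.range m, (if t < m then D t else if t = m then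
      ∑ s ∈ Finset.range (b + 1), D (m + s) + e else D (t + b)) = ∑ t ∈ Finset.range m, D t :=
    Finset.sum_congr rfl fun t ht => if_pos (Finset.mem_range.1 ht)
  have h2 : ∀ t, (if m + (1 + t) < m then D (m + (1 + t)) else if m + (1 + t) = m then
      ∑ s ∈ Finset.range (b + 1), D (m + s) + e else D (m + (1 + t) + b)) =
      D (m + (b + 1 + t)) := fun t => by
    rw [if_neg (by omega), if_neg (by omega)]
    congr 1
    omega
  rw [h1]
  simp only [h2, Finset.sum_range_one, add_zero, lt_irrefl, if_false, if_true]
  abel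

theorem insertDeg_val {A : Type*} [AddCommMonoid A] {N a b : ℕ} (h : a + b = N) (m : Fin (a + 1))
    (e : A) (D : ℕ → A) (t : Fin (a + 1)) :
    insertDeg h m e (fun s => D s.1) t = if t.1 < m.1 then D t else if t.1 = m.1 then
      ∑ s ∈ Finset.range (b + 1), D (m + s) + e else D (t + b) := by
  unfold insertDeg
  simp only [Fin.lt_def, Fin.ext_iff, Fin.sum_univ_eq_sum_range (fun s => D (m.1 + s))]

theorem sum_insertDeg {A : Type*} [AddCommMonoid A] {N a b : ℕ} (h : a + b = N) (m : Fin (a + 1))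
    (e : A) (d : Fin (N + 1) → A) : ∑ t, insertDeg h m e d t = ∑ s, d s + e := by
  obtain ⟨D, rfl⟩ := exists_eq_comp_val d
  subst h
  simp only [insertDeg_val]
  rw [Fin.sum_univ_eq_sum_range (fun t => if t < m.1 then D t else if t = m.1 then
      ∑ s ∈ Finset.range (b + 1), D (m + s) + e else D (t + b)) (a + 1),
    Fin.sum_univ_eq_sum_range D, sum_range_insertDeg (by omega)]

theorem mem_insertTuple {𝒱 : ℤ → Submodule K V} {N a b : ℕ} (h : a + b = N) (m : Fin (a + 1))
    {e : ℤ} {f : (⨂[K]^(b + 1) V) →ₗ[K] V} (hf : IsHomogeneousOp 𝒱 e f)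
    {d : Fin (N + 1) → ℤ} {x : Fin (N + 1) → V} (hx : ∀ i, x i ∈ 𝒱 (d i)) (t : Fin (a + 1)) :
    insertTuple h m f x t ∈ 𝒱 (insertDeg h m e d t) := by
  unfold insertDeg insertTuple
  split_ifs
  · exact hx _
  · exact hf _ _ fun s => hx _
  · exact hx _

section
variable (𝒱 : ℤ → Submodule K V) [DirectSum.Decomposition 𝒱]

/-- `f` shifts parities by `e`. The Koszul signs only depend on the parities of the degrees,
and this is the part of `IsHomogeneousOp` that they need. -/
def IsParityOp {n : ℕ} (e : ZMod 2) (f : (⨂[K]^n V) →ₗ[K] V) : Prop :=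
  ∀ (d : Fin n → ZMod 2) (x : Fin n → V), (∀ i, parityProj 𝒱 (d i) (x i) = x i) →
    parityProj 𝒱 (∑ i, d i + e) (f (PiTensorProduct.tprod K x)) = f (PiTensorProduct.tprod K x)

variable {𝒱}

theorem multilinear_ext_homogeneous {n : ℕ} {f g : MultilinearMap K (fun _ : Fin n => V) W}
    (h : ∀ (d : Fin n → ℤ) (x : Fin n → V), (∀ i, x i ∈ 𝒱 (d i)) → f x = g x) : f = g := by
  classical
  ext x
  have hx : x = fun i => ∑ j ∈ (DirectSum.decompose 𝒱 (x i)).support,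
      (DirectSum.decompose 𝒱 (x i) j : V) := by
    funext i; exact (DirectSum.sum_support_decompose 𝒱 (x i)).symm
  rw [hx, MultilinearMap.map_sum_finset, MultilinearMap.map_sum_finset]
  exact Finset.sum_congr rfl fun d _ => h d _ fun i => SetLike.coe_mem _

theorem linear_ext_homogeneous {n : ℕ} {f g : (⨂[K]^n V) →ₗ[K] W}
    (h : ∀ (d : Fin n → ℤ) (x : Fin n → V), (∀ i, x i ∈ 𝒱 (d i)) →
      f (PiTensorProduct.tprod K x) = g (PiTensorProduct.tprod K x)) : f = g :=
  PiTensorProduct.ext (multilinear_ext_homogeneous (𝒱 := 𝒱) h)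

theorem parityProj_eq_self_of_mem {i : ℤ} {v : V} (hv : v ∈ 𝒱 i) :
    parityProj 𝒱 (i : ZMod 2) v = v := by
  rw [parityProj_of_mem 𝒱 _ hv, if_pos rfl]

theorem IsHomogeneousOp.isParityOp {n : ℕ} {e : ℤ} {f : (⨂[K]^n V) →ₗ[K] V}
    (hf : IsHomogeneousOp 𝒱 e f) : IsParityOp 𝒱 e f := by
  intro d x hx
  have key : gradedExt 𝒱 (fun d => (parityProj 𝒱 (∑ i, d i + (e : ZMod 2)) ∘ₗ f).compMultilinearMap
      (PiTensorProduct.tprod K)) = f.compMultilinearMap (PiTensorProduct.tprod K) := by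
    refine multilinear_ext_homogeneous (𝒱 := 𝒱) fun d x hx => ?_
    rw [gradedExt_apply_of_mem _ hx]
    have := parityProj_eq_self_of_mem (hf d x hx)
    simpa using this
  have := congrArg (fun g => g x) key
  rwa [gradedExt_apply _ hx] at this

theorem idTensor_tprod {N a b : ℕ} (h : a + b = N) (m : Fin (a + 1)) (e : ℤ)
    (f : (⨂[K]^(b + 1) V) →ₗ[K] V) {d : Fin (N + 1) → ZMod 2} {x : Fin (N + 1) → V}
    (hx : ∀ i, parityProj 𝒱 (d i) (x i) = x i) :
    idTensor 𝒱 h m e f (PiTensorProduct.tprod K x) =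
      (-1 : ℤˣ) ^ ((e : ZMod 2) * ∑ t : Fin (N + 1) with t.1 < m.1, d t) •
        PiTensorProduct.tprod K (insertTuple h m f x) := by
  rw [idTensor, PiTensorProduct.lift.tprod, gradedExt_apply _ hx, units_smul_apply]
  rfl

theorem parity_insertTuple {N a b : ℕ} (h : a + b = N) (m : Fin (a + 1)) {e : ZMod 2}
    {f : (⨂[K]^(b + 1) V) →ₗ[K] V} (hf : IsParityOp 𝒱 e f)
    {d : Fin (N + 1) → ZMod 2} {x : Fin (N + 1) → V}
    (hx : ∀ i, parityProj 𝒱 (d i) (x i) = x i) (t : Fin (a + 1)) :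
    parityProj 𝒱 (insertDeg h m e d t) (insertTuple h m f x t) = insertTuple h m f x t := by
  unfold insertDeg insertTuple
  split_ifs
  · exact hx _
  · exact hf _ _ fun s => hx _
  · exact hx _

variable (𝒱) in
theorem rho1_one (n : ℕ) : rho1 𝒱 (1 : Equiv.Perm (Fin n)) = LinearMap.id := by
  refine linear_ext (𝒱 := 𝒱) fun d x hx => ?_
  rw [rho1_tprod 𝒱 _ hx]
  have : koszulSign (1 : Equiv.Perm (Fin n)) d = 1 := by
    refine Finset.prod_eq_one fun i _ => Finset.prod_eq_one fun j _ => if_neg ?_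
    simp only [Equiv.Perm.coe_one, id]
    omega
  rw [this, one_smul]
  rfl

end

/-! ### Cyclic permutations of consecutive positions -/

/-- `g` moves position `i + m` to position `i`, and shifts positions `i, …, i + m - 1` up by one:
`x ∘ g = (…, x_{i+m}, x_i, …, x_{i+m-1}, …)`. -/
def IsBlockShift {n : ℕ} (g : Equiv.Perm (Fin n)) (i m : ℕ) : Prop :=
  ∀ s, (g s).1 = if s.1 = i then i + m else if i < s.1 ∧ s.1 ≤ i + m then s.1 - 1 else s.1

theorem exists_isBlockShift {n i m : ℕ} (h : i + m < n) :
    ∃ g : Equiv.Perm (Fin n), IsBlockShift g i m := by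
  refine ⟨Equiv.ofBijective (fun s => ⟨if s.1 = i then i + m else
    if i < s.1 ∧ s.1 ≤ i + m then s.1 - 1 else s.1, by split_ifs <;> omega⟩)
    (Finite.injective_iff_bijective.1 fun s t hst => ?_), fun s => rfl⟩
  have := congrArg Fin.val hst
  simp only at this
  refine Fin.ext ?_
  split_ifs at this <;> omega

theorem IsBlockShift.fixLast {n i m : ℕ} {g : Equiv.Perm (Fin n)} (hg : IsBlockShift g i m)
    (h : i + m < n) : IsBlockShift (PLInf.fixLast g) i m := by
  intro s
  refine Fin.lastCases ?_ (fun s => ?_) s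
  · rw [fixLast_last]
    simp only [Fin.val_last]
    split_ifs <;> omega
  · rw [fixLast_castSucc]
    exact hg s

theorem isBlockShift_swap {n : ℕ} (j : Fin n) :
    IsBlockShift (Equiv.swap j.castSucc j.succ) j.1 1 := by
  intro s
  rw [Equiv.swap_apply_def]
  simp only [apply_ite Fin.val, Fin.ext_iff, Fin.val_castSucc, Fin.val_succ]
  split_ifs <;> omega

/-- Moving `x_{i+m}` past `x_i, …, x_{i+m-1}` costs the sign of the product of the degrees. -/
theorem koszulSign_blockShift {n i m : ℕ} {g : Equiv.Perm (Fin n)} (hg : IsBlockShift g i m)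
    (h : i + m < n) (D : ℕ → ZMod 2) :
    koszulSign g (fun s => D s.1) =
      (-1) ^ (D (i + m) * ∑ s ∈ Finset.range m, D (i + s)) := by
  have hi : i < n := by omega
  unfold koszulSign
  rw [Finset.prod_eq_single (⟨i, hi⟩ : Fin n)]
  · have e : ∀ q : Fin n, (if (⟨i, hi⟩ : Fin n) < q ∧ g q < g ⟨i, hi⟩ then
        (-1 : ℤˣ) ^ (D (g ⟨i, hi⟩) * D (g q)) else 1) =
        (fun r : Fin n => (-1 : ℤˣ) ^ (if i ≤ r.1 ∧ r.1 < i + m then D (i + m) * D r.1 else 0))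
          (g q) := fun q => by
      have h1 := hg ⟨i, hi⟩
      have h2 := hg q
      rw [if_pos rfl] at h1
      simp only [Fin.lt_def, h1]
      split_ifs with c1 c2 c2
      · rfl
      · split_ifs at h2 <;> omega
      · split_ifs at h2 <;> omega
      · simp
    rw [Finset.prod_congr rfl fun q _ => e q, Equiv.prod_comp g fun r : Fin n =>
      (-1 : ℤˣ) ^ (if i ≤ r.1 ∧ r.1 < i + m then D (i + m) * D r.1 else 0), prod_neg_one_pow,
      Fin.sum_univ_eq_sum_range (fun r => if i ≤ r ∧ r < i + m then D (i + m) * D r else 0) n]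
    congr 1
    obtain ⟨k, rfl⟩ := Nat.exists_eq_add_of_le h.le
    rw [Finset.sum_range_add, Finset.sum_range_add, Finset.mul_sum,
      Finset.sum_eq_zero (s := Finset.range i), Finset.sum_eq_zero (s := Finset.range k), zero_add,
      add_zero]
    · refine Finset.sum_congr rfl fun s hs => if_pos ?_
      have := Finset.mem_range.1 hs
      omega
    · intro s _
      exact if_neg (by omega)
    · intro s hs
      have := Finset.mem_range.1 hs
      exact if_neg (by omega)
  · intro p _ hp
    refine Finset.prod_eq_one fun q _ => if_neg ?_
    have hp' : p.1 ≠ i := fun e => hp (Fin.ext e)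
    have h1 := hg p
    have h2 := hg q
    simp only [Fin.lt_def]
    split_ifs at h1 h2 <;> omega
  · simp

/-! ### Equivariance of the insertion operations -/

section
variable {𝒱 : ℤ → Submodule K V} [DirectSum.Decomposition 𝒱]

/-- Reduces the exchange of a permutation and an insertion to an identity of tuples and an identity
of signs. -/
theorem rho1_comp_idTensor_of_eq {N a b : ℕ} (h : a + b = N) {m m' : Fin (a + 1)} {e : ℤ}
    {f : (⨂[K]^(b + 1) V) →ₗ[K] V} (hf : IsParityOp 𝒱 e f)
    (τ : Equiv.Perm (Fin (a + 1))) (g : Equiv.Perm (Fin (N + 1)))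
    (ht : ∀ (x : Fin (N + 1) → V) t,
      insertTuple h m f x (τ t) = insertTuple h m' f (fun s => x (g s)) t)
    (hs : ∀ d : Fin (N + 1) → ZMod 2,
      (-1 : ℤˣ) ^ ((e : ZMod 2) * ∑ t : Fin (N + 1) with t.1 < m.1, d t) *
          koszulSign τ (insertDeg h m (e : ZMod 2) d) =
        koszulSign g d *
          (-1 : ℤˣ) ^ ((e : ZMod 2) * ∑ t : Fin (N + 1) with t.1 < m'.1, d (g t))) :
    rho1 𝒱 τ ∘ₗ idTensor 𝒱 h m e f = idTensor 𝒱 h m' e f ∘ₗ rho1 𝒱 g := by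
  refine linear_ext (𝒱 := 𝒱) fun d x hx => ?_
  rw [LinearMap.comp_apply, LinearMap.comp_apply, idTensor_tprod h m e f hx, rho1_tprod 𝒱 g hx,
    map_zsmul_unit, map_zsmul_unit, rho1_tprod 𝒱 τ (parity_insertTuple h m hf hx),
    idTensor_tprod h m' e f (fun i => hx (g i)), smul_smul, smul_smul, hs]
  simp only [ht]

theorem rho1_comp_idTensor_after {N a b : ℕ} (h : a + b = N) {m : Fin (a + 1)} {e : ℤ}
    {f : (⨂[K]^(b + 1) V) →ₗ[K] V} (hf : IsParityOp 𝒱 e f) {j : ℕ} (hmj : m.1 < j)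
    (hj : j + 1 < a + 1)
    {τ : Equiv.Perm (Fin (a + 1))} {g : Equiv.Perm (Fin (N + 1))}
    (hτ : IsBlockShift τ j 1) (hg : IsBlockShift g (j + b) 1) :
    rho1 𝒱 τ ∘ₗ idTensor 𝒱 h m e f = idTensor 𝒱 h m e f ∘ₗ rho1 𝒱 g := by
  refine rho1_comp_idTensor_of_eq h hf τ g (fun x t => ?_) fun d => ?_
  · have h1 := hτ t
    have hg1 : ∀ s : Fin (N + 1), s.1 < j + b → g s = s := fun s hs => by
      have := hg s
      refine Fin.ext ?_
      split_ifs at this <;> omega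
    unfold insertTuple
    simp only [Fin.lt_def, Fin.ext_iff]
    by_cases c1 : t.1 < m.1
    · have : (τ t).1 = t.1 := by split_ifs at h1 <;> omega
      rw [if_pos c1, if_pos (by omega), hg1 _ (by simp only; omega)]
      simp only [this]
    by_cases c2 : t.1 = m.1
    · have : (τ t).1 = t.1 := by split_ifs at h1 <;> omega
      rw [if_neg c1, if_pos c2, if_neg (by omega), if_pos (by omega)]
      congr 2
      funext s
      rw [hg1 _ (by simp only; omega)]
    · have h2 := hg ⟨t + b, by omega⟩
      have : (τ t).1 + b = (g ⟨t + b, by omega⟩).1 := by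
        simp only at h2
        split_ifs at h1 h2 <;> omega
      have hm : m.1 < (τ t).1 := by split_ifs at h1 <;> omega
      rw [if_neg c1, if_neg c2, if_neg (by omega), if_neg (by omega)]
      exact congrArg x (Fin.ext this)
  · obtain ⟨D, rfl⟩ := exists_eq_comp_val d
    have hlt : ∀ t : Fin (N + 1), t.1 < m.1 → D (g t).1 = D t.1 := fun t ht => by
      have := hg t
      congr 1
      split_ifs at this <;> omega
    obtain ⟨E, hE⟩ : ∃ E : ℕ → ZMod 2, E = fun t => if t < m.1 then D t else if t = m.1 then
      ∑ s ∈ Finset.range (b + 1), D (m.1 + s) + (e : ZMod 2) else D (t + b) := ⟨_, rfl⟩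
    have hE' : insertDeg h m (e : ZMod 2) (fun s : Fin (N + 1) => D s.1) = fun t => E t.1 :=
      funext fun t => by rw [insertDeg_val, hE]
    rw [hE', koszulSign_blockShift hτ hj, koszulSign_blockShift hg (by omega),
      Finset.sum_congr rfl fun t ht => hlt t (Finset.mem_filter.1 ht).2, mul_comm]
    congr 3
    · rw [hE]
      simp only
      rw [if_neg (by omega), if_neg (by omega)]
      congr 1
      omega
    · rw [Finset.sum_range_one, Finset.sum_range_one, hE]
      simp only
      rw [if_neg (by omega), if_neg (by omega)]
      rfl

theorem rho1_comp_idTensor_before {N a b : ℕ} (h : a + b = N) {m : Fin (a + 1)} {e : ℤ}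
    {f : (⨂[K]^(b + 1) V) →ₗ[K] V} (hf : IsParityOp 𝒱 e f) {j : ℕ} (hj : j + 1 < m.1)
    {τ : Equiv.Perm (Fin (a + 1))} {g : Equiv.Perm (Fin (N + 1))}
    (hτ : IsBlockShift τ j 1) (hg : IsBlockShift g j 1) :
    rho1 𝒱 τ ∘ₗ idTensor 𝒱 h m e f = idTensor 𝒱 h m e f ∘ₗ rho1 𝒱 g := by
  refine rho1_comp_idTensor_of_eq h hf τ g (fun x t => ?_) fun d => ?_
  · have h1 := hτ t
    have hg1 : ∀ s : Fin (N + 1), j + 1 < s.1 → g s = s := fun s hs => by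
      have := hg s
      refine Fin.ext ?_
      split_ifs at this <;> omega
    unfold insertTuple
    simp only [Fin.lt_def, Fin.ext_iff]
    by_cases c1 : t.1 < m.1
    · have h2 := hg ⟨t, by omega⟩
      have : (τ t).1 < m.1 := by split_ifs at h1 <;> omega
      rw [if_pos c1, if_pos this]
      exact congrArg x (Fin.ext (h1.trans h2.symm))
    have : (τ t).1 = t.1 := by split_ifs at h1 <;> omega
    by_cases c2 : t.1 = m.1
    · rw [if_neg c1, if_pos c2, if_neg (by omega), if_pos (by omega)]
      congr 2
      funext s
      rw [hg1 _ (by simp only; omega)]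
    · rw [if_neg c1, if_neg c2, if_neg (by omega), if_neg (by omega), hg1 _ (by simp only; omega)]
      simp only [this]
  · obtain ⟨D, rfl⟩ := exists_eq_comp_val d
    have hlt : ∀ t : Fin (N + 1), (g t).1 < m.1 ↔ t.1 < m.1 := fun t => by
      have := hg t
      split_ifs at this <;> omega
    obtain ⟨E, hE⟩ : ∃ E : ℕ → ZMod 2, E = fun t => if t < m.1 then D t else if t = m.1 then
      ∑ s ∈ Finset.range (b + 1), D (m.1 + s) + (e : ZMod 2) else D (t + b) := ⟨_, rfl⟩
    have hE' : insertDeg h m (e : ZMod 2) (fun s : Fin (N + 1) => D s.1) = fun t => E t.1 :=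
      funext fun t => by rw [insertDeg_val, hE]
    have hsum : ∑ t : Fin (N + 1) with t.1 < m.1, D (g t).1 =
        ∑ t : Fin (N + 1) with t.1 < m.1, D t.1 := by
      rw [Finset.sum_filter, Finset.sum_filter,
        ← Equiv.sum_comp g fun t => if t.1 < m.1 then D t.1 else 0]
      simp only [hlt]
    rw [hE', koszulSign_blockShift hτ (by omega), koszulSign_blockShift hg (by omega), hsum,
      mul_comm]
    congr 3
    · rw [hE]
      simp only
      rw [if_pos (by omega)]
    · rw [Finset.sum_range_one, Finset.sum_range_one, hE]
      simp only
      rw [if_pos (by omega)]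

/-- Exchanging the inserted entry with its right neighbour moves that neighbour past the whole block
of arguments of `f`. -/
theorem rho1_comp_idTensor_succ {N a b : ℕ} (h : a + b = N) {m m' : Fin (a + 1)} {e : ℤ}
    {f : (⨂[K]^(b + 1) V) →ₗ[K] V} (hf : IsParityOp 𝒱 e f) (hm : m'.1 = m.1 + 1)
    {τ : Equiv.Perm (Fin (a + 1))} {g : Equiv.Perm (Fin (N + 1))}
    (hτ : IsBlockShift τ m.1 1) (hg : IsBlockShift g m.1 (b + 1)) :
    rho1 𝒱 τ ∘ₗ idTensor 𝒱 h m e f = idTensor 𝒱 h m' e f ∘ₗ rho1 𝒱 g := by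
  have hma : m.1 + 1 < a + 1 := by omega
  refine rho1_comp_idTensor_of_eq h hf τ g (fun x t => ?_) fun d => ?_
  · have h1 := hτ t
    unfold insertTuple
    simp only [Fin.lt_def, Fin.ext_iff]
    by_cases c1 : t.1 < m.1
    · have h2 := hg ⟨t, by omega⟩
      have : (τ t).1 < m.1 := by split_ifs at h1 <;> omega
      rw [if_pos (by omega), if_pos (by omega)]
      refine congrArg x (Fin.ext ?_)
      simp only at h2 ⊢
      split_ifs at h1 h2 <;> omega
    by_cases c2 : t.1 = m.1
    · have h2 := hg ⟨t, by omega⟩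
      rw [if_neg (by split_ifs at h1 <;> omega), if_neg (by split_ifs at h1 <;> omega),
        if_pos (by omega)]
      refine congrArg x (Fin.ext ?_)
      simp only at h2 ⊢
      split_ifs at h1 h2 <;> omega
    by_cases c3 : t.1 = m.1 + 1
    · rw [if_neg (by split_ifs at h1 <;> omega), if_pos (by split_ifs at h1 <;> omega),
        if_neg (by omega), if_pos (by omega)]
      congr 2
      funext s
      have h2 := hg ⟨m' + s, by omega⟩
      refine congrArg x (Fin.ext ?_)
      simp only at h2 ⊢
      split_ifs at h2 <;> omega
    · have h2 := hg ⟨t + b, by omega⟩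
      rw [if_neg (by split_ifs at h1 <;> omega), if_neg (by split_ifs at h1 <;> omega),
        if_neg (by omega), if_neg (by omega)]
      refine congrArg x (Fin.ext ?_)
      simp only at h2 ⊢
      split_ifs at h1 h2 <;> omega
  · obtain ⟨D, rfl⟩ := exists_eq_comp_val d
    obtain ⟨E, hE⟩ : ∃ E : ℕ → ZMod 2, E = fun t => if t < m.1 then D t else if t = m.1 then
      ∑ s ∈ Finset.range (b + 1), D (m.1 + s) + (e : ZMod 2) else D (t + b) := ⟨_, rfl⟩
    have hE' : insertDeg h m (e : ZMod 2) (fun s : Fin (N + 1) => D s.1) = fun t => E t.1 :=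
      funext fun t => by rw [insertDeg_val, hE]
    have hG : (fun t : Fin (N + 1) => D (g t).1) = fun t : Fin (N + 1) =>
        (fun k => D (if k = m.1 then m.1 + (b + 1) else
          if m.1 < k ∧ k ≤ m.1 + (b + 1) then k - 1 else k)) t.1 :=
      funext fun t => by rw [hg t]
    have hsum : ∑ t : Fin (N + 1) with t.1 < m'.1, D (g t).1 =
        ∑ k ∈ Finset.range m.1, D k + D (m.1 + (b + 1)) := by
      rw [hG, sum_fin_filter_lt (n := N + 1) (m := m'.1) (by omega)
        (fun k => D (if k = m.1 then m.1 + (b + 1) else if m.1 < k ∧ k ≤ m.1 + (b + 1) then k - 1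
          else k)), hm, Finset.sum_range_succ, if_pos rfl]
      congr 1
      refine Finset.sum_congr rfl fun k hk => ?_
      have := Finset.mem_range.1 hk
      rw [if_neg (by omega), if_neg (by omega)]
    rw [hE', koszulSign_blockShift hτ hma, koszulSign_blockShift hg (by omega), hsum,
      sum_fin_filter_lt (by omega), Finset.sum_range_one, ← uzpow_add, ← uzpow_add]
    have e1 : E (m.1 + 1) = D (m.1 + (b + 1)) := by
      rw [hE]
      simp only
      rw [if_neg (by omega), if_neg (by omega)]
      congr 1
      omega
    have e2 : E (m.1 + 0) = ∑ s ∈ Finset.range (b + 1), D (m.1 + s) + (e : ZMod 2) := by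
      rw [hE]
      simp
    rw [e1, e2]
    congr 1
    ring

/-- Permuting the entries other than the last one of the values of `I_m ⊗ f ⊗ I_{a-m}` amounts to
moving the slot `m` and permuting the arguments other than the last one. -/
theorem exists_rho1_comp_idTensor {N a b : ℕ} (h : a + b = N) {e : ℤ}
    {f : (⨂[K]^(b + 1) V) →ₗ[K] V} (hf : IsParityOp 𝒱 e f) (τ : Equiv.Perm (Fin a)) :
    ∀ m : Fin (a + 1), ∃ g : Equiv.Perm (Fin N),
      rho1 𝒱 (fixLast τ) ∘ₗ idTensor 𝒱 h (fixLast τ m) e f =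
        idTensor 𝒱 h m e f ∘ₗ rho1 𝒱 (fixLast g) := by
  have hone : ∀ n, fixLast (1 : Equiv.Perm (Fin n)) = 1 := fun n =>
    map_one (Equiv.Perm.viaEmbeddingHom Fin.castSuccEmb)
  cases a with
  | zero =>
    intro m
    obtain rfl := Subsingleton.elim τ 1
    exact ⟨1, by rw [hone, hone, rho1_one, rho1_one]; rfl⟩
  | succ a =>
    have hmem : τ ∈ Submonoid.closure
        (Set.range fun i : Fin a => Equiv.swap i.castSucc i.succ) := by
      rw [Equiv.Perm.mclosure_swap_castSucc_succ]
      exact Submonoid.mem_top τ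
    induction hmem using Submonoid.closure_induction with
    | mem τ hτ =>
      obtain ⟨j, rfl⟩ := hτ
      have hs : IsBlockShift (fixLast (Equiv.swap j.castSucc j.succ)) j.1 1 :=
        (isBlockShift_swap j).fixLast (by omega)
      have hval := fun m => hs m
      generalize hτ : fixLast (Equiv.swap j.castSucc j.succ) = τ at hs hval
      have hττ : rho1 𝒱 τ ∘ₗ rho1 𝒱 τ = LinearMap.id := by
        rw [← rho1_mul, ← hτ, ← fixLast_mul, Equiv.swap_mul_self, hone, rho1_one]
      intro m
      have hm := hval m
      rcases lt_trichotomy m.1 j.1 with c | c | c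
      · obtain ⟨g, hg⟩ := exists_isBlockShift (n := N) (i := j + b) (m := 1) (by omega)
        refine ⟨g, ?_⟩
        rw [show τ m = m from Fin.ext (by split_ifs at hm <;> omega)]
        exact rho1_comp_idTensor_after h hf c (by omega) hs (hg.fixLast (by omega))
      · obtain ⟨g, hg⟩ := exists_isBlockShift (n := N) (i := j.1) (m := b + 1) (by omega)
        have h1 := rho1_comp_idTensor_succ h hf (m := m) (m' := τ m)
          (by split_ifs at hm <;> omega) (c ▸ hs) (c ▸ hg.fixLast (by omega))
        refine ⟨g⁻¹, ?_⟩
        have h2 := congrArg (fun φ => rho1 𝒱 τ ∘ₗ φ ∘ₗ rho1 𝒱 (fixLast g⁻¹)) h1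
        simp only [← LinearMap.comp_assoc] at h2
        -- the exchange with the left neighbour is the inverse of the exchange with the right one
        rw [hττ, LinearMap.id_comp, LinearMap.comp_assoc, LinearMap.comp_assoc, ← rho1_mul,
          ← fixLast_mul, inv_mul_cancel, hone, rho1_one, LinearMap.comp_id] at h2
        exact h2.symm
      · by_cases c' : m.1 = j.1 + 1
        · obtain ⟨g, hg⟩ := exists_isBlockShift (n := N) (i := j.1) (m := b + 1) (by omega)
          have hτm : (τ m).1 = j.1 := by split_ifs at hm <;> omega
          exact ⟨g, rho1_comp_idTensor_succ h hf (by omega) (hτm ▸ hs)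
            (hτm ▸ hg.fixLast (by omega))⟩
        · obtain ⟨g, hg⟩ := exists_isBlockShift (n := N) (i := j.1) (m := 1) (by omega)
          refine ⟨g, ?_⟩
          rw [show τ m = m from Fin.ext (by split_ifs at hm <;> omega)]
          exact rho1_comp_idTensor_before h hf (by omega) hs (hg.fixLast (by omega))
    | one => exact fun m => ⟨1, by rw [hone, hone, rho1_one, rho1_one]; rfl⟩
    | mul τ₁ τ₂ _ _ h₁ h₂ =>
      intro m
      obtain ⟨g₂, hg₂⟩ := h₂ m
      obtain ⟨g₁, hg₁⟩ := h₁ (fixLast τ₂ m)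
      refine ⟨g₁ * g₂, ?_⟩
      rw [fixLast_mul, fixLast_mul, rho1_mul, rho1_mul, LinearMap.comp_assoc,
        Equiv.Perm.mul_apply, hg₁, ← LinearMap.comp_assoc, hg₂, LinearMap.comp_assoc]

variable (𝒱) in
/-- The sum `ρ⁽¹⁾_{w_N} ⊗ I₁` of all permutations of the first `N` factors of `⊗ᴺ⁺¹ V`. -/
def symmetrizer (N : ℕ) : (⨂[K]^(N + 1) V) →ₗ[K] (⨂[K]^(N + 1) V) :=
  ∑ σ : Equiv.Perm (Fin N), rho1 𝒱 (fixLast σ)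

variable (𝒱) in
theorem rho1_comp_symmetrizer {N : ℕ} (τ : Equiv.Perm (Fin N)) :
    rho1 𝒱 (fixLast τ) ∘ₗ symmetrizer 𝒱 N = symmetrizer 𝒱 N := by
  refine LinearMap.ext fun x => ?_
  rw [LinearMap.comp_apply, symmetrizer, LinearMap.sum_apply, map_sum,
    ← Equiv.sum_comp (Equiv.mulRight τ) fun σ => rho1 𝒱 (fixLast σ) x]
  refine Finset.sum_congr rfl fun σ _ => ?_
  rw [Equiv.coe_mulRight, fixLast_mul, rho1_mul, LinearMap.comp_apply]

variable (𝒱) in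
/-- The sum of all `I_m ⊗ f ⊗ I_{a-m}`, for `f` of degree `e`. -/
def insertSum {N a b : ℕ} (h : a + b = N) (e : ℤ) (f : (⨂[K]^(b + 1) V) →ₗ[K] V) :
    (⨂[K]^(N + 1) V) →ₗ[K] (⨂[K]^(a + 1) V) :=
  ∑ m : Fin (a + 1), idTensor 𝒱 h m e f

/-- After symmetrization of its arguments, `∑_m I_m ⊗ f ⊗ I_{a-m}` takes values invariant under
permutations of the factors other than the last one: such permutations only permute the summands. -/
theorem rho1_insertSum_symmetrizer {N a b : ℕ} (h : a + b = N) {e : ℤ}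
    {f : (⨂[K]^(b + 1) V) →ₗ[K] V} (hf : IsParityOp 𝒱 e f) (τ : Equiv.Perm (Fin a))
    (t : ⨂[K]^(N + 1) V) :
    rho1 𝒱 (fixLast τ) (insertSum 𝒱 h e f (symmetrizer 𝒱 N t)) =
      insertSum 𝒱 h e f (symmetrizer 𝒱 N t) := by
  simp only [insertSum, LinearMap.sum_apply, map_sum]
  rw [← Equiv.sum_comp (fixLast τ)]
  refine Finset.sum_congr rfl fun m _ => ?_
  obtain ⟨g, hg⟩ := exists_rho1_comp_idTensor h hf τ m
  rw [← LinearMap.comp_apply (rho1 𝒱 _), hg, LinearMap.comp_apply,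
    ← LinearMap.comp_apply (rho1 𝒱 _), rho1_comp_symmetrizer]

theorem symmetrizer_insertSum_symmetrizer {N a b : ℕ} (h : a + b = N) {e : ℤ}
    {f : (⨂[K]^(b + 1) V) →ₗ[K] V} (hf : IsParityOp 𝒱 e f) (t : ⨂[K]^(N + 1) V) :
    symmetrizer 𝒱 a (insertSum 𝒱 h e f (symmetrizer 𝒱 N t)) =
      (a.factorial : K) • insertSum 𝒱 h e f (symmetrizer 𝒱 N t) := by
  conv_lhs => rw [symmetrizer]
  rw [LinearMap.sum_apply, Finset.sum_congr rfl fun τ _ => rho1_insertSum_symmetrizer h hf τ t]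
  simp [Fintype.card_perm, Nat.cast_smul_eq_nsmul]

end

/-! ### Unshuffles and the symmetrizer -/

/-- There are `a! b!` permutations that preserve the blocks of sizes `a, 1, b`. -/
theorem card_blk_stabilizer {N a b : ℕ} (h : a + 1 + b = N) :
    Fintype.card {g : Equiv.Perm (Fin N) // ∀ i, blk a (g i) = blk a i} =
      a.factorial * b.factorial := by
  let f : Fin N → Fin 3 := fun i => ⟨blk a i, by unfold blk; split_ifs <;> omega⟩
  have e : Fintype.card {g : Equiv.Perm (Fin N) // ∀ i, blk a (g i) = blk a i} =
      Fintype.card {g : Equiv.Perm (Fin N) // f ∘ g = f} := by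
    refine Fintype.card_congr (Equiv.subtypeEquivRight fun g => ?_)
    simp only [funext_iff, Function.comp, f, Fin.ext_iff]
  have ha : a < N := by omega
  have h0 : (Finset.univ.filter fun i => f i = 0) = Finset.Iio ⟨a, ha⟩ := by
    ext i
    simp only [f, blk, Fin.ext_iff, Finset.mem_filter, Finset.mem_univ, true_and, Finset.mem_Iio,
      Fin.lt_def, Fin.val_zero]
    split_ifs <;> simp_all
  have h1 : (Finset.univ.filter fun i => f i = 1) = {⟨a, ha⟩} := by
    ext i
    simp only [f, blk, Fin.ext_iff, Finset.mem_filter, Finset.mem_univ, true_and,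
      Finset.mem_singleton, Fin.val_one]
    split_ifs <;> simp_all <;> omega
  have h2 : (Finset.univ.filter fun i => f i = 2) = Finset.Ioi ⟨a, ha⟩ := by
    ext i
    simp only [f, blk, Fin.ext_iff, Finset.mem_filter, Finset.mem_univ, true_and, Finset.mem_Ioi,
      Fin.lt_def, Fin.val_two]
    split_ifs <;> simp_all <;> omega
  rw [e, DomMulAct.stabilizer_card, Fin.prod_univ_three, Fintype.card_subtype,
    Fintype.card_subtype, Fintype.card_subtype, h0, h1, h2, Fin.card_Iio, Fin.card_Ioi,
    Finset.card_singleton, Nat.factorial_one, mul_one]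
  congr 2
  simp only
  omega

/-- Every permutation is an unshuffle followed by a permutation within the blocks, in a unique
way. -/
theorem sum_perm_eq_sum_unshuffles {N a b : ℕ} (h : a + 1 + b = N) {M : Type*} [AddCommMonoid M]
    (T : Equiv.Perm (Fin N) → M)
    (hT : ∀ σ g : Equiv.Perm (Fin N), (∀ i, blk a (g i) = blk a i) → T (σ * g) = T σ) :
    ∑ σ, T σ = (a.factorial * b.factorial) • ∑ σ ∈ unshuffles N a, T σ := by
  have hinv : ∀ {k : Equiv.Perm (Fin N)}, (∀ i, blk a (k i) = blk a i) →
      ∀ i, blk a (k⁻¹ i) = blk a i := fun {k} hk i => by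
    rw [← hk (k⁻¹ i)]; simp
  let G := {g : Equiv.Perm (Fin N) // ∀ i, blk a (g i) = blk a i}
  have hbij : Function.Bijective
      (fun q : ↥(unshuffles N a) × G => (q.1.1 * q.2.1 : Equiv.Perm (Fin N))) := by
    constructor
    · rintro ⟨⟨s, hs⟩, ⟨g, hg⟩⟩ ⟨⟨s', hs'⟩, ⟨g', hg'⟩⟩ hq
      simp only at hq
      have h1 : s' = s * (g * g'⁻¹) := by rw [← mul_assoc, hq, mul_inv_cancel_right]
      have h2 : s' = s := by
        rw [h1] at hs' ⊢
        exact unshuffle_unique hs (fun i => by rw [Equiv.Perm.mul_apply, hg, hinv hg']) hs'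
      subst h2
      obtain rfl : g = g' := by simpa using hq
      rfl
    · intro σ
      obtain ⟨g, hg, hσ⟩ := exists_unshuffle a σ
      exact ⟨⟨⟨_, hσ⟩, ⟨g⁻¹, hinv hg⟩⟩, by simp⟩
  rw [← hbij.sum_comp T, Fintype.sum_prod_type, ← card_blk_stabilizer h,
    ← Finset.sum_coe_sort (unshuffles N a), Finset.smul_sum]
  refine Finset.sum_congr rfl fun s _ => ?_
  rw [Finset.sum_congr rfl fun (g : G) _ => hT s.1 g.1 g.2, Finset.sum_const, Finset.card_univ]

section
variable (𝒱 : ℤ → Submodule K V) [DirectSum.Decomposition 𝒱]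

/-- The sum over the unshuffles is, up to a factor, the sum over all permutations. -/
theorem splitMk_symmetrizer {N a b : ℕ} (h : a + 1 + b = N) (t : ⨂[K]^(N + 1) V) :
    splitMk 𝒱 h (symmetrizer 𝒱 N t) = ((a.factorial * b.factorial : ℕ) : K) •
      splitMk 𝒱 h ((∑ σ ∈ unshuffles N a, rho1 𝒱 (fixLast σ)) t) := by
  rw [symmetrizer, LinearMap.sum_apply, map_sum, LinearMap.sum_apply, map_sum,
    sum_perm_eq_sum_unshuffles h, Nat.cast_smul_eq_nsmul]
  intro σ g hg
  rw [fixLast_mul, rho1_mul, LinearMap.comp_apply, ← LinearMap.comp_apply (splitMk 𝒱 h),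
    splitMk_comp_block 𝒱 h g hg]

/-! ### Splitting of tensors -/

theorem tmul_units_smul {M N : Type*} [AddCommGroup M] [Module K M] [AddCommGroup N] [Module K N]
    (e : ℤˣ) (u : M) (v : N) : u ⊗ₜ[K] (e • v) = e • u ⊗ₜ[K] v :=
  map_zsmul_unit (TensorProduct.mk K M N u) e v

theorem units_smul_tmul {M N : Type*} [AddCommGroup M] [Module K M] [AddCommGroup N] [Module K N]
    (e : ℤˣ) (u : M) (v : N) : (e • u) ⊗ₜ[K] v = e • u ⊗ₜ[K] v :=
  map_zsmul_unit ((TensorProduct.mk K M N).flip v) e u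

/-- A permutation of the left piece of a tensor, the last factor of that piece being fixed, is a
permutation of the whole tensor. -/
theorem map_rho1_split_left {N a b : ℕ} (h : a + 1 + b = N) (g : Equiv.Perm (Fin a)) :
    ∃ k : Equiv.Perm (Fin N),
      TensorProduct.map (rho1 𝒱 (fixLast g)) LinearMap.id ∘ₗ split h =
        split h ∘ₗ rho1 𝒱 (fixLast k) := by
  have haN : a ≤ N := by omega
  set E : Fin a ↪ Fin N := Fin.castLEEmb haN
  have hE : ∀ i, (E i).1 = i.1 := fun i => rfl
  have hin : ∀ i, g.viaEmbedding E (E i) = E (g i) := fun i => Equiv.Perm.viaEmbedding_apply _ _ _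
  have hout : ∀ j : Fin N, a ≤ j.1 → g.viaEmbedding E j = j := fun j hj => by
    refine Equiv.Perm.viaEmbedding_apply_of_notMem _ _ _ ?_
    rintro ⟨i, rfl⟩
    have := hE i
    omega
  refine ⟨g.viaEmbedding E, linear_ext (𝒱 := 𝒱) fun d x hx => ?_⟩
  have hε : koszulSign (fixLast (g.viaEmbedding E)) d =
      koszulSign (fixLast g) (fun i : Fin (a + 1) => d ⟨i, by omega⟩) := by
    rw [koszulSign_fixLast, koszulSign_fixLast, koszulSign_viaEmbedding]
    · rfl
    · intro i j hij
      exact hij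
    · intro i j l _ hl
      have hl' : l.1 ≤ j.1 := hl
      exact ⟨⟨l, by omega⟩, rfl⟩
  have h1 : ∀ i : Fin (a + 1), fixLast (g.viaEmbedding E) ⟨i, by omega⟩ =
      ⟨fixLast g i, by omega⟩ := fun i => by
    have hi : (⟨i, by omega⟩ : Fin (N + 1)) = Fin.castSucc ⟨i, by omega⟩ := rfl
    rw [hi, fixLast_castSucc]
    refine Fin.ext ?_
    refine Fin.lastCases ?_ (fun i => ?_) i
    · have hl : (fixLast g (Fin.last a)).1 = a := by rw [fixLast_last]; rfl
      simp only [hl]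
      rw [hout _ (by simp)]
      rfl
    · have hl : (fixLast g i.castSucc).1 = (g i).1 := by rw [fixLast_castSucc]; rfl
      simp only [hl]
      exact congrArg Fin.val (hin i)
  have h2 : ∀ i : Fin (b + 1), fixLast (g.viaEmbedding E) ⟨a + 1 + i, by omega⟩ =
      ⟨a + 1 + i, by omega⟩ := fun i => by
    by_cases hi : i.1 = b
    · have : (⟨a + 1 + i, by omega⟩ : Fin (N + 1)) = Fin.last N := Fin.ext (by simp; omega)
      rw [this, fixLast_last]
    · have : (⟨a + 1 + i, by omega⟩ : Fin (N + 1)) = Fin.castSucc ⟨a + 1 + i, by omega⟩ := rfl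
      rw [this, fixLast_castSucc, hout _ (by simp only; omega)]
  rw [LinearMap.comp_apply, LinearMap.comp_apply, rho1_tprod 𝒱 _ hx, map_zsmul_unit, split_tprod,
    split_tprod, TensorProduct.map_tmul, rho1_tprod 𝒱 (d := fun i : Fin (a + 1) => d ⟨i, by omega⟩) _
    (fun i => hx _), hε]
  simp only [h1, h2, units_smul_tmul, LinearMap.id_apply]

theorem map_rho1_split_right {N a b : ℕ} (h : a + 1 + b = N) (g : Equiv.Perm (Fin b)) :
    ∃ k : Equiv.Perm (Fin N),
      TensorProduct.map LinearMap.id (rho1 𝒱 (fixLast g)) ∘ₗ split h =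
        split h ∘ₗ rho1 𝒱 (fixLast k) := by
  let E : Fin b ↪ Fin N := ⟨fun i => ⟨a + 1 + i, by omega⟩, fun i j hij => by
    have := congrArg Fin.val hij
    exact Fin.ext (by simpa using this)⟩
  have hE : ∀ i, (E i).1 = a + 1 + i.1 := fun i => rfl
  have hin : ∀ i, g.viaEmbedding E (E i) = E (g i) := fun i => Equiv.Perm.viaEmbedding_apply _ _ _
  have hout : ∀ j : Fin N, j.1 ≤ a → g.viaEmbedding E j = j := fun j hj => by
    refine Equiv.Perm.viaEmbedding_apply_of_notMem _ _ _ ?_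
    rintro ⟨i, rfl⟩
    have := hE i
    omega
  refine ⟨g.viaEmbedding E, linear_ext (𝒱 := 𝒱) fun d x hx => ?_⟩
  have hε : koszulSign (fixLast (g.viaEmbedding E)) d =
      koszulSign (fixLast g) (fun i : Fin (b + 1) => d ⟨a + 1 + i, by omega⟩) := by
    rw [koszulSign_fixLast, koszulSign_fixLast, koszulSign_viaEmbedding]
    · rfl
    · intro i j hij
      have hij' : i.1 < j.1 := hij
      rw [Fin.lt_def, hE, hE]
      omega
    · intro i j l hl1 hl2
      rw [Fin.le_def, hE] at hl1 hl2
      exact ⟨⟨l - (a + 1), by omega⟩, Fin.ext (by rw [hE]; simp only; omega)⟩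
  have h1 : ∀ i : Fin (a + 1), fixLast (g.viaEmbedding E) ⟨i, by omega⟩ = ⟨i, by omega⟩ :=
    fun i => by
    have hi : (⟨i, by omega⟩ : Fin (N + 1)) = Fin.castSucc ⟨i, by omega⟩ := rfl
    rw [hi, fixLast_castSucc, hout _ (by simp only; omega)]
  have h2 : ∀ i : Fin (b + 1), fixLast (g.viaEmbedding E) ⟨a + 1 + i, by omega⟩ =
      ⟨a + 1 + fixLast g i, by omega⟩ := fun i => by
    refine Fin.ext ?_
    refine Fin.lastCases ?_ (fun i => ?_) i
    · have : (⟨a + 1 + Fin.last b, by simp; omega⟩ : Fin (N + 1)) = Fin.last N :=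
        Fin.ext (by simp; omega)
      have hl : (fixLast g (Fin.last b)).1 = b := by rw [fixLast_last]; rfl
      rw [this, fixLast_last]
      simp only [hl, Fin.val_last]
      omega
    · have : (⟨a + 1 + i.castSucc, by simp; omega⟩ : Fin (N + 1)) = Fin.castSucc (E i) := rfl
      have hl : (fixLast g i.castSucc).1 = (g i).1 := by rw [fixLast_castSucc]; rfl
      rw [this, fixLast_castSucc, hin]
      simp only [hl]
      rfl
  rw [LinearMap.comp_apply, LinearMap.comp_apply, rho1_tprod 𝒱 _ hx, map_zsmul_unit, split_tprod,
    split_tprod, TensorProduct.map_tmul,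
    rho1_tprod 𝒱 (d := fun i : Fin (b + 1) => d ⟨a + 1 + i, by omega⟩) _ (fun i => hx _), hε]
  simp only [h1, h2, tmul_units_smul, LinearMap.id_apply]

theorem map_sum_left {ι M M' N N' : Type*} [AddCommGroup M] [Module K M] [AddCommGroup M']
    [Module K M'] [AddCommGroup N] [Module K N] [AddCommGroup N'] [Module K N'] (s : Finset ι)
    (f : ι → M →ₗ[K] M') (g : N →ₗ[K] N') :
    TensorProduct.map (∑ i ∈ s, f i) g = ∑ i ∈ s, TensorProduct.map (f i) g := by
  have := congrArg (fun φ => φ g) (map_sum (TensorProduct.mapBilinear (RingHom.id K) M N M' N') f s)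
  simpa only [LinearMap.sum_apply, TensorProduct.mapBilinear_apply] using this

theorem map_sum_right {ι M M' N N' : Type*} [AddCommGroup M] [Module K M] [AddCommGroup M']
    [Module K M'] [AddCommGroup N] [Module K N] [AddCommGroup N'] [Module K N'] (s : Finset ι)
    (f : M →ₗ[K] M') (g : ι → N →ₗ[K] N') :
    TensorProduct.map f (∑ i ∈ s, g i) = ∑ i ∈ s, TensorProduct.map f (g i) :=
  map_sum (TensorProduct.mapBilinear (RingHom.id K) M N M' N' f) g s

theorem map_symmetrizer_split_left {N a b : ℕ} (h : a + 1 + b = N) (t : ⨂[K]^(N + 1) V) :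
    TensorProduct.map (symmetrizer 𝒱 a) LinearMap.id (split h (symmetrizer 𝒱 N t)) =
      (a.factorial : K) • split h (symmetrizer 𝒱 N t) := by
  conv_lhs => rw [symmetrizer]
  rw [map_sum_left, LinearMap.sum_apply,
    Finset.sum_congr rfl (g := fun _ => split h (symmetrizer 𝒱 N t))]
  · simp [Fintype.card_perm, Nat.cast_smul_eq_nsmul]
  · intro g _
    obtain ⟨k, hk⟩ := map_rho1_split_left 𝒱 h g
    rw [← LinearMap.comp_apply, hk, LinearMap.comp_apply, ← LinearMap.comp_apply (rho1 𝒱 _),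
      rho1_comp_symmetrizer]

theorem map_symmetrizer_split_right {N a b : ℕ} (h : a + 1 + b = N) (t : ⨂[K]^(N + 1) V) :
    TensorProduct.map LinearMap.id (symmetrizer 𝒱 b) (split h (symmetrizer 𝒱 N t)) =
      (b.factorial : K) • split h (symmetrizer 𝒱 N t) := by
  conv_lhs => rw [symmetrizer]
  rw [map_sum_right, LinearMap.sum_apply,
    Finset.sum_congr rfl (g := fun _ => split h (symmetrizer 𝒱 N t))]
  · simp [Fintype.card_perm, Nat.cast_smul_eq_nsmul]
  · intro g _
    obtain ⟨k, hk⟩ := map_rho1_split_right 𝒱 h g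
    rw [← LinearMap.comp_apply, hk, LinearMap.comp_apply, ← LinearMap.comp_apply (rho1 𝒱 _),
      rho1_comp_symmetrizer]

/-- The map `u ↦ (-1)^(e |u|) u` on `⊗ⁿ V`. -/
def tensorSign (n : ℕ) (e : ℤ) : (⨂[K]^n V) →ₗ[K] (⨂[K]^n V) :=
  PiTensorProduct.lift (gradedExt 𝒱 fun d =>
    (-1 : ℤˣ) ^ ((e : ZMod 2) * ∑ i, d i) •
      (PiTensorProduct.tprod K).domDomCongr (Equiv.refl (Fin n)))

variable {𝒱} in
theorem tensorSign_tprod {n : ℕ} (e : ℤ) {d : Fin n → ZMod 2} {x : Fin n → V}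
    (hx : ∀ i, parityProj 𝒱 (d i) (x i) = x i) :
    tensorSign 𝒱 n e (PiTensorProduct.tprod K x) =
      (-1 : ℤˣ) ^ ((e : ZMod 2) * ∑ i, d i) • PiTensorProduct.tprod K x := by
  rw [tensorSign, PiTensorProduct.lift.tprod, gradedExt_apply _ hx]
  rfl

theorem sum_fin_add {M : Type*} [AddCommMonoid M] {a b : ℕ} (F : Fin (a + 1 + b + 1) → M) :
    ∑ m, F m = ∑ m : Fin (a + 1), F ⟨m, by omega⟩ + ∑ m : Fin (b + 1), F ⟨a + 1 + m, by omega⟩ :=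
  Fin.sum_univ_add (a := a + 1) (b := b + 1) F

/-- The insertion of an operation is compatible with deconcatenation: the operation is inserted
into the left or the right factor. -/
theorem split_insertSum {N l a b c : ℕ} (hl : a + 1 + b = l) (h : l + c = N)
    (h₁ : a + c + 1 + b = N) (h₂ : a + 1 + (b + c) = N) (e : ℤ) (f : (⨂[K]^(c + 1) V) →ₗ[K] V)
    (t : ⨂[K]^(N + 1) V) :
    split hl (insertSum 𝒱 h e f t) =
      TensorProduct.map (insertSum 𝒱 (rfl : a + c = a + c) e f) LinearMap.id (split h₁ t) +
      TensorProduct.map (tensorSign 𝒱 (a + 1) e) (insertSum 𝒱 (rfl : b + c = b + c) e f)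
        (split h₂ t) := by
  suffices H : split hl ∘ₗ insertSum 𝒱 h e f =
      TensorProduct.map (insertSum 𝒱 (rfl : a + c = a + c) e f) LinearMap.id ∘ₗ split h₁ +
      TensorProduct.map (tensorSign 𝒱 (a + 1) e) (insertSum 𝒱 (rfl : b + c = b + c) e f) ∘ₗ
        split h₂ from LinearMap.congr_fun H t
  subst hl
  refine linear_ext (𝒱 := 𝒱) fun d x hx => ?_
  simp only [LinearMap.comp_apply, LinearMap.add_apply, split_tprod, TensorProduct.map_tmul,
    insertSum, LinearMap.sum_apply, map_sum, LinearMap.id_apply]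
  rw [sum_fin_add, TensorProduct.sum_tmul, TensorProduct.tmul_sum]
  congr 1
  · refine Finset.sum_congr rfl fun m _ => ?_
    rw [idTensor_tprod h _ e f hx, idTensor_tprod rfl m e f
      (d := fun i : Fin (a + c + 1) => d ⟨i, by omega⟩) (fun i => hx _), map_zsmul_unit, split_tprod]
    have hs : ∑ t : Fin (N + 1) with t.1 < m.1, d t =
        ∑ t : Fin (a + c + 1) with t.1 < m.1, d ⟨t, by omega⟩ := by
      obtain ⟨D, rfl⟩ := exists_eq_comp_val d
      rw [sum_fin_filter_lt (n := N + 1) (by omega), sum_fin_filter_lt (n := a + c + 1) (by omega)]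
    have e1 : (fun i : Fin (a + 1) => insertTuple h ⟨m, by omega⟩ f x ⟨i, by omega⟩) =
        insertTuple rfl m f (fun i : Fin (a + c + 1) => x ⟨i, by omega⟩) := funext fun i => by
      simp only [insertTuple, Fin.lt_def, Fin.ext_iff]
    have e2 : (fun i : Fin (b + 1) => insertTuple h ⟨m, by omega⟩ f x ⟨a + 1 + i, by omega⟩) =
        fun i : Fin (b + 1) => x ⟨a + c + 1 + i, by omega⟩ := funext fun i => by
      have h1 : ¬ a + 1 + i.1 < m.1 := by omega
      have h2 : ¬ a + 1 + i.1 = m.1 := by omega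
      simp only [insertTuple, Fin.lt_def, Fin.ext_iff, if_neg h1, if_neg h2]
      congr 2
      omega
    rw [hs, e1, e2, units_smul_tmul]
  · refine Finset.sum_congr rfl fun m _ => ?_
    rw [idTensor_tprod h _ e f hx, idTensor_tprod rfl m e f
      (d := fun i : Fin (b + c + 1) => d ⟨a + 1 + i, by omega⟩) (fun i => hx _), map_zsmul_unit,
      split_tprod, tensorSign_tprod e (d := fun i : Fin (a + 1) => d ⟨i, by omega⟩) (fun i => hx _)]
    have hs : ∑ t : Fin (N + 1) with t.1 < a + 1 + m.1, d t = ∑ i : Fin (a + 1), d ⟨i, by omega⟩ +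
        ∑ t : Fin (b + c + 1) with t.1 < m.1, d ⟨a + 1 + t, by omega⟩ := by
      obtain ⟨D, rfl⟩ := exists_eq_comp_val d
      rw [sum_fin_filter_lt (n := N + 1) (by omega), Finset.sum_range_add,
        sum_fin_filter_lt (n := b + c + 1) (by omega) (fun t => D (a + 1 + t)),
        Fin.sum_univ_eq_sum_range D]
    have e1 : (fun i : Fin (a + 1) => insertTuple h ⟨a + 1 + m, by omega⟩ f x ⟨i, by omega⟩) =
        fun i : Fin (a + 1) => x ⟨i, by omega⟩ := funext fun i => by
      simp only [insertTuple, Fin.lt_def]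
      exact if_pos (by omega)
    have e2 : (fun i : Fin (b + 1) =>
        insertTuple h ⟨a + 1 + m, by omega⟩ f x ⟨a + 1 + i, by omega⟩) =
        insertTuple rfl m f (fun i : Fin (b + c + 1) => x ⟨a + 1 + i, by omega⟩) :=
      funext fun i => by
      simp only [insertTuple, Fin.lt_def, Fin.ext_iff, add_lt_add_iff_left, add_right_inj, add_assoc]
    rw [hs, e1, e2, mul_add, uzpow_add, units_smul_tmul, tmul_units_smul, smul_smul]

end

/-! ### The induced map is a coderivation -/

section
variable (𝒱 : ℤ → Submodule K V) [DirectSum.Decomposition 𝒱]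

/-- The map `⊗ⁿ⁺¹ V → P* V`, `x₁ ⊗ … ⊗ xₙ₊₁ ↦ x₁ ∧ … ∧ xₙ ⊗ xₙ₊₁`. -/
def toPermCoalg (n : ℕ) : (⨂[K]^(n + 1) V) →ₗ[K] PermCoalg 𝒱 :=
  DirectSum.lof K ℕ (fun n => PermPart 𝒱 n) n ∘ₗ permMk 𝒱 n

variable {𝒱}

theorem permPart_ext {n : ℕ} {f g : PermPart 𝒱 n →ₗ[K] W}
    (h : ∀ t, f (permMk 𝒱 n t) = g (permMk 𝒱 n t)) : f = g := by
  suffices H : f ∘ₗ (permEquiv 𝒱 n).toLinearMap = g ∘ₗ (permEquiv 𝒱 n).toLinearMap from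
    LinearMap.ext fun u => LinearMap.congr_fun H u
  refine TensorProduct.ext ?_
  refine Submodule.linearMap_qext _ (PiTensorProduct.ext (MultilinearMap.ext fun x => ?_))
  refine LinearMap.ext fun v => ?_
  have := h (PiTensorProduct.tprod K (Fin.snoc x v : Fin (n + 1) → V))
  rw [permMk_tprod] at this
  simp only [Fin.snoc_castSucc, Fin.snoc_last] at this
  exact this

theorem permMk_surjective (n : ℕ) : Function.Surjective (permMk 𝒱 n) := by
  rw [← LinearMap.range_eq_top, ← Submodule.ker_mkQ (LinearMap.range (permMk 𝒱 n)),
    LinearMap.ker_eq_top]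
  exact permPart_ext fun t => by simp

theorem permCoalg_ext {f g : PermCoalg 𝒱 →ₗ[K] W}
    (h : ∀ n t, f (toPermCoalg 𝒱 n t) = g (toPermCoalg 𝒱 n t)) : f = g :=
  DirectSum.linearMap_ext K fun n => permPart_ext (h n)

variable (𝒱)

theorem permMk_symmetrizer {n : ℕ} (t : ⨂[K]^(n + 1) V) :
    permMk 𝒱 n (symmetrizer 𝒱 n t) = (n.factorial : K) • permMk 𝒱 n t := by
  rw [symmetrizer, LinearMap.sum_apply, map_sum,
    Finset.sum_congr rfl (g := fun _ => permMk 𝒱 n t)]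
  · simp [Fintype.card_perm, Nat.cast_smul_eq_nsmul]
  · intro σ _
    rw [← LinearMap.comp_apply, permMk_comp_rho1]

theorem signTwist_toPermCoalg (e : ℤ) (n : ℕ) (t : ⨂[K]^(n + 1) V) :
    signTwist 𝒱 e (toPermCoalg 𝒱 n t) = toPermCoalg 𝒱 n (tensorSign 𝒱 (n + 1) e t) := by
  suffices H : signTwist 𝒱 e ∘ₗ toPermCoalg 𝒱 n = toPermCoalg 𝒱 n ∘ₗ tensorSign 𝒱 (n + 1) e from
    LinearMap.congr_fun H t
  refine linear_ext (𝒱 := 𝒱) fun d x hx => ?_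
  rw [LinearMap.comp_apply, LinearMap.comp_apply, tensorSign_tprod e hx, map_zsmul_unit]
  simp only [toPermCoalg, signTwist, LinearMap.comp_apply, DirectSum.toModule_lof, permLift_permMk,
    PiTensorProduct.lift.tprod]
  rw [gradedExt_apply _ hx, units_smul_apply, map_zsmul_unit, LinearMap.compMultilinearMap_apply]

theorem coext_toPermCoalg (q : ∀ n, PermPart 𝒱 n →ₗ[K] V) (k : ℕ) (t : ⨂[K]^(k + 1) V) :
    coext 𝒱 q (toPermCoalg 𝒱 k t) = ∑ l : Fin (k + 1),
      ((l.1.factorial : K) * ((k - l.1).factorial : K))⁻¹ • toPermCoalg 𝒱 l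
        (insertSum 𝒱 (show l.1 + (k - l.1) = k by omega) (-1) (q (k - l.1) ∘ₗ permMk 𝒱 (k - l.1))
          (symmetrizer 𝒱 k t)) := by
  simp only [toPermCoalg, coext, LinearMap.comp_apply, DirectSum.toModule_lof, LinearMap.sum_apply]
  refine Finset.sum_congr rfl fun l _ => ?_
  rw [coextComponent, permLift_permMk, LinearMap.smul_apply, map_smul]
  rfl

/-- The comultiplication is deconcatenation after symmetrization, with the factor `1 / (a! b!)`. -/
theorem comul_toPermCoalg [CharZero K] (N : ℕ) (t : ⨂[K]^(N + 1) V) :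
    comul 𝒱 (toPermCoalg 𝒱 N t) = ∑ a : Fin N,
      ((a.1.factorial : K) * ((N - 1 - a.1).factorial : K))⁻¹ •
        TensorProduct.map (toPermCoalg 𝒱 a) (toPermCoalg 𝒱 (N - 1 - a.1))
          (split (show a.1 + 1 + (N - 1 - a.1) = N by omega) (symmetrizer 𝒱 N t)) := by
  simp only [comul, toPermCoalg, LinearMap.comp_apply, DirectSum.toModule_lof, LinearMap.sum_apply]
  refine Finset.sum_congr rfl fun a _ => ?_
  have hne : ((a.1.factorial * (N - 1 - a.1).factorial : ℕ) : K) ≠ 0 := by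
    exact_mod_cast (Nat.mul_pos (Nat.factorial_pos _) (Nat.factorial_pos _)).ne'
  rw [permLift_permMk, LinearMap.comp_apply, TensorProduct.map_comp, LinearMap.comp_apply,
    ← map_smul]
  congr 1
  have := splitMk_symmetrizer 𝒱 (show a.1 + 1 + (N - 1 - a.1) = N by omega) t
  rw [← Nat.cast_mul, eq_inv_smul_iff₀ hne, ← this]
  rfl

/-- Both double sums run over the triples `(a, b, c)` with `a + 1 + b + c = N`. -/
theorem sum_triples_left {M : Type*} [AddCommMonoid M] (N : ℕ) (F : ℕ → ℕ → ℕ → M) :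
    ∑ l : Fin (N + 1), ∑ a : Fin l, F a (l - 1 - a) (N - l) =
      ∑ r : Fin N, ∑ a : Fin (r + 1), F a (N - 1 - r) (r - a) := by
  rw [Finset.sum_sigma', Finset.sum_sigma']
  refine Finset.sum_bij' (fun s _ => ⟨⟨N - 1 - (s.1.1 - 1 - s.2.1), by omega⟩, ⟨s.2.1, by
      have := s.2.2; have := s.1.2; simp only; omega⟩⟩)
    (fun s _ => ⟨⟨s.2.1 + 1 + (N - 1 - s.1.1), by omega⟩, ⟨s.2.1, by simp only; omega⟩⟩)
    (by simp) (by simp) ?_ ?_ ?_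
  · rintro ⟨⟨l, hl⟩, ⟨a, ha⟩⟩ _
    simp only at ha ⊢
    have e : a + 1 + (N - 1 - (N - 1 - (l - 1 - a))) = l := by omega
    congr! 1
    · exact Fin.ext e
    · congr! 1
  · rintro ⟨⟨l, hl⟩, ⟨a, ha⟩⟩ _
    simp only at ha ⊢
    have e : N - 1 - (a + 1 + (N - 1 - l) - 1 - a) = l := by omega
    congr! 1
    · exact Fin.ext e
    · congr! 1
      rw [e]
  · rintro ⟨⟨l, hl⟩, ⟨a, ha⟩⟩ _
    simp only at ha ⊢
    congr 1 <;> omega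

theorem sum_triples_right {M : Type*} [AddCommMonoid M] (N : ℕ) (F : ℕ → ℕ → ℕ → M) :
    ∑ l : Fin (N + 1), ∑ a : Fin l, F a (l - 1 - a) (N - l) =
      ∑ a : Fin N, ∑ b : Fin (N - 1 - a + 1), F a b (N - 1 - a - b) := by
  rw [Finset.sum_sigma', Finset.sum_sigma']
  refine Finset.sum_bij' (fun s _ => ⟨⟨s.2.1, by omega⟩, ⟨s.1.1 - 1 - s.2.1, by
      have := s.2.2; have := s.1.2; simp only; omega⟩⟩)
    (fun s _ => ⟨⟨s.1.1 + 1 + s.2.1, by have := s.2.2; omega⟩, ⟨s.1.1, by simp only; omega⟩⟩)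
    (by simp) (by simp) ?_ ?_ ?_
  · rintro ⟨⟨l, hl⟩, ⟨a, ha⟩⟩ _
    simp only at ha ⊢
    have e : a + 1 + (l - 1 - a) = l := by omega
    congr! 1
    · exact Fin.ext e
    · congr! 1
  · rintro ⟨⟨a, ha⟩, ⟨b, hb⟩⟩ _
    simp only at hb ⊢
    congr! 2
    omega
  · rintro ⟨⟨l, hl⟩, ⟨a, ha⟩⟩ _
    simp only at ha ⊢
    congr 1
    omega

/-- The induced map is a coderivation: after symmetrization both sides are sums over the triples
`(a, b, c)` of the terms compared in `split_insertSum`. -/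
theorem isCoderivation_coext [CharZero K] (q : ∀ n, PermPart 𝒱 n →ₗ[K] V)
    (hq : ∀ n, IsParityOp 𝒱 ((-1 : ℤ) : ZMod 2) (q n ∘ₗ permMk 𝒱 n)) :
    IsCoderivation 𝒱 (-1) (coext 𝒱 q) := by
  refine permCoalg_ext fun N t => ?_
  have fac : ∀ n : ℕ, (n.factorial : K) ≠ 0 := fun n => by exact_mod_cast n.factorial_ne_zero
  set S := symmetrizer 𝒱 N t with hS
  let f := fun c => q c ∘ₗ permMk 𝒱 c
  -- `F`, `G`, `H` are the terms of `Δ q̃`, `(q̃ ⊗ Id) Δ`, `(Id ⊗ q̃) Δ`. They are extended by zero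
  -- to all triples of natural numbers, so that the sums can be reindexed without casts.
  let P := PermCoalg 𝒱 ⊗[K] PermCoalg 𝒱
  let cf : ℕ → ℕ → ℕ → K := fun a b c =>
    ((a.factorial : K) * (b.factorial : K) * (c.factorial : K))⁻¹
  let F : ℕ → ℕ → ℕ → P := fun a b c => if h : a + 1 + b + c = N then
    cf a b c • TensorProduct.map (toPermCoalg 𝒱 a) (toPermCoalg 𝒱 b)
      (split rfl (insertSum 𝒱 h (-1) (f c) S)) else 0
  let G : ℕ → ℕ → ℕ → P := fun a b c => if h : a + c + 1 + b = N then
    cf a b c • TensorProduct.map (toPermCoalg 𝒱 a) (toPermCoalg 𝒱 b)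
      (TensorProduct.map (insertSum 𝒱 rfl (-1) (f c)) LinearMap.id (split h S)) else 0
  let H : ℕ → ℕ → ℕ → P := fun a b c => if h : a + 1 + (b + c) = N then
    cf a b c • TensorProduct.map (toPermCoalg 𝒱 a) (toPermCoalg 𝒱 b)
      (TensorProduct.map (tensorSign 𝒱 (a + 1) (-1)) (insertSum 𝒱 rfl (-1) (f c))
        (split h S)) else 0
  have hFGH : ∀ a b c, F a b c = G a b c + H a b c := fun a b c => by
    by_cases h : a + 1 + b + c = N
    · simp only [F, G, H]
      rw [dif_pos h, dif_pos (show a + c + 1 + b = N by omega),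
        dif_pos (show a + 1 + (b + c) = N by omega), ← smul_add, ← map_add, split_insertSum 𝒱 rfl h]
    · simp only [F, G, H]
      rw [dif_neg h, dif_neg (show ¬ a + c + 1 + b = N by omega),
        dif_neg (show ¬ a + 1 + (b + c) = N by omega), add_zero]
  have hF : ∀ (l a b c : ℕ) (hl : a + 1 + b = l) (hc : l + c = N),
      ((l.factorial : K) * (c.factorial : K))⁻¹ • ((a.factorial : K) * (b.factorial : K))⁻¹ •
        TensorProduct.map (toPermCoalg 𝒱 a) (toPermCoalg 𝒱 b)
          (split hl (symmetrizer 𝒱 l (insertSum 𝒱 hc (-1) (f c) S))) = F a b c := by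
    intro l a b c hl hc
    subst hl
    simp only [F, cf]
    rw [dif_pos hc, hS, symmetrizer_insertSum_symmetrizer hc (hq c), map_smul, map_smul, smul_smul,
      smul_smul]
    congr 1
    have := fac a; have := fac b; have := fac c; have := fac (a + 1 + b)
    field_simp
  have hG : ∀ (r a b c : ℕ) (hr : a + c = r) (hb : r + 1 + b = N),
      ((r.factorial : K) * (b.factorial : K))⁻¹ • ((a.factorial : K) * (c.factorial : K))⁻¹ •
        TensorProduct.map (toPermCoalg 𝒱 a ∘ₗ insertSum 𝒱 hr (-1) (f c) ∘ₗ symmetrizer 𝒱 r)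
          (toPermCoalg 𝒱 b) (split hb S) = G a b c := by
    intro r a b c hr hb
    subst hr
    simp only [G, cf]
    have e : TensorProduct.map
        (toPermCoalg 𝒱 a ∘ₗ insertSum 𝒱 rfl (-1) (f c) ∘ₗ symmetrizer 𝒱 (a + c)) (toPermCoalg 𝒱 b) =
        TensorProduct.map (toPermCoalg 𝒱 a) (toPermCoalg 𝒱 b) ∘ₗ
          TensorProduct.map (insertSum 𝒱 rfl (-1) (f c)) LinearMap.id ∘ₗ
          TensorProduct.map (symmetrizer 𝒱 (a + c)) LinearMap.id := by
      rw [← TensorProduct.map_comp, ← TensorProduct.map_comp]; rfl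
    rw [dif_pos hb, e, LinearMap.comp_apply, LinearMap.comp_apply, hS, map_symmetrizer_split_left,
      map_smul, map_smul, smul_smul, smul_smul]
    congr 1
    have := fac a; have := fac b; have := fac c; have := fac (a + c)
    field_simp
  have hH : ∀ (r a b c : ℕ) (hr : b + c = r) (ha : a + 1 + r = N),
      ((a.factorial : K) * (r.factorial : K))⁻¹ • ((b.factorial : K) * (c.factorial : K))⁻¹ •
        TensorProduct.map (signTwist 𝒱 (-1) ∘ₗ toPermCoalg 𝒱 a)
          (toPermCoalg 𝒱 b ∘ₗ insertSum 𝒱 hr (-1) (f c) ∘ₗ symmetrizer 𝒱 r) (split ha S) =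
        H a b c := by
    intro r a b c hr ha
    subst hr
    simp only [H, cf]
    have e0 : signTwist 𝒱 (-1) ∘ₗ toPermCoalg 𝒱 a =
        toPermCoalg 𝒱 a ∘ₗ tensorSign 𝒱 (a + 1) (-1) :=
      LinearMap.ext fun u => signTwist_toPermCoalg 𝒱 (-1) a u
    have e : TensorProduct.map (signTwist 𝒱 (-1) ∘ₗ toPermCoalg 𝒱 a)
        (toPermCoalg 𝒱 b ∘ₗ insertSum 𝒱 rfl (-1) (f c) ∘ₗ symmetrizer 𝒱 (b + c)) =
        TensorProduct.map (toPermCoalg 𝒱 a) (toPermCoalg 𝒱 b) ∘ₗ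
          TensorProduct.map (tensorSign 𝒱 (a + 1) (-1)) (insertSum 𝒱 rfl (-1) (f c)) ∘ₗ
          TensorProduct.map LinearMap.id (symmetrizer 𝒱 (b + c)) := by
      rw [e0, ← TensorProduct.map_comp, ← TensorProduct.map_comp]; rfl
    rw [dif_pos ha, e, LinearMap.comp_apply, LinearMap.comp_apply, hS, map_symmetrizer_split_right,
      map_smul, map_smul, smul_smul, smul_smul]
    congr 1
    have := fac a; have := fac b; have := fac c; have := fac (b + c)
    field_simp
  have coext_comp : ∀ k, coext 𝒱 q ∘ₗ toPermCoalg 𝒱 k = ∑ l : Fin (k + 1),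
      ((l.1.factorial : K) * ((k - l.1).factorial : K))⁻¹ • (toPermCoalg 𝒱 l ∘ₗ
        insertSum 𝒱 (show l.1 + (k - l.1) = k by omega) (-1) (f (k - l.1)) ∘ₗ
          symmetrizer 𝒱 k) := fun k => LinearMap.ext fun u => by
    rw [LinearMap.comp_apply, coext_toPermCoalg, LinearMap.sum_apply]
    rfl
  have h1 : comul 𝒱 (coext 𝒱 q (toPermCoalg 𝒱 N t)) =
      ∑ l : Fin (N + 1), ∑ a : Fin l, F a (l - 1 - a) (N - l) := by
    rw [coext_toPermCoalg, map_sum]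
    refine Finset.sum_congr rfl fun l _ => ?_
    rw [map_smul, comul_toPermCoalg, Finset.smul_sum]
    exact Finset.sum_congr rfl fun a _ => hF _ _ _ _ _ _
  have h2 : TensorProduct.map (coext 𝒱 q) LinearMap.id (comul 𝒱 (toPermCoalg 𝒱 N t)) =
      ∑ r : Fin N, ∑ a : Fin (r + 1), G a (N - 1 - r) (r - a) := by
    rw [comul_toPermCoalg, map_sum]
    refine Finset.sum_congr rfl fun r _ => ?_
    rw [map_smul, ← LinearMap.comp_apply, ← TensorProduct.map_comp, coext_comp, LinearMap.id_comp,
      map_sum_left, LinearMap.sum_apply, Finset.smul_sum]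
    refine Finset.sum_congr rfl fun a _ => ?_
    rw [TensorProduct.map_smul_left, LinearMap.smul_apply]
    exact hG _ _ _ _ _ _
  have h3 : TensorProduct.map (signTwist 𝒱 (-1)) (coext 𝒱 q) (comul 𝒱 (toPermCoalg 𝒱 N t)) =
      ∑ a : Fin N, ∑ b : Fin (N - 1 - a + 1), H a b (N - 1 - a - b) := by
    rw [comul_toPermCoalg, map_sum]
    refine Finset.sum_congr rfl fun r _ => ?_
    rw [map_smul, ← LinearMap.comp_apply, ← TensorProduct.map_comp, coext_comp,
      map_sum_right, LinearMap.sum_apply, Finset.smul_sum]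
    refine Finset.sum_congr rfl fun a _ => ?_
    rw [TensorProduct.map_smul_right, LinearMap.smul_apply]
    exact hH _ _ _ _ _ _
  rw [LinearMap.comp_apply, LinearMap.comp_apply, LinearMap.add_apply, h1, h2, h3]
  simp only [hFGH, Finset.sum_add_distrib]
  rw [sum_triples_left N G, sum_triples_right N H]

end

/-! ### Degrees in the Perm-coalgebra -/

section
variable {𝒱 : ℤ → Submodule K V} [DirectSum.Decomposition 𝒱]

theorem toPermCoalg_mem_permDegree {n : ℕ} {d : Fin (n + 1) → ℤ} {x : Fin (n + 1) → V}
    (hx : ∀ i, x i ∈ 𝒱 (d i)) :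
    toPermCoalg 𝒱 n (PiTensorProduct.tprod K x) ∈ permDegree 𝒱 (∑ i, d i) :=
  Submodule.subset_span ⟨n, d, x, hx, rfl, rfl⟩

theorem isPermHomogeneous_coext (q : ∀ n, PermPart 𝒱 n →ₗ[K] V)
    (hq : ∀ n, IsHomogeneousOp 𝒱 (-1) (q n ∘ₗ permMk 𝒱 n)) :
    IsPermHomogeneous 𝒱 (-1) (coext 𝒱 q) := by
  intro k u hu
  induction hu using Submodule.span_induction with
  | zero => rw [map_zero]; exact zero_mem _
  | add u v _ _ hu hv => rw [map_add]; exact add_mem hu hv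
  | smul c u _ hu => rw [map_smul]; exact Submodule.smul_mem _ _ hu
  | mem u hu =>
    obtain ⟨n, d, x, hx, rfl, rfl⟩ := hu
    have hp : ∀ i, parityProj 𝒱 ((d i : ℤ) : ZMod 2) (x i) = x i :=
      fun i => parityProj_eq_self_of_mem (hx i)
    change coext 𝒱 q (toPermCoalg 𝒱 n (PiTensorProduct.tprod K x)) ∈ _
    rw [coext_toPermCoalg]
    refine Submodule.sum_mem _ fun l _ => Submodule.smul_mem _ _ ?_
    rw [symmetrizer, LinearMap.sum_apply, map_sum, map_sum]
    refine Submodule.sum_mem _ fun σ _ => ?_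
    rw [rho1_tprod 𝒱 _ hp, map_zsmul_unit, map_zsmul_unit, Units.smul_def]
    refine zsmul_mem ?_ _
    rw [insertSum, LinearMap.sum_apply, map_sum]
    refine Submodule.sum_mem _ fun m _ => ?_
    rw [idTensor_tprod _ m (-1) _ (fun i => hp (fixLast σ i)), map_zsmul_unit, Units.smul_def]
    refine zsmul_mem ?_ _
    have := toPermCoalg_mem_permDegree (mem_insertTuple (show l.1 + (n - l.1) = n by omega) m
      (hq _) (fun i => hx (fixLast σ i)))
    rwa [sum_insertDeg, Equiv.sum_comp (fixLast σ) d] at this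

theorem signTwist_of_mem {e k : ℤ} {u : PermCoalg 𝒱} (hu : u ∈ permDegree 𝒱 k) :
    signTwist 𝒱 e u = ((-1 : ℤˣ) ^ ((e : ZMod 2) * k)) • u := by
  induction hu using Submodule.span_induction with
  | zero => rw [map_zero, smul_zero]
  | add u v _ _ hu hv => rw [map_add, hu, hv, smul_add]
  | smul c u _ hu => rw [map_smul, hu, smul_comm]
  | mem u hu =>
    obtain ⟨n, d, x, hx, rfl, rfl⟩ := hu
    change signTwist 𝒱 e (toPermCoalg 𝒱 n (PiTensorProduct.tprod K x)) = _
    rw [signTwist_toPermCoalg, tensorSign_tprod e fun i => parityProj_eq_self_of_mem (hx i),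
      map_zsmul_unit, Int.cast_sum]
    rfl

/-- A map of degree `-1` anticommutes with the sign twist. -/
theorem IsPermHomogeneous.signTwist_comp {f : PermCoalg 𝒱 →ₗ[K] PermCoalg 𝒱}
    (hf : IsPermHomogeneous 𝒱 (-1) f) : signTwist 𝒱 (-1) ∘ₗ f = -(f ∘ₗ signTwist 𝒱 (-1)) := by
  refine permCoalg_ext fun n => LinearMap.congr_fun
    (f := (signTwist 𝒱 (-1) ∘ₗ f) ∘ₗ toPermCoalg 𝒱 n)
    (g := -(f ∘ₗ signTwist 𝒱 (-1)) ∘ₗ toPermCoalg 𝒱 n)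
    (linear_ext_homogeneous (𝒱 := 𝒱) fun d x hx => ?_)
  have hu := toPermCoalg_mem_permDegree hx
  simp only [LinearMap.comp_apply, LinearMap.neg_apply]
  rw [signTwist_of_mem hu, signTwist_of_mem (hf _ _ hu), map_zsmul_unit]
  push_cast
  rw [mul_add, uzpow_add]
  have : (-1 : ℤˣ) ^ ((-1 : ZMod 2) * -1) = -1 := by
    rw [show (-1 : ZMod 2) * -1 = 1 by decide, uzpow_one]
  rw [this, mul_neg_one, Units.smul_def, Units.smul_def, Units.val_neg, neg_smul]

/-! ### Cofreeness -/

variable (𝒱)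

/-- The identification of `⊗¹ V` with `V`. -/
def tensorOne (K V : Type*) [Field K] [AddCommGroup V] [Module K V] : (⨂[K]^1 V) ≃ₗ[K] V :=
  PiTensorProduct.subsingletonEquiv (0 : Fin 1)

theorem tensorOne_tprod (x : Fin 1 → V) : tensorOne K V (PiTensorProduct.tprod K x) = x 0 :=
  PiTensorProduct.subsingletonEquiv_apply_tprod 0 x

/-- The projection of `P* V` onto its first summand `P¹ V = V`. -/
def corestrict : PermCoalg 𝒱 →ₗ[K] V :=
  permLift 𝒱 (tensorOne K V).toLinearMap (fun σ => by
    obtain rfl := Subsingleton.elim σ 1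
    rw [show fixLast (1 : Equiv.Perm (Fin 0)) = 1 from
      map_one (Equiv.Perm.viaEmbeddingHom Fin.castSuccEmb), rho1_one]
    rfl) ∘ₗ
    DirectSum.component K ℕ (fun n => PermPart 𝒱 n) 0

theorem corestrict_toPermCoalg_zero (t : ⨂[K]^1 V) :
    corestrict 𝒱 (toPermCoalg 𝒱 0 t) = tensorOne K V t := by
  rw [corestrict, toPermCoalg, LinearMap.comp_apply, LinearMap.comp_apply,
    DirectSum.component.lof_self, permLift_permMk]
  rfl

theorem corestrict_toPermCoalg_of_ne {n : ℕ} (hn : n ≠ 0) (t : ⨂[K]^(n + 1) V) :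
    corestrict 𝒱 (toPermCoalg 𝒱 n t) = 0 := by
  rw [corestrict, toPermCoalg, LinearMap.comp_apply, LinearMap.comp_apply,
    DirectSum.component.of, dif_neg hn, map_zero]

theorem tensorOne_insertSum {k : ℕ} (h : 0 + k = k) (e : ℤ) (f : (⨂[K]^(k + 1) V) →ₗ[K] V)
    (t : ⨂[K]^(k + 1) V) :
    tensorOne K V (insertSum 𝒱 h e f t) = f t := by
  suffices H : (tensorOne K V).toLinearMap ∘ₗ
      insertSum 𝒱 h e f = f from LinearMap.congr_fun H t
  refine linear_ext (𝒱 := 𝒱) fun d x hx => ?_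
  rw [LinearMap.comp_apply, insertSum, LinearMap.sum_apply, Fin.sum_univ_one,
    idTensor_tprod _ _ _ _ hx, map_zsmul_unit]
  have : (Finset.univ.filter fun t : Fin (k + 1) => t.1 < (0 : Fin (0 + 1)).1) = ∅ := by
    ext; simp
  rw [this, Finset.sum_empty, mul_zero, uzpow_zero, one_smul, LinearEquiv.coe_coe,
    tensorOne_tprod]
  simp only [insertTuple, lt_irrefl, if_false, if_true]
  congr 2
  funext s
  exact congrArg x (Fin.ext (Nat.zero_add _))

/-- The composite of the induced map with the projection onto `V` recovers the given maps. -/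
theorem corestrict_coext [CharZero K] (q : ∀ n, PermPart 𝒱 n →ₗ[K] V) (k : ℕ)
    (t : ⨂[K]^(k + 1) V) :
    corestrict 𝒱 (coext 𝒱 q (toPermCoalg 𝒱 k t)) = q k (permMk 𝒱 k t) := by
  have fac : (k.factorial : K) ≠ 0 := by exact_mod_cast k.factorial_ne_zero
  rw [coext_toPermCoalg, map_sum, Finset.sum_eq_single 0]
  · have h0 : ∀ (l b : ℕ) (h : l + b = k) (hl : l = 0), corestrict 𝒱
        (((l.factorial : K) * (b.factorial : K))⁻¹ • toPermCoalg 𝒱 l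
        (insertSum 𝒱 h (-1) (q b ∘ₗ permMk 𝒱 b) (symmetrizer 𝒱 k t))) = q k (permMk 𝒱 k t) := by
      intro l b h hl
      subst hl
      obtain rfl : b = k := by omega
      rw [map_smul, corestrict_toPermCoalg_zero, tensorOne_insertSum, LinearMap.comp_apply,
        permMk_symmetrizer, map_smul, smul_smul, Nat.factorial_zero, Nat.cast_one, one_mul,
        inv_mul_cancel₀ fac, one_smul]
    exact h0 _ _ _ rfl
  · intro l _ hl
    rw [map_smul, corestrict_toPermCoalg_of_ne 𝒱 (fun h => hl (Fin.ext h)), smul_zero]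
  · simp

theorem symmetrizer_comp_rho1 {n : ℕ} (τ : Equiv.Perm (Fin n)) :
    symmetrizer 𝒱 n ∘ₗ rho1 𝒱 (fixLast τ) = symmetrizer 𝒱 n :=
  sum_rho1_comp 𝒱 τ

/-- The map that sends `x₁ ∧ … ∧ xₙ ⊗ xₙ₊₁` to the signed sum over all orderings of the first `n`
factors. Up to the factor `n!` it is a section of `permMk`. -/
def permSymm (n : ℕ) : PermPart 𝒱 n →ₗ[K] (⨂[K]^(n + 1) V) :=
  permLift 𝒱 (symmetrizer 𝒱 n) (symmetrizer_comp_rho1 𝒱)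

theorem permSymm_injective [CharZero K] (n : ℕ) : Function.Injective (permSymm 𝒱 n) := by
  have fac : (n.factorial : K) ≠ 0 := by exact_mod_cast n.factorial_ne_zero
  refine (injective_iff_map_eq_zero _).2 fun u hu => ?_
  obtain ⟨t, rfl⟩ := permMk_surjective n u
  rw [permSymm, permLift_permMk] at hu
  have := permMk_symmetrizer 𝒱 t
  rw [hu, map_zero] at this
  exact (smul_eq_zero.1 this.symm).resolve_left fac

theorem split_injective {N a b : ℕ} (h : a + 1 + b = N) :
    Function.Injective (split (K := K) (V := V) h) := by
  unfold split
  rw [LinearMap.coe_comp]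
  exact (LinearEquiv.injective _).comp (LinearEquiv.injective _)

/-- The part of the comultiplication that splits off a single factor, as a map into tensors. -/
theorem map_permSymm_comul [CharZero K] (b : ℕ) (u : PermCoalg 𝒱) :
    TensorProduct.map (permSymm 𝒱 0 ∘ₗ DirectSum.component K ℕ (fun n => PermPart 𝒱 n) 0)
      (permSymm 𝒱 b ∘ₗ DirectSum.component K ℕ (fun n => PermPart 𝒱 n) b) (comul 𝒱 u) =
    split (show 0 + 1 + b = b + 1 by omega) (permSymm 𝒱 (b + 1)
      (DirectSum.component K ℕ (fun n => PermPart 𝒱 n) (b + 1) u)) := by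
  suffices H : TensorProduct.map
      (permSymm 𝒱 0 ∘ₗ DirectSum.component K ℕ (fun n => PermPart 𝒱 n) 0)
      (permSymm 𝒱 b ∘ₗ DirectSum.component K ℕ (fun n => PermPart 𝒱 n) b) ∘ₗ comul 𝒱 =
      split (show 0 + 1 + b = b + 1 by omega) ∘ₗ permSymm 𝒱 (b + 1) ∘ₗ
        DirectSum.component K ℕ (fun n => PermPart 𝒱 n) (b + 1) from LinearMap.congr_fun H u
  have hself : ∀ n, (permSymm 𝒱 n ∘ₗ DirectSum.component K ℕ (fun n => PermPart 𝒱 n) n) ∘ₗ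
      toPermCoalg 𝒱 n = symmetrizer 𝒱 n := fun n => LinearMap.ext fun t => by
    rw [LinearMap.comp_apply, LinearMap.comp_apply, toPermCoalg, LinearMap.comp_apply,
      DirectSum.component.lof_self, permSymm, permLift_permMk]
  have hne : ∀ m n, m ≠ n → (permSymm 𝒱 n ∘ₗ
      DirectSum.component K ℕ (fun n => PermPart 𝒱 n) n) ∘ₗ toPermCoalg 𝒱 m = 0 :=
    fun m n hmn => LinearMap.ext fun t => by
      rw [LinearMap.comp_apply, LinearMap.comp_apply, toPermCoalg, LinearMap.comp_apply,
        DirectSum.component.of, dif_neg hmn, map_zero, LinearMap.zero_apply]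
  refine permCoalg_ext fun N t => ?_
  rw [LinearMap.comp_apply, comul_toPermCoalg, map_sum, LinearMap.comp_apply,
    ← LinearMap.comp_apply _ (toPermCoalg 𝒱 N)]
  simp only [map_smul]
  simp only [← LinearMap.comp_apply (TensorProduct.map _ _) (TensorProduct.map _ _),
    ← TensorProduct.map_comp]
  by_cases hN : N = b + 1
  · subst hN
    have fac : (b.factorial : K) ≠ 0 := by exact_mod_cast b.factorial_ne_zero
    rw [hself, Finset.sum_eq_single 0]
    · have e : TensorProduct.map (symmetrizer 𝒱 0) (symmetrizer 𝒱 b) =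
          TensorProduct.map (symmetrizer 𝒱 0) LinearMap.id ∘ₗ
            TensorProduct.map LinearMap.id (symmetrizer 𝒱 b) := by
        rw [← TensorProduct.map_comp]; rfl
      change ((Nat.factorial 0 : K) * (b.factorial : K))⁻¹ • TensorProduct.map
        ((permSymm 𝒱 0 ∘ₗ _) ∘ₗ toPermCoalg 𝒱 0) ((permSymm 𝒱 b ∘ₗ _) ∘ₗ toPermCoalg 𝒱 b)
          (split (show 0 + 1 + b = b + 1 by omega) _) = _
      rw [hself, hself, e, LinearMap.comp_apply, map_symmetrizer_split_right, map_smul,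
        map_symmetrizer_split_left, smul_smul, smul_smul, Nat.factorial_zero, Nat.cast_one, one_mul,
        mul_one, inv_mul_cancel₀ fac, one_smul]
    · intro a _ ha
      rw [hne a.1 0 (fun h => ha (Fin.ext h)), TensorProduct.map_zero_left, LinearMap.zero_apply,
        smul_zero]
    · simp
  · rw [hne _ _ hN, LinearMap.zero_apply, map_zero]
    refine Finset.sum_eq_zero fun a _ => ?_
    by_cases ha : a.1 = 0
    · rw [hne (N - 1 - a.1) b (by omega), TensorProduct.map_zero_right, LinearMap.zero_apply,
        smul_zero]
    · rw [hne a.1 0 ha, TensorProduct.map_zero_left, LinearMap.zero_apply, smul_zero]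

/-- The kernel of the comultiplication is `V`. -/
theorem eq_zero_of_comul_eq_zero [CharZero K] {u : PermCoalg 𝒱} (h : comul 𝒱 u = 0)
    (h0 : corestrict 𝒱 u = 0) : u = 0 := by
  refine DirectSum.ext_component K fun n => ?_
  rw [map_zero]
  cases n with
  | zero =>
    obtain ⟨t, ht⟩ := permMk_surjective (𝒱 := 𝒱) 0
      (DirectSum.component K ℕ (fun n => PermPart 𝒱 n) 0 u)
    rw [corestrict, LinearMap.comp_apply, ← ht, permLift_permMk, LinearEquiv.coe_coe,
      LinearEquiv.map_eq_zero_iff] at h0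
    rw [← ht, h0, map_zero]
  | succ b =>
    have := map_permSymm_comul 𝒱 b u
    rw [h, map_zero] at this
    refine permSymm_injective 𝒱 (b + 1) ?_
    rw [map_zero]
    refine split_injective (show 0 + 1 + b = b + 1 by omega) ?_
    rw [← this, map_zero]

/-- The square of a coderivation of degree `-1` is a coderivation, hence is determined by its
projection to `V`. -/
theorem comp_self_eq_zero [CharZero K] {f : PermCoalg 𝒱 →ₗ[K] PermCoalg 𝒱}
    (hf : IsCoderivation 𝒱 (-1) f) (hdeg : IsPermHomogeneous 𝒱 (-1) f)
    (h0 : corestrict 𝒱 ∘ₗ f ∘ₗ f = 0) : f ∘ₗ f = 0 := by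
  have hsq : comul 𝒱 ∘ₗ f ∘ₗ f = (TensorProduct.map (f ∘ₗ f) LinearMap.id +
      TensorProduct.map (signTwist 𝒱 (-1) ∘ₗ signTwist 𝒱 (-1)) (f ∘ₗ f)) ∘ₗ comul 𝒱 := by
    have e : (TensorProduct.map f LinearMap.id + TensorProduct.map (signTwist 𝒱 (-1)) f) ∘ₗ
        (TensorProduct.map f LinearMap.id + TensorProduct.map (signTwist 𝒱 (-1)) f) =
        TensorProduct.map (f ∘ₗ f) LinearMap.id +
          TensorProduct.map (signTwist 𝒱 (-1) ∘ₗ signTwist 𝒱 (-1)) (f ∘ₗ f) := by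
      rw [LinearMap.add_comp, LinearMap.comp_add, LinearMap.comp_add, ← TensorProduct.map_comp,
        ← TensorProduct.map_comp, ← TensorProduct.map_comp, ← TensorProduct.map_comp,
        hdeg.signTwist_comp, LinearMap.id_comp, LinearMap.id_comp, LinearMap.comp_id]
      have : TensorProduct.map (-(f ∘ₗ signTwist 𝒱 (-1))) f =
          -TensorProduct.map (f ∘ₗ signTwist 𝒱 (-1)) f :=
        TensorProduct.ext' fun u v => by simp [TensorProduct.neg_tmul]
      rw [this]
      abel
    refine LinearMap.ext fun u => ?_
    have h1 := LinearMap.congr_fun hf (f u)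
    have h2 := LinearMap.congr_fun hf u
    rw [LinearMap.comp_apply, LinearMap.comp_apply] at h1 h2
    rw [← e, LinearMap.comp_apply, LinearMap.comp_apply, h1, h2]
    rfl
  have key : ∀ n, (f ∘ₗ f) ∘ₗ toPermCoalg 𝒱 n = 0 := by
    intro n
    induction n using Nat.strong_induction_on with
    | _ n ih =>
      refine LinearMap.ext fun t => ?_
      refine eq_zero_of_comul_eq_zero 𝒱 ?_ (LinearMap.congr_fun h0 _)
      rw [LinearMap.comp_apply, ← LinearMap.comp_apply (comul 𝒱), hsq, LinearMap.comp_apply,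
        comul_toPermCoalg, map_sum]
      refine Finset.sum_eq_zero fun a _ => ?_
      rw [map_smul, ← LinearMap.comp_apply, LinearMap.add_comp, ← TensorProduct.map_comp,
        ← TensorProduct.map_comp, ih a.1 a.2, ih (n - 1 - a.1) (by omega),
        TensorProduct.map_zero_left, TensorProduct.map_zero_right, add_zero, LinearMap.zero_apply,
        smul_zero]
  exact permCoalg_ext fun n t => LinearMap.congr_fun (key n) t

/-- The quadratic relation in degree `-1` is the projection of `q̃² = 0` to `V`. -/
theorem corestrict_coext_coext [CharZero K] (q : ∀ n, PermPart 𝒱 n →ₗ[K] V)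
    (p : ∀ n : ℕ, (⨂[K]^(n + 1) V) →ₗ[K] V) (hp : ∀ n, q n ∘ₗ permMk 𝒱 n = p n) (N : ℕ)
    (t : ⨂[K]^(N + 1) V) :
    corestrict 𝒱 (coext 𝒱 q (coext 𝒱 q (toPermCoalg 𝒱 N t))) =
      (∑ a : Fin (N + 1), ∑ m : Fin (a.1 + 1), (1 / (a.1.factorial * (N - a.1).factorial) : K) •
        (p a ∘ₗ idTensor 𝒱 (show a.1 + (N - a.1) = N by omega) m (-1) (p (N - a.1)) ∘ₗ
          ∑ σ : Equiv.Perm (Fin N), rho1 𝒱 (fixLast σ))) t := by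
  rw [coext_toPermCoalg, map_sum, map_sum, LinearMap.sum_apply]
  refine Finset.sum_congr rfl fun a _ => ?_
  rw [map_smul, map_smul, corestrict_coext, ← LinearMap.comp_apply (q a.1), hp, hp, insertSum,
    LinearMap.sum_apply, map_sum, Finset.smul_sum, LinearMap.sum_apply]
  refine Finset.sum_congr rfl fun m _ => ?_
  rw [LinearMap.smul_apply, one_div]
  rfl

/-- The equivalence of the equations in degree `-1` with the square-zero coderivation. -/
theorem satisfiesPLDegNegOne_iff [CharZero K] (p : ∀ n : ℕ, (⨂[K]^(n + 1) V) →ₗ[K] V)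
    (hp : ∀ n, IsHomogeneousOp 𝒱 (-1) (p n)) :
    SatisfiesPLDegNegOne 𝒱 p ↔ ∃ q : ∀ n : ℕ, PermPart 𝒱 n →ₗ[K] V,
      (∀ n, q n ∘ₗ permMk 𝒱 n = p n) ∧ IsCoderivation 𝒱 (-1) (coext 𝒱 q) ∧
        IsPermHomogeneous 𝒱 (-1) (coext 𝒱 q) ∧ coext 𝒱 q ∘ₗ coext 𝒱 q = 0 := by
  constructor
  · rintro ⟨hsymm, hrel⟩
    have hq : ∀ n, permLift 𝒱 (p n) (fun σ => (hsymm n σ).symm) ∘ₗ permMk 𝒱 n = p n :=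
      fun n => LinearMap.ext fun t => permLift_permMk 𝒱 _ (fun σ => (hsymm n σ).symm) t
    have hcod := isCoderivation_coext 𝒱 (fun n => permLift 𝒱 (p n) fun σ => (hsymm n σ).symm)
      fun n => by rw [hq]; exact (hp n).isParityOp
    have hdeg := isPermHomogeneous_coext (fun n => permLift 𝒱 (p n) fun σ => (hsymm n σ).symm)
      fun n => by rw [hq]; exact hp n
    refine ⟨_, hq, hcod, hdeg, comp_self_eq_zero 𝒱 hcod hdeg (permCoalg_ext fun N t => ?_)⟩
    exact (corestrict_coext_coext 𝒱 _ p hq N t).trans (LinearMap.congr_fun (hrel N) t)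
  · rintro ⟨q, hq, _, _, hsq⟩
    refine ⟨fun n σ => ?_, fun N => LinearMap.ext fun t => ?_⟩
    · rw [← hq, LinearMap.comp_assoc, permMk_comp_rho1]
    · rw [← corestrict_coext_coext 𝒱 q p hq N t, ← LinearMap.comp_apply (coext 𝒱 q), hsq,
        LinearMap.zero_apply, map_zero, LinearMap.zero_apply]

end

/-! ### Décalage -/

/-- In both cases of its definition `hatSign` is, with indices starting at `0`, the sign with
exponent `n + ∑ (n - 1 - i) d i`. -/
theorem hatSign_eq {n : ℕ} (d : Fin n → ZMod 2) :
    hatSign d = (-1) ^ ((n : ZMod 2) + ∑ i : Fin n, ((n : ZMod 2) + 1 + (i.1 : ZMod 2)) * d i) := by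
  have odd_cast : ∀ k : ℕ, Odd k → (k : ZMod 2) = 1 := fun k hk =>
    (ZMod.natCast_eq_one_iff_odd).2 hk
  have even_cast : ∀ k : ℕ, Even k → (k : ZMod 2) = 0 := fun k hk =>
    (ZMod.natCast_eq_zero_iff_even).2 hk
  unfold hatSign
  split_ifs with h
  · rw [even_cast n h, zero_add, Finset.sum_filter]
    congr 1
    refine Finset.sum_congr rfl fun i _ => ?_
    split_ifs with hi
    · rw [even_cast _ hi]; ring
    · rw [odd_cast _ (Nat.not_even_iff_odd.1 hi), zero_add, show (1 + 1 : ZMod 2) = 0 by decide,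
        zero_mul]
  · rw [odd_cast n (Nat.not_even_iff_odd.1 h), uzpow_add, uzpow_one, neg_one_mul, Finset.sum_filter]
    congr 2
    refine Finset.sum_congr rfl fun i _ => ?_
    rw [show (1 + 1 : ZMod 2) = 0 by decide, zero_add]
    split_ifs with hi
    · rw [odd_cast _ hi, one_mul]
    · rw [even_cast _ (Nat.not_odd_iff_even.1 hi), zero_mul]

theorem hatSign_mul_self {n : ℕ} (d : Fin n → ZMod 2) : hatSign d * hatSign d = 1 :=
  Int.units_mul_self _

section
variable (𝒱 : ℤ → Submodule K V) [DirectSum.Decomposition 𝒱]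

/-- The sign change of `⊗ⁿ V` by `hatSign` of the degrees. -/
def decalage (n : ℕ) : (⨂[K]^n V) →ₗ[K] (⨂[K]^n V) :=
  PiTensorProduct.lift (gradedExt 𝒱 fun d =>
    hatSign d • (PiTensorProduct.tprod K).domDomCongr (Equiv.refl (Fin n)))

theorem rho2_apply {n : ℕ} (σ : Equiv.Perm (Fin n)) (t : ⨂[K]^n V) :
    rho2 𝒱 σ t = Equiv.Perm.sign σ • rho1 𝒱 σ t :=
  rfl

variable {𝒱} in
theorem decalage_tprod {n : ℕ} {d : Fin n → ZMod 2} {x : Fin n → V}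
    (hx : ∀ i, parityProj 𝒱 (d i) (x i) = x i) :
    decalage 𝒱 n (PiTensorProduct.tprod K x) = hatSign d • PiTensorProduct.tprod K x := by
  rw [decalage, PiTensorProduct.lift.tprod, gradedExt_apply _ hx]
  rfl

theorem decalage_comp_decalage (n : ℕ) : decalage 𝒱 n ∘ₗ decalage 𝒱 n = LinearMap.id := by
  refine linear_ext (𝒱 := 𝒱) fun d x hx => ?_
  rw [LinearMap.comp_apply, decalage_tprod hx, map_zsmul_unit, decalage_tprod hx, smul_smul,
    hatSign_mul_self, one_smul]
  rfl

theorem hat_eq_comp_decalage (p : ∀ n : ℕ, (⨂[K]^(n + 1) V) →ₗ[K] V) (n : ℕ) :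
    hat 𝒱 p n = p n ∘ₗ decalage 𝒱 (n + 1) := by
  refine linear_ext (𝒱 := 𝒱) fun d x hx => ?_
  rw [LinearMap.comp_apply, decalage_tprod hx, map_zsmul_unit, hat, PiTensorProduct.lift.tprod,
    gradedExt_apply _ hx, units_smul_apply]
  rfl

theorem parityProj_susp (a : ZMod 2) (v : V) :
    parityProj (susp 𝒱) (a + 1) v = parityProj 𝒱 a v := by
  induction v using DirectSum.Decomposition.inductionOn 𝒱 with
  | zero => simp
  | @homogeneous i v =>
    have hv : (v : V) ∈ susp 𝒱 (i + 1) := by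
      rw [susp, add_sub_cancel_right]
      exact v.2
    rw [parityProj_of_mem 𝒱 a v.2, parityProj_of_mem (susp 𝒱) (a + 1) hv]
    simp
  | add v w hv hw => rw [map_add, map_add, hv, hw]

variable {𝒱} in
theorem parity_susp {n : ℕ} {d : Fin n → ZMod 2} {x : Fin n → V}
    (hx : ∀ i, parityProj 𝒱 (d i) (x i) = x i) (i : Fin n) :
    parityProj (susp 𝒱) (d i + 1) (x i) = x i := by
  rw [parityProj_susp, hx]

/-- Under décalage the signed action of the symmetric group becomes the unsigned one on the
suspension. -/
theorem rho1_susp : ∀ {n : ℕ} (σ : Equiv.Perm (Fin n)),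
    rho1 (susp 𝒱) σ = decalage 𝒱 n ∘ₗ rho2 𝒱 σ ∘ₗ decalage 𝒱 n
  | 0, σ => by
    obtain rfl := Subsingleton.elim σ 1
    rw [rho1_one, rho2, rho1_one, Equiv.Perm.sign_one, one_smul, LinearMap.id_comp,
      decalage_comp_decalage]
  | n + 1, σ => by
    have hmem : σ ∈ Submonoid.closure
        (Set.range fun i : Fin n => Equiv.swap i.castSucc i.succ) := by
      rw [Equiv.Perm.mclosure_swap_castSucc_succ]
      exact Submonoid.mem_top σ
    induction hmem using Submonoid.closure_induction with
    | one =>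
      rw [rho1_one, rho2, rho1_one, Equiv.Perm.sign_one, one_smul, LinearMap.id_comp,
        decalage_comp_decalage]
    | mul τ₁ τ₂ _ _ h₁ h₂ =>
      have h : rho2 𝒱 (τ₁ * τ₂) = rho2 𝒱 τ₂ ∘ₗ rho2 𝒱 τ₁ := LinearMap.ext fun t => by
        rw [LinearMap.comp_apply, rho2_apply, rho2_apply, rho2_apply, map_zsmul_unit, smul_smul,
          rho1_mul, Equiv.Perm.sign_mul, LinearMap.comp_apply, mul_comm]
      refine LinearMap.ext fun t => ?_
      have hθ := fun u => LinearMap.congr_fun (decalage_comp_decalage 𝒱 (n + 1)) u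
      simp only [LinearMap.comp_apply, LinearMap.id_apply] at hθ
      rw [rho1_mul, h₁, h₂, h]
      simp only [LinearMap.comp_apply, hθ]
    | mem τ hτ =>
      obtain ⟨j, hτ⟩ := hτ
      replace hτ : Equiv.swap j.castSucc j.succ = τ := hτ
      have hs : IsBlockShift τ j.1 1 := hτ ▸ isBlockShift_swap j
      have hsgn : Equiv.Perm.sign τ = -1 := hτ ▸ Equiv.Perm.sign_swap (Fin.castSucc_lt_succ).ne
      have hinv : ∀ i, τ (τ i) = i := hτ ▸ Equiv.swap_apply_self _ _
      have hj : j.1 + 1 < n + 1 := by omega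
      refine linear_ext (𝒱 := 𝒱) fun d x hx => ?_
      rw [LinearMap.comp_apply, LinearMap.comp_apply, decalage_tprod hx, map_zsmul_unit,
        rho2_apply, rho1_tprod 𝒱 _ hx, map_zsmul_unit, map_zsmul_unit, map_zsmul_unit,
        decalage_tprod (d := fun i => d (τ i)) (fun i => hx (τ i)),
        rho1_tprod (susp 𝒱) τ (parity_susp hx), smul_smul, smul_smul, smul_smul]
      congr 1
      have hsum : ∑ i, ((n + 1 : ℕ) + 1 + (i.1 : ZMod 2)) * d i +
          ∑ i, ((n + 1 : ℕ) + 1 + (i.1 : ZMod 2)) * d (τ i) = d j.castSucc + d j.succ := by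
        rw [← Equiv.sum_comp τ (fun i => ((n + 1 : ℕ) + 1 + (i.1 : ZMod 2)) * d (τ i)),
          ← Finset.sum_add_distrib]
        simp only [hinv, ← add_mul]
        have two : ∀ z : ZMod 2, z + z = 0 := CharTwo.add_self_eq_zero
        rw [Fintype.sum_eq_add j.castSucc j.succ (Fin.castSucc_lt_succ).ne]
        · have h1 := hs j.castSucc
          have h2 := hs j.succ
          simp only [Fin.val_castSucc, Fin.val_succ, if_true] at h1 h2
          rw [if_neg (by omega), if_pos (by omega)] at h2
          rw [h1, h2]
          simp only [Fin.val_castSucc, Fin.val_succ]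
          push_cast
          rw [show ∀ u v : ZMod 2, (u + v + (u + (v + 1))) = 1 by decide,
            show ∀ u v : ZMod 2, (u + (v + 1) + (u + v)) = 1 by decide, one_mul, one_mul]
        · rintro i ⟨hi1, hi2⟩
          have h1 := hs i
          have hi1' : i.1 ≠ j.1 := fun h => hi1 (Fin.ext h)
          have hi2' : i.1 ≠ j.1 + 1 := fun h => hi2 (Fin.ext h)
          rw [if_neg hi1', if_neg (by omega)] at h1
          rw [h1, two, zero_mul]
      have e0 : hatSign d * hatSign (fun i => d (τ i)) = (-1) ^ (d j.castSucc + d j.succ) := by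
        rw [hatSign_eq, hatSign_eq, ← uzpow_add, ← hsum]
        congr 1
        have two : ∀ z : ZMod 2, z + z = 0 := CharTwo.add_self_eq_zero
        linear_combination two ((n + 1 : ℕ) : ZMod 2)
      obtain ⟨D, rfl⟩ := exists_eq_comp_val d
      have k1 := (koszulSign_blockShift hs hj fun k => D k + 1).trans
        (by rw [Finset.sum_range_one]; rfl :
          _ = (-1 : ℤˣ) ^ ((D (j.1 + 1) + 1) * (D j.1 + 1)))
      have k2 := (koszulSign_blockShift hs hj D).trans
        (by rw [Finset.sum_range_one]; rfl : _ = (-1 : ℤˣ) ^ (D (j.1 + 1) * D j.1))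
      rw [k1, k2, hsgn]
      simp only [mul_assoc]
      rw [mul_left_comm, mul_left_comm (hatSign _), e0]
      simp only [Fin.val_castSucc, Fin.val_succ]
      have : (-1 : ℤˣ) = (-1) ^ (1 : ZMod 2) := (uzpow_one _).symm
      rw [this, ← uzpow_mul, ← uzpow_mul, ← uzpow_mul, one_mul, one_mul, one_mul,
        ← uzpow_add, ← uzpow_add]
      congr 1
      ring

theorem insertTuple_eq_update {N a b : ℕ} (h : a + b = N) (m : Fin (a + 1))
    (f g : (⨂[K]^(b + 1) V) →ₗ[K] V) (x : Fin (N + 1) → V) :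
    insertTuple h m f x = Function.update (insertTuple h m g x) m
      (f (PiTensorProduct.tprod K fun s : Fin (b + 1) => x ⟨m + s, by omega⟩)) := by
  funext t
  by_cases ht : t = m
  · subst ht
    simp [insertTuple]
  · rw [Function.update_of_ne ht]
    simp only [insertTuple, if_neg ht]

/-- The sign comparison behind `idTensor_susp`: the décalage signs of the inner and the outer
operation combine to that of all the arguments, up to the sign of the quadratic relation. -/
theorem hatSign_insertDeg {N a b : ℕ} (h : a + b = N) (m : Fin (a + 1)) (d : Fin (N + 1) → ZMod 2) :
    (-1 : ℤˣ) ^ (((-1 : ℤ) : ZMod 2) * ∑ t : Fin (N + 1) with t.1 < m.1, (d t + 1)) *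
      hatSign (fun s : Fin (b + 1) => d ⟨m + s, by omega⟩) =
    -(-1) ^ ((b + 1) * (a - m.1) + m.1) * (hatSign d *
      ((-1 : ℤˣ) ^ ((((b : ℤ) - 1 : ℤ) : ZMod 2) * ∑ t : Fin (N + 1) with t.1 < m.1, d t) *
        hatSign (insertDeg h m (((b : ℤ) - 1 : ℤ) : ZMod 2) d))) := by
  have two : ∀ z : ZMod 2, z + z = 0 := CharTwo.add_self_eq_zero
  have hneg : (-1 : ZMod 2) = 1 := by decide
  obtain ⟨D, rfl⟩ := exists_eq_comp_val d
  subst h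
  have hm : m.1 ≤ a := by omega
  set e : ZMod 2 := (((b : ℤ) - 1 : ℤ) : ZMod 2) with he
  have he' : e = (b : ZMod 2) + 1 := by
    rw [he]; push_cast; rw [sub_eq_add_neg, hneg]
  -- `P` and `Q` are the contributions of the arguments before and inside the inner operation
  set P := ∑ k ∈ Finset.range m.1, D k with hP
  set Q := ∑ s ∈ Finset.range (b + 1), ((b : ZMod 2) + s) * D (m.1 + s) with hQ
  have s1 : ∑ t : Fin (a + b + 1) with t.1 < m.1, (D t.1 + 1) = P + m.1 := by
    rw [sum_fin_filter_lt (by omega) (fun k => D k + 1), Finset.sum_add_distrib]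
    simp [hP]
  have s2 : ∑ t : Fin (a + b + 1) with t.1 < m.1, D t.1 = P := sum_fin_filter_lt (by omega) D
  have s3 : ∑ i : Fin (b + 1), (((b + 1 : ℕ) : ZMod 2) + 1 + (i.1 : ZMod 2)) * D (m.1 + i.1) =
      Q := by
    rw [Fin.sum_univ_eq_sum_range
      (fun s => (((b + 1 : ℕ) : ZMod 2) + 1 + (s : ZMod 2)) * D (m.1 + s)) (b + 1), hQ]
    refine Finset.sum_congr rfl fun s _ => ?_
    push_cast
    rw [show ∀ u v : ZMod 2, u + 1 + 1 + v = u + v by decide]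
  have s4 : ∑ i : Fin (a + b + 1), (((a + b + 1 : ℕ) : ZMod 2) + 1 + (i.1 : ZMod 2)) * D i.1 +
      ∑ i : Fin (a + 1), (((a + 1 : ℕ) : ZMod 2) + 1 + (i.1 : ZMod 2)) *
        insertDeg rfl m e (fun s : Fin (a + b + 1) => D s.1) i =
      b * P + Q + ((a : ZMod 2) + m.1) * e := by
    simp only [insertDeg_val]
    rw [Fin.sum_univ_eq_sum_range
        (fun k => (((a + b + 1 : ℕ) : ZMod 2) + 1 + (k : ZMod 2)) * D k) (a + b + 1),
      Fin.sum_univ_eq_sum_range (fun t => (((a + 1 : ℕ) : ZMod 2) + 1 + (t : ZMod 2)) *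
        (if t < m.1 then D t else if t = m.1 then ∑ s ∈ Finset.range (b + 1), D (m.1 + s) + e
          else D (t + b))) (a + 1)]
    have h0 := (sum_range_insertDeg (b := b) hm (0 : ZMod 2)
      (fun k => (((a + b + 1 : ℕ) : ZMod 2) + 1 + (k : ZMod 2)) * D k)).trans (add_zero _)
    beta_reduce at h0
    rw [← h0, ← Finset.sum_add_distrib]
    have h1 : ∀ t ∈ Finset.range (a + 1),
        ((if t < m.1 then (((a + b + 1 : ℕ) : ZMod 2) + 1 + (t : ZMod 2)) * D t else
          if t = m.1 then ∑ s ∈ Finset.range (b + 1),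
            (((a + b + 1 : ℕ) : ZMod 2) + 1 + ((m.1 + s : ℕ) : ZMod 2)) * D (m.1 + s) + 0
          else (((a + b + 1 : ℕ) : ZMod 2) + 1 + ((t + b : ℕ) : ZMod 2)) * D (t + b)) +
        (((a + 1 : ℕ) : ZMod 2) + 1 + (t : ZMod 2)) *
          (if t < m.1 then D t else if t = m.1 then ∑ s ∈ Finset.range (b + 1), D (m.1 + s) + e
            else D (t + b))) =
        (if t < m.1 then b * D t else 0) +
          (if t = m.1 then Q + ((a : ZMod 2) + m.1) * e else 0) := by
      intro t _
      push_cast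
      by_cases c1 : t < m.1
      · rw [if_pos c1, if_pos c1, if_pos c1, if_neg (by omega), ← add_mul, add_zero]
        congr 1
        generalize (a : ZMod 2) = a', (b : ZMod 2) = b', (t : ZMod 2) = t'
        revert a' b' t'
        decide
      by_cases c2 : t = m.1
      · rw [if_neg c1, if_pos c2, if_neg c1, if_pos c2, if_neg c1, if_pos c2, mul_add, add_zero,
          Finset.mul_sum, ← add_assoc, ← Finset.sum_add_distrib, zero_add, c2, hQ]
        congr 1
        · refine Finset.sum_congr rfl fun s _ => ?_
          rw [← add_mul]
          congr 1
          generalize (a : ZMod 2) = a', (b : ZMod 2) = b', (m.1 : ZMod 2) = m', (s : ZMod 2) = s'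
          revert a' b' m' s'
          decide
        · rw [show ∀ u v : ZMod 2, u + 1 + 1 + v = u + v by decide]
      · rw [if_neg c1, if_neg c2, if_neg c1, if_neg c2, if_neg c1, if_neg c2, add_zero, ← add_mul]
        generalize (a : ZMod 2) = a', (b : ZMod 2) = b', (t : ZMod 2) = t', D (t + b) = v
        revert a' b' t' v
        decide
    rw [Finset.sum_congr rfl h1, Finset.sum_add_distrib, Finset.sum_ite_eq',
      if_pos (by simp; omega), ← Finset.sum_filter,
      show (Finset.range (a + 1)).filter (fun t => t < m.1) =
        Finset.range m.1 by ext t; simp; omega, ← Finset.mul_sum, add_assoc]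
  have hcast : ((a - m.1 : ℕ) : ZMod 2) = (a : ZMod 2) + m.1 := by
    rw [Nat.cast_sub hm, sub_eq_add_neg, ← neg_one_mul (m.1 : ZMod 2), hneg, one_mul]
  have hκ : (-(-1 : ℤˣ) ^ ((b + 1) * (a - m.1) + m.1)) =
      (-1) ^ ((1 : ZMod 2) + (((b : ZMod 2) + 1) * ((a : ZMod 2) + m.1) + m.1)) := by
    rw [uzpow_add (-1) (1 : ZMod 2), uzpow_one (R := ZMod 2), neg_one_mul,
      ← uzpow_natCast (R := ZMod 2)]
    push_cast
    rw [hcast]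
  rw [s1, s2, hκ, hatSign_eq, hatSign_eq, hatSign_eq, s3, ← uzpow_add, ← uzpow_add, ← uzpow_add,
    ← uzpow_add]
  congr 1
  rw [he'] at s4 ⊢
  push_cast at s4 ⊢
  rw [hneg]
  linear_combination (-1 : ZMod 2) * s4 - two (1 + P * b + m.1 + m.1 * b + b * a + a + a)

/-- Under décalage the insertion of `p` becomes the insertion of `p̂` on the suspension, up to the
sign of the quadratic relation and a global sign `-1`. -/
theorem idTensor_susp {N a b : ℕ} (h : a + b = N) (m : Fin (a + 1))
    {p : (⨂[K]^(b + 1) V) →ₗ[K] V} (hp : IsParityOp 𝒱 (((b : ℤ) - 1 : ℤ) : ZMod 2) p) :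
    idTensor (susp 𝒱) h m (-1) (p ∘ₗ decalage 𝒱 (b + 1)) =
      (-(-1 : K) ^ ((b + 1) * (a - m.1) + m.1)) •
        (decalage 𝒱 (a + 1) ∘ₗ idTensor 𝒱 h m ((b : ℤ) - 1) p ∘ₗ decalage 𝒱 (N + 1)) := by
  have hK : ∀ u : ⨂[K]^(a + 1) V, (-(-1 : K) ^ ((b + 1) * (a - m.1) + m.1)) • u =
      (-(-1 : ℤˣ) ^ ((b + 1) * (a - m.1) + m.1)) • u := fun u => by
    rw [Units.smul_def, ← Int.cast_smul_eq_zsmul K]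
    push_cast
    rfl
  refine linear_ext (𝒱 := 𝒱) fun d x hx => ?_
  rw [idTensor_tprod h m (-1) _ (parity_susp hx), LinearMap.smul_apply, hK, LinearMap.comp_apply,
    LinearMap.comp_apply, decalage_tprod hx, map_zsmul_unit, map_zsmul_unit,
    idTensor_tprod h m _ p hx, map_zsmul_unit, decalage_tprod (parity_insertTuple h m hp hx),
    insertTuple_eq_update h m (p ∘ₗ decalage 𝒱 (b + 1)) p, LinearMap.comp_apply,
    decalage_tprod (d := fun s : Fin (b + 1) => d ⟨m + s, by omega⟩) (fun s => hx _), map_zsmul_unit,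
    ← MultilinearMap.toLinearMap_apply, map_zsmul_unit, MultilinearMap.toLinearMap_apply,
    ← insertTuple_eq_update h m p p, smul_smul, smul_smul, smul_smul, smul_smul, hatSign_insertDeg h]
  simp only [mul_assoc]

/-- Décalage turns the equations in degrees `n - 2` into those in degree `-1`. -/
theorem satisfiesPLDegNSubTwo_iff (p : ∀ n : ℕ, (⨂[K]^(n + 1) V) →ₗ[K] V)
    (hp : ∀ n : ℕ, IsHomogeneousOp 𝒱 ((n : ℤ) - 1) (p n)) :
    SatisfiesPLDegNSubTwo 𝒱 p ↔ SatisfiesPLDegNegOne (susp 𝒱) (hat 𝒱 p) := by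
  have hθ : ∀ n (u : ⨂[K]^n V), decalage 𝒱 n (decalage 𝒱 n u) = u := fun n u =>
    LinearMap.congr_fun (decalage_comp_decalage 𝒱 n) u
  have cancel : ∀ {n : ℕ} (f g : (⨂[K]^n V) →ₗ[K] V),
      f ∘ₗ decalage 𝒱 n = g ∘ₗ decalage 𝒱 n ↔ f = g := fun {n} f g => by
    refine ⟨fun h => LinearMap.ext fun u => ?_, fun h => by rw [h]⟩
    have := LinearMap.congr_fun h (decalage 𝒱 n u)
    rwa [LinearMap.comp_apply, LinearMap.comp_apply, hθ] at this
  unfold SatisfiesPLDegNSubTwo SatisfiesPLDegNegOne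
  refine and_congr (forall_congr' fun n => forall_congr' fun σ => ?_) (forall_congr' fun N => ?_)
  · have : hat 𝒱 p n ∘ₗ rho1 (susp 𝒱) (fixLast σ) =
        (p n ∘ₗ rho2 𝒱 (fixLast σ)) ∘ₗ decalage 𝒱 (n + 1) := LinearMap.ext fun u => by
      rw [hat_eq_comp_decalage, rho1_susp]
      simp only [LinearMap.comp_apply, hθ]
    rw [this, hat_eq_comp_decalage, cancel]
  · have hsum : (∑ σ : Equiv.Perm (Fin N), rho1 (susp 𝒱) (fixLast σ)) =
        decalage 𝒱 (N + 1) ∘ₗ (∑ σ : Equiv.Perm (Fin N), rho2 𝒱 (fixLast σ)) ∘ₗ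
          decalage 𝒱 (N + 1) := LinearMap.ext fun u => by
      simp only [rho1_susp, LinearMap.sum_apply, LinearMap.comp_apply, map_sum]
    have hterm : ∀ (a : Fin (N + 1)) (m : Fin (a.1 + 1)),
        (1 / (a.1.factorial * (N - a.1).factorial) : K) •
          (hat 𝒱 p a ∘ₗ idTensor (susp 𝒱) (show a.1 + (N - a.1) = N by omega) m (-1)
            (hat 𝒱 p (N - a.1)) ∘ₗ ∑ σ : Equiv.Perm (Fin N), rho1 (susp 𝒱) (fixLast σ)) =
        (-(((-1 : K) ^ ((N - a.1 + 1) * (a.1 - m.1) + m.1) /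
            (a.1.factorial * (N - a.1).factorial)) •
          (p a ∘ₗ idTensor 𝒱 (show a.1 + (N - a.1) = N by omega) m (((N - a.1 : ℕ) : ℤ) - 1)
            (p (N - a.1)) ∘ₗ ∑ σ : Equiv.Perm (Fin N), rho2 𝒱 (fixLast σ)))) ∘ₗ
              decalage 𝒱 (N + 1) := fun a m => LinearMap.ext fun u => by
      rw [hsum, hat_eq_comp_decalage, hat_eq_comp_decalage,
        idTensor_susp 𝒱 (show a.1 + (N - a.1) = N by omega) m (hp (N - a.1)).isParityOp]
      simp only [LinearMap.comp_apply, LinearMap.smul_apply, map_smul, hθ,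
        smul_smul, ← neg_smul]
      congr 1
      ring
    simp only [hterm]
    rw [← cancel _ 0, LinearMap.zero_comp, ← neg_eq_zero]
    refine Eq.congr (LinearMap.ext fun u => ?_) rfl
    simp only [LinearMap.sum_apply, LinearMap.comp_apply, LinearMap.neg_apply,
      Finset.sum_neg_distrib]

end

end
end PLInf

theorem theorem3p6 {K V : Type*} [Field K] [CharZero K] [AddCommGroup V] [Module K V]
    (𝒱 : ℤ → Submodule K V) [DirectSum.Decomposition 𝒱]
    (p : ∀ n : ℕ, (PiTensorProduct K fun _ : Fin (n + 1) => V) →ₗ[K] V)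
    (hp : ∀ n : ℕ, PLInf.IsHomogeneousOp 𝒱 ((n : ℤ) - 1) (p n)) :
    List.TFAE [
      PLInf.SatisfiesPLDegNSubTwo 𝒱 p,
      PLInf.SatisfiesPLDegNegOne (PLInf.susp 𝒱) (PLInf.hat 𝒱 p),
      ∃ q : ∀ n : ℕ, PLInf.PermPart (PLInf.susp 𝒱) n →ₗ[K] V,
        (∀ n, q n ∘ₗ PLInf.permMk (PLInf.susp 𝒱) n = PLInf.hat 𝒱 p n) ∧
        PLInf.IsCoderivation (PLInf.susp 𝒱) (-1) (PLInf.coext (PLInf.susp 𝒱) q) ∧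
        PLInf.IsPermHomogeneous (PLInf.susp 𝒱) (-1) (PLInf.coext (PLInf.susp 𝒱) q) ∧
        PLInf.coext (PLInf.susp 𝒱) q ∘ₗ PLInf.coext (PLInf.susp 𝒱) q = 0] := by
  tfae_have 1 ↔ 2 := PLInf.satisfiesPLDegNSubTwo_iff 𝒱 p hp
  tfae_have 2 ↔ 3 := PLInf.satisfiesPLDegNegOne_iff (PLInf.susp 𝒱) (PLInf.hat 𝒱 p)
    (PLInf.hat_homogeneous 𝒱 p hp)
  tfae_finish
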